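/- Let $d\in\mathbb N$, $\kappa\ge 0$, and let $V:[0,\infty)\times\mathbb R^d\to\mathbb R$ satisfy: * **V1.** There is $\lambda\in L^\infty_{loc}([0,\infty))$, $\lambda:[0,\infty)\to\mathbb R$, such that for every $t\ge 0$ the function $x\mapsto V(t,x)-\frac{\lambda(t)}2|x|^2$ is convex. * **V2.** With $\partial^\circ V(t,0)$ the element of minimal norm of the (Fréchet) subdifferential of $V(t,\cdot)$ at $0$, the functions $t\mapsto|\partial^\circ V(t,0)|$ and $t\mapsto -V(t,0)$ are bounded above on every $[0,T]$. * **V3.** There is $\beta\in L^1_{loc}([0,\infty))$ with $|V(s,x)-V(t,x)|\le\int_s^t\beta(r)\,dr\,(1+|x|^2)$ for all $0\le s<t$ and $x\in\mathbb R^d$. Let $X=\mathscr P_2(\mathbb R^d)$ be the space of Borel probability measures with finite second moment, with the quadratic Wasserstein distance $\mathbf d_2$. Put $\mathcal U(\mu)=\int\rho\log\rho\,dx$ if $d\mu=\rho\,dx$ and $\mathcal U(\mu)=+\infty$ if $\mu$ is not absolutely continuous, $\mathcal V(t,\mu)=\int V(t,x)\,d\mu(x)$, and $\mathcal E_1(t,\mu)=\kappa\,\mathcal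 U(\mu)+\mathcal V(t,\mu)$ (with $\mathcal E_1=\mathcal V$ if $\kappa=0$). Assume that there is $\mu\in\mathscr P_2(\mathbb R^d)$, $d\mu=\rho\,dx$, with $\int\rho\log\rho\,dx<\infty$ and $\int V(0,x)\,d\mu(x)<\infty$. Then $\mathcal E=\mathcal E_1$ satisfies the following on $(X,d)=(\mathscr P_2(\mathbb R^d),\mathbf d_2)$, where $\mathbf E(t,\tau,u;v)=\mathcal E(t,v)+\frac{d^2(u,v)}{2\tau}$: * **E1.** For each $t\ge0$, $\mathcal E(t,\cdot)$ takes values in $(-\infty,+\infty]$, is not identically $+\infty$, and is lower semicontinuous. * **E2.** The domain $\mathbf D=\{u:\mathcal E(t,u)<\infty\}$ does not depend on $t\ge 0$. * **E3.** There are $u^*\in X$ and $\beta:[0,\infty)\to[0,\infty)$ in $L^1_{loc}([0,\infty))$ with $|\mathcal E(t,u)-\mathcal E(s,u)|\le\int_s^t\beta(r)\,dr\,(1+d^2(u,u^*))$ for all $u\in\mathbf D$ and $0\le s\le t$. * **E4.** For each $T>0$ there are $u^*\in X$ and $\tau^*>0$ such that $t\mapsto\inf_{v\in X}\mathbf E(t,\tau^*,u^*;v)$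 is bounded from below on $[0,T]$. * **E5.** With the function $\lambda$ of V1: for all $u,v_0,v_1\in X$ there is a continuous curve $\gamma:[0,1]\to X$ with $\gamma(0)=v_0$, $\gamma(1)=v_1$ such that for all $T>0$, $t\in[0,T]$, $s\in[0,1]$ and $0<\tau<1/\lambda_T^-$, $$\mathbf E(t,\tau,u;\gamma(s))\le(1-s)\mathbf E(t,\tau,u;v_0)+s\,\mathbf E(t,\tau,u;v_1)-\frac{1+\tau\lambda(t)}{2\tau}\,s(1-s)\,d^2(v_0,v_1),$$ where $\lambda_T^-=\max\{-\operatorname{ess\,inf}_{[0,T]}\lambda,0\}$ and $1/0=+\infty$. -/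

import Mathlib

open MeasureTheory ProbabilityTheory Set Filter Topology
open scoped ENNReal

namespace TimeDepFlow

noncomputable section

/-! ### The Wasserstein space `𝒫₂(ℝᵈ)` -/

/-- Borel probability measures on `ℝᵈ` with finite second moment. -/
@[ext]
structure WassersteinSpace (d : ℕ) where
  measure : Measure (EuclideanSpace ℝ (Fin d))
  isProbabilityMeasure : IsProbabilityMeasure measure
  integrable_norm_sq : Integrable (fun x => ‖x‖ ^ 2) measure

instance {d : ℕ} (μ : WassersteinSpace d) : IsProbabilityMeasure μ.measure :=
  μ.isProbabilityMeasure

/-- `γ` has first marginal `μ` and second marginal `ν`. -/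
def IsCoupling {d : ℕ}
    (γ : Measure (EuclideanSpace ℝ (Fin d) × EuclideanSpace ℝ (Fin d)))
    (μ ν : WassersteinSpace d) : Prop :=
  γ.map Prod.fst = μ.measure ∧ γ.map Prod.snd = ν.measure

/-- The quadratic cost `∫ |x - y|² dγ(x, y)` of a transport plan. -/
def transportCost {d : ℕ}
    (γ : Measure (EuclideanSpace ℝ (Fin d) × EuclideanSpace ℝ (Fin d))) : ℝ≥0∞ :=
  ∫⁻ p, ‖p.1 - p.2‖ₑ ^ 2 ∂γ

/-- The squared Wasserstein distance, as an extended nonnegative number. -/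
def wassersteinSq {d : ℕ} (μ ν : WassersteinSpace d) : ℝ≥0∞ :=
  ⨅ γ : {γ : Measure (EuclideanSpace ℝ (Fin d) × EuclideanSpace ℝ (Fin d)) //
    IsCoupling γ μ ν}, transportCost γ.1

/-- The quadratic Wasserstein distance `𝐝₂`. -/
def wassersteinDist {d : ℕ} (μ ν : WassersteinSpace d) : ℝ :=
  Real.sqrt (wassersteinSq μ ν).toReal

section WassersteinMetric

variable {d : ℕ}

theorem measurable_cost :
    Measurable (fun p : EuclideanSpace ℝ (Fin d) × EuclideanSpace ℝ (Fin d) =>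
      ‖p.1 - p.2‖ₑ ^ 2) := by
  fun_prop

theorem lintegral_enorm_sq_lt_top (μ : WassersteinSpace d) :
    ∫⁻ x, ‖x‖ₑ ^ 2 ∂μ.measure < ∞ := by
  have h := μ.integrable_norm_sq.2
  simpa [HasFiniteIntegral, enorm_pow] using h

theorem isCoupling_prod (μ ν : WassersteinSpace d) :
    IsCoupling (μ.measure.prod ν.measure) μ ν := by
  simp [IsCoupling, Measure.map_fst_prod, Measure.map_snd_prod]

theorem IsCoupling.transportCost_lt_top
    {γ : Measure (EuclideanSpace ℝ (Fin d) × EuclideanSpace ℝ (Fin d))}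
    {μ ν : WassersteinSpace d} (h : IsCoupling γ μ ν) : transportCost γ < ∞ := by
  have h1 : ∫⁻ p, ‖p.1‖ₑ ^ 2 ∂γ < ∞ := by
    have := lintegral_enorm_sq_lt_top μ
    rwa [← h.1, lintegral_map (by fun_prop) measurable_fst] at this
  have h2 : ∫⁻ p, ‖p.2‖ₑ ^ 2 ∂γ < ∞ := by
    have := lintegral_enorm_sq_lt_top ν
    rwa [← h.2, lintegral_map (by fun_prop) measurable_snd] at this
  have hle : transportCost γ ≤ ∫⁻ p, (2 * ‖p.1‖ₑ ^ 2 + 2 * ‖p.2‖ₑ ^ 2) ∂γ := by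
    refine lintegral_mono fun p => ?_
    calc ‖p.1 - p.2‖ₑ ^ 2 ≤ (‖p.1‖ₑ + ‖p.2‖ₑ) ^ 2 := by
          gcongr
          exact enorm_sub_le
      _ ≤ 2 * ‖p.1‖ₑ ^ 2 + 2 * ‖p.2‖ₑ ^ 2 := by
          have : (‖p.1‖₊ + ‖p.2‖₊) ^ 2 ≤ 2 * ‖p.1‖₊ ^ 2 + 2 * ‖p.2‖₊ ^ 2 := by
            rw [← NNReal.coe_le_coe]
            push_cast
            nlinarith [sq_nonneg (‖p.1‖ - ‖p.2‖)]
          simp only [enorm_eq_nnnorm]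
          exact_mod_cast this
  refine hle.trans_lt ?_
  rw [lintegral_add_left (by fun_prop), lintegral_const_mul _ (by fun_prop),
    lintegral_const_mul _ (by fun_prop)]
  exact ENNReal.add_lt_top.2 ⟨ENNReal.mul_lt_top (by simp) h1, ENNReal.mul_lt_top (by simp) h2⟩

theorem wassersteinSq_lt_top (μ ν : WassersteinSpace d) : wassersteinSq μ ν < ∞ :=
  (iInf_le _ ⟨_, isCoupling_prod μ ν⟩).trans_lt (isCoupling_prod μ ν).transportCost_lt_top

theorem wassersteinSq_self (μ : WassersteinSpace d) : wassersteinSq μ μ = 0 := by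
  have hm : Measurable (fun x : EuclideanSpace ℝ (Fin d) => (x, x)) := by fun_prop
  have hc : IsCoupling (μ.measure.map fun x => (x, x)) μ μ := by
    constructor
    · rw [Measure.map_map measurable_fst hm]
      exact Measure.map_id
    · rw [Measure.map_map measurable_snd hm]
      exact Measure.map_id
  refine le_antisymm ((iInf_le _ ⟨_, hc⟩).trans ?_) zero_le
  simp [transportCost, lintegral_map measurable_cost hm]

theorem wassersteinSq_le_swap (μ ν : WassersteinSpace d) :
    wassersteinSq μ ν ≤ wassersteinSq ν μ := by
  refine le_iInf fun γ => ?_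
  have hc : IsCoupling (γ.1.map Prod.swap) μ ν := by
    constructor
    · rw [Measure.map_map measurable_fst measurable_swap]
      exact γ.2.2
    · rw [Measure.map_map measurable_snd measurable_swap]
      exact γ.2.1
  refine (iInf_le _ ⟨_, hc⟩).trans (le_of_eq ?_)
  simp only [transportCost]
  rw [lintegral_map measurable_cost measurable_swap]
  refine lintegral_congr fun p => ?_
  simp [enorm_sub_rev]

/-- Gluing of two transport plans along their common marginal. -/
theorem exists_gluing {μ ν ρ : WassersteinSpace d}
    {γ₁ γ₂ : Measure (EuclideanSpace ℝ (Fin d) × EuclideanSpace ℝ (Fin d))}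
    (h₁ : IsCoupling γ₁ ν μ) (h₂ : IsCoupling γ₂ ν ρ) :
    ∃ π : Measure (EuclideanSpace ℝ (Fin d) ×
        (EuclideanSpace ℝ (Fin d) × EuclideanSpace ℝ (Fin d))),
      π.map (fun p => (p.1, p.2.1)) = γ₁ ∧ π.map (fun p => (p.1, p.2.2)) = γ₂ := by
  have i₁ : IsFiniteMeasure γ₁ := by
    have : IsFiniteMeasure (γ₁.map Prod.fst) := by rw [h₁.1]; infer_instance
    exact Measure.isFiniteMeasure_of_map measurable_fst.aemeasurable
  have i₂ : IsFiniteMeasure γ₂ := by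
    have : IsFiniteMeasure (γ₂.map Prod.fst) := by rw [h₂.1]; infer_instance
    exact Measure.isFiniteMeasure_of_map measurable_fst.aemeasurable
  have e₁ : ν.measure ⊗ₘ γ₁.condKernel = γ₁ := by
    rw [← h₁.1]; exact γ₁.disintegrate γ₁.condKernel
  have e₂ : ν.measure ⊗ₘ γ₂.condKernel = γ₂ := by
    rw [← h₂.1]; exact γ₂.disintegrate γ₂.condKernel
  refine ⟨ν.measure ⊗ₘ (γ₁.condKernel ×ₖ γ₂.condKernel), ?_, ?_⟩
  · conv_rhs => rw [← e₁, ← Kernel.fst_prod γ₁.condKernel γ₂.condKernel, Kernel.fst_eq,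
      Measure.compProd_map measurable_fst]
    rfl
  · conv_rhs => rw [← e₂, ← Kernel.snd_prod γ₁.condKernel γ₂.condKernel, Kernel.snd_eq,
      Measure.compProd_map measurable_snd]
    rfl

theorem rpow_wassersteinSq_le (μ ν ρ : WassersteinSpace d) :
    (wassersteinSq μ ρ) ^ (1 / 2 : ℝ) ≤
      (wassersteinSq μ ν) ^ (1 / 2 : ℝ) + (wassersteinSq ν ρ) ^ (1 / 2 : ℝ) := by
  have key : ∀ γ₁ γ₂ : Measure (EuclideanSpace ℝ (Fin d) × EuclideanSpace ℝ (Fin d)),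
      IsCoupling γ₁ ν μ → IsCoupling γ₂ ν ρ →
      (wassersteinSq μ ρ) ^ (1 / 2 : ℝ) ≤
        (transportCost γ₁) ^ (1 / 2 : ℝ) + (transportCost γ₂) ^ (1 / 2 : ℝ) := by
    intro γ₁ γ₂ h₁ h₂
    obtain ⟨π, rfl, rfl⟩ := exists_gluing h₁ h₂
    have hc : IsCoupling (π.map Prod.snd) μ ρ := by
      constructor
      · rw [← h₁.2, Measure.map_map (by fun_prop) (by fun_prop),
          Measure.map_map (by fun_prop) (by fun_prop)]
        rfl
      · rw [← h₂.2, Measure.map_map (by fun_prop) (by fun_prop),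
          Measure.map_map (by fun_prop) (by fun_prop)]
        rfl
    have hle : wassersteinSq μ ρ ≤ transportCost (π.map Prod.snd) :=
      iInf_le (fun γ : {γ : Measure (EuclideanSpace ℝ (Fin d) × EuclideanSpace ℝ (Fin d)) //
        IsCoupling γ μ ρ} => transportCost γ.1) ⟨_, hc⟩
    refine (ENNReal.rpow_le_rpow hle (by norm_num)).trans ?_
    simp only [transportCost]
    rw [lintegral_map measurable_cost (by fun_prop), lintegral_map measurable_cost (by fun_prop),
      lintegral_map measurable_cost (by fun_prop)]
    have hL := ENNReal.lintegral_Lp_add_le (μ := π) (p := 2)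
      (f := fun p => ‖p.1 - p.2.1‖ₑ) (g := fun p => ‖p.1 - p.2.2‖ₑ)
      (by fun_prop) (by fun_prop) (by norm_num)
    simp only [ENNReal.rpow_two, Pi.add_apply] at hL
    refine le_trans (ENNReal.rpow_le_rpow (lintegral_mono fun p => ?_) (by norm_num)) hL
    gcongr
    calc ‖p.2.1 - p.2.2‖ₑ = ‖(p.1 - p.2.2) - (p.1 - p.2.1)‖ₑ := by congr 1; abel
      _ ≤ ‖p.1 - p.2.2‖ₑ + ‖p.1 - p.2.1‖ₑ := enorm_sub_le
      _ = _ := add_comm _ _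
  have hs : wassersteinSq μ ν = wassersteinSq ν μ :=
    le_antisymm (wassersteinSq_le_swap _ _) (wassersteinSq_le_swap _ _)
  have hmap : ∀ α β : WassersteinSpace d, (wassersteinSq α β) ^ (1 / 2 : ℝ) =
      ⨅ γ : {γ : Measure (EuclideanSpace ℝ (Fin d) × EuclideanSpace ℝ (Fin d)) //
        IsCoupling γ α β}, (transportCost γ.1) ^ (1 / 2 : ℝ) := fun α β =>
    (ENNReal.orderIsoRpow (1 / 2) (by norm_num)).map_iInf _
  rw [hs, hmap ν μ, hmap ν ρ]
  exact ENNReal.le_iInf_add_iInf fun γ₁ γ₂ => key γ₁.1 γ₂.1 γ₁.2 γ₂.2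

theorem wassersteinDist_eq (μ ν : WassersteinSpace d) :
    wassersteinDist μ ν = ((wassersteinSq μ ν) ^ (1 / 2 : ℝ)).toReal := by
  rw [wassersteinDist, Real.sqrt_eq_rpow, ENNReal.toReal_rpow]

theorem eq_of_wassersteinSq_eq_zero {μ ν : WassersteinSpace d} (h : wassersteinSq μ ν = 0) :
    μ = ν := by
  have half : ∀ (α β : WassersteinSpace d), wassersteinSq α β = 0 → ∀ (ε : ℝ≥0∞) (B : Set _),
      0 < ε → ε < ∞ → MeasurableSet B →
      α.measure B ≤ β.measure (Metric.thickening ε.toReal B) + ε := by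
    intro α β h0 ε B hε hε' hB
    have hε2 : ε ^ 2 ≠ 0 := pow_ne_zero 2 hε.ne'
    have h3 : wassersteinSq α β < ε * ε ^ 2 := by
      rw [h0]; exact ENNReal.mul_pos hε.ne' hε2
    obtain ⟨⟨γ, hγ⟩, hlt⟩ := iInf_lt_iff.1 h3
    have hpos := ENNReal.toReal_pos hε.ne' hε'.ne
    have hmk : γ {p | ε ^ 2 ≤ ‖p.1 - p.2‖ₑ ^ 2} ≤ ε := by
      refine (meas_ge_le_lintegral_div measurable_cost.aemeasurable hε2
        (ENNReal.pow_lt_top hε').ne).trans ?_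
      exact ENNReal.div_le_of_le_mul hlt.le
    have hth : MeasurableSet (Metric.thickening ε.toReal B) := Metric.isOpen_thickening.measurableSet
    rw [← hγ.1, ← hγ.2, Measure.map_apply measurable_fst hB, Measure.map_apply measurable_snd hth]
    refine le_trans (le_trans (measure_mono ?_) (measure_union_le _ _)) (add_le_add le_rfl hmk)
    rintro ⟨x, y⟩ hx
    by_cases hxy : ε ≤ ‖x - y‖ₑ
    · right
      change ε ^ 2 ≤ ‖x - y‖ₑ ^ 2
      gcongr
    · left
      refine Metric.mem_thickening_iff.2 ⟨x, hx, ?_⟩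
      rw [dist_comm, dist_eq_norm, ← toReal_enorm]
      exact ENNReal.toReal_strict_mono hε'.ne (not_le.1 hxy)
  have h' : wassersteinSq ν μ = 0 := le_antisymm (h ▸ wassersteinSq_le_swap ν μ) zero_le
  have hLP : levyProkhorovEDist μ.measure ν.measure = 0 := by
    refine le_antisymm (levyProkhorovEDist_le_of_forall _ _ 0 fun ε B hε hε' hB => ?_) zero_le
    exact ⟨half μ ν h ε B hε hε' hB, half ν μ h' ε B hε hε' hB⟩
  have hm : μ.measure = ν.measure := by
    refine ext_of_generate_finite _ (BorelSpace.measurable_eq.trans borel_eq_generateFrom_isClosed)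
      isPiSystem_isClosed (fun F hF => ?_) (by simp)
    exact measure_eq_measure_of_levyProkhorovEDist_eq_zero_of_isClosed hLP hF
      ⟨1, one_pos, measure_ne_top _ _⟩ ⟨1, one_pos, measure_ne_top _ _⟩
  exact WassersteinSpace.ext hm

end WassersteinMetric

instance (d : ℕ) : MetricSpace (WassersteinSpace d) where
  dist := wassersteinDist
  dist_self μ := by simp [wassersteinDist, wassersteinSq_self]
  dist_comm μ ν := by
    simp only [wassersteinDist]
    rw [le_antisymm (wassersteinSq_le_swap μ ν) (wassersteinSq_le_swap ν μ)]
  dist_triangle μ ν ρ := by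
    simp only [wassersteinDist_eq]
    have hf : ∀ α β : WassersteinSpace d, (wassersteinSq α β) ^ (1 / 2 : ℝ) ≠ ∞ := fun α β =>
      ENNReal.rpow_ne_top_of_nonneg (by norm_num) (wassersteinSq_lt_top α β).ne
    rw [← ENNReal.toReal_add (hf _ _) (hf _ _)]
    exact ENNReal.toReal_mono (ENNReal.add_ne_top.2 ⟨hf _ _, hf _ _⟩) (rpow_wassersteinSq_le μ ν ρ)
  eq_of_dist_eq_zero {μ ν} h := by
    refine eq_of_wassersteinSq_eq_zero ?_
    have h1 : (wassersteinSq μ ν).toReal = 0 := (Real.sqrt_eq_zero ENNReal.toReal_nonneg).1 h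
    exact ((ENNReal.toReal_eq_zero_iff _).1 h1).resolve_right (wassersteinSq_lt_top μ ν).ne

/-! ### The abstract hypotheses on a time-dependent functional

A functional on `[0, ∞) × X` is a map `ℝ → X → EReal` of which only the times `t ≥ 0` matter. -/

/-- `f ∈ L^∞_loc([0, ∞))`. -/
def LocallyEssBounded (f : ℝ → ℝ) : Prop :=
  ∀ T > 0, MemLp f ∞ (volume.restrict (Icc 0 T))

/-- `λ_T⁻ = max {- inf_{[0,T]} λ, 0}` as an element of `[0, ∞]`; since `λ` is an `L^∞_loc` function,
the infimum is the essential one. -/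
def negBound (lam : ℝ → ℝ) (T : ℝ) : ℝ≥0∞ :=
  essSup (fun t => ENNReal.ofReal (-lam t)) (volume.restrict (Icc 0 T))

section Abstract

variable {X : Type*} [MetricSpace X]

/-- The domain `{u : F u < +∞}` of an extended real functional. -/
def effDomain (F : X → EReal) : Set X := {u | F u < ⊤}

/-- `𝐄(t, τ, u; v) = ℰ(t, v) + d²(u, v) / (2τ)`. -/
def penalized (ℰ : ℝ → X → EReal) (t τ : ℝ) (u v : X) : EReal :=
  ℰ t v + ((dist u v ^ 2 / (2 * τ) : ℝ) : EReal)

/-- The Moreau-Yosida approximation `inf_v 𝐄(t, τ, u; v)`. -/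
def moreauYosida (ℰ : ℝ → X → EReal) (t τ : ℝ) (u : X) : EReal :=
  ⨅ v, penalized ℰ t τ u v

/-- E1: at each time the functional takes values in `(-∞, +∞]`, is proper and is lower
semicontinuous. -/
def HypE1 (ℰ : ℝ → X → EReal) : Prop :=
  ∀ t, 0 ≤ t → (∀ u, ℰ t u ≠ ⊥) ∧ (effDomain (ℰ t)).Nonempty ∧ LowerSemicontinuous (ℰ t)

/-- E2: the domain does not depend on time. -/
def HypE2 (ℰ : ℝ → X → EReal) : Prop :=
  ∀ s t, 0 ≤ s → 0 ≤ t → effDomain (ℰ s) = effDomain (ℰ t)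

/-- E3: control of the time increments on the (time-independent) domain, where the functional is
finite. -/
def HypE3 (ℰ : ℝ → X → EReal) : Prop :=
  ∃ (uStar : X) (β : ℝ → ℝ), (∀ r, 0 ≤ r → 0 ≤ β r) ∧ LocallyIntegrableOn β (Ici 0) ∧
    ∀ u ∈ effDomain (ℰ 0), ∀ s t, 0 ≤ s → s ≤ t →
      |(ℰ t u).toReal - (ℰ s u).toReal| ≤ (∫ r in s..t, β r) * (1 + dist u uStar ^ 2)

/-- E4: a Moreau-Yosida approximation is bounded below, locally in time. -/
def HypE4 (ℰ : ℝ → X → EReal) : Prop :=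
  ∀ T > 0, ∃ (uStar : X) (τStar : ℝ), 0 < τStar ∧
    ∃ m : ℝ, ∀ t ∈ Icc 0 T, (m : EReal) ≤ moreauYosida ℰ t τStar uStar

/-- E5, with the time-dependent convexity function `lam`. The curve depends neither on `t` nor
on `τ`; the condition `0 < τ < 1 / λ_T⁻` is read in `[0, ∞]`, with `1 / 0 = ∞`. -/
def HypE5 (ℰ : ℝ → X → EReal) (lam : ℝ → ℝ) : Prop :=
  LocallyEssBounded lam ∧
    ∀ u v₀ v₁ : X, ∃ γ : ℝ → X, ContinuousOn γ (Icc 0 1) ∧ γ 0 = v₀ ∧ γ 1 = v₁ ∧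
      ∀ T > 0, ∀ t ∈ Icc 0 T, ∀ τ > 0, ENNReal.ofReal τ < (negBound lam T)⁻¹ →
        ∀ s ∈ Icc (0 : ℝ) 1,
          penalized ℰ t τ u (γ s) ≤
            ((1 - s : ℝ) : EReal) * penalized ℰ t τ u v₀
              + ((s : ℝ) : EReal) * penalized ℰ t τ u v₁
              - (((1 + τ * lam t) / (2 * τ) * s * (1 - s) * dist v₀ v₁ ^ 2 : ℝ) : EReal)

end Abstract

/-! ### The energies -/

/-- The integral of a real function as an extended real number, `∫ f⁺ - ∫ f⁻`. -/
def extIntegral {α : Type*} [MeasurableSpace α] (μ : Measure α) (f : α → ℝ) : EReal :=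
  ((∫⁻ x, ENNReal.ofReal (f x) ∂μ : ℝ≥0∞) : EReal)
    - ((∫⁻ x, ENNReal.ofReal (-f x) ∂μ : ℝ≥0∞) : EReal)

open Classical in
/-- The entropy `𝒰(μ) = ∫ ρ log ρ dx` if `dμ = ρ dx`, and `+∞` if `μ` is not absolutely
continuous. -/
def entropy {d : ℕ} (μ : WassersteinSpace d) : EReal :=
  if μ.measure ≪ volume then
    extIntegral volume fun x =>
      (μ.measure.rnDeriv volume x).toReal * Real.log (μ.measure.rnDeriv volume x).toReal
  else ⊤

/-- The potential energy `𝒱(t, μ) = ∫ V(t, x) dμ(x)`. -/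
def potentialEnergy {d : ℕ} (V : ℝ → EuclideanSpace ℝ (Fin d) → ℝ) (t : ℝ)
    (μ : WassersteinSpace d) : EReal :=
  extIntegral μ.measure (V t)

/-- `ℰ₁(t, μ) = κ 𝒰(μ) + 𝒱(t, μ)`; for `κ = 0` the entropy term is absent (`0 * ⊤ = 0`). -/
def energyOne {d : ℕ} (κ : ℝ) (V : ℝ → EuclideanSpace ℝ (Fin d) → ℝ) (t : ℝ)
    (μ : WassersteinSpace d) : EReal :=
  (κ : EReal) * entropy μ + potentialEnergy V t μ

/-! ### The hypotheses on the potential -/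

section Potential

variable {d : ℕ}

/-- The (Fréchet) subdifferential of `f` at `x`:
`f y ≥ f x + ⟨p, y - x⟩ + o(|y - x|)` as `y → x`. -/
def subdifferential (f : EuclideanSpace ℝ (Fin d) → ℝ) (x : EuclideanSpace ℝ (Fin d)) :
    Set (EuclideanSpace ℝ (Fin d)) :=
  {p | ∀ ε > 0, ∀ᶠ y in 𝓝 x, f x + inner ℝ p (y - x) - ε * ‖y - x‖ ≤ f y}

/-- `p` is the element of minimal norm `∂°f(x)` of the subdifferential. -/
def IsMinimalSubgradient (f : EuclideanSpace ℝ (Fin d) → ℝ) (x p : EuclideanSpace ℝ (Fin d)) :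
    Prop :=
  p ∈ subdifferential f x ∧ ∀ q ∈ subdifferential f x, ‖p‖ ≤ ‖q‖

/-- V1: `V(t, ·)` is `λ(t)`-convex with `λ ∈ L^∞_loc([0, ∞))`. -/
def HypV1 (V : ℝ → EuclideanSpace ℝ (Fin d) → ℝ) (lam : ℝ → ℝ) : Prop :=
  LocallyEssBounded lam ∧
    ∀ t, 0 ≤ t → ConvexOn ℝ univ fun x => V t x - lam t / 2 * ‖x‖ ^ 2

/-- V2: `|∂°V(t, 0)|` is locally bounded and `V(t, 0)` is locally bounded from below. -/
def HypV2 (V : ℝ → EuclideanSpace ℝ (Fin d) → ℝ) : Prop :=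
  (∀ T > 0, ∃ C : ℝ, ∀ t ∈ Icc 0 T, ∃ p, IsMinimalSubgradient (V t) 0 p ∧ ‖p‖ ≤ C) ∧
    ∀ T > 0, ∃ m : ℝ, ∀ t ∈ Icc 0 T, m ≤ V t 0

/-- V3: control of the time increments of `V`. -/
def HypV3 (V : ℝ → EuclideanSpace ℝ (Fin d) → ℝ) : Prop :=
  ∃ β : ℝ → ℝ, LocallyIntegrableOn β (Ici 0) ∧
    ∀ s t, 0 ≤ s → s < t → ∀ x, |V s x - V t x| ≤ (∫ r in s..t, β r) * (1 + ‖x‖ ^ 2)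

end Potential

end

end TimeDepFlow

open TimeDepFlow

/-! Two independent ingredients carry the theorem: regularity of V in t and x, and a dual
description of the entropy.

Potential. A Fréchet subgradient of a semiconvex function is a global one, so V1 and V2 give a
quadratic minorant of V(t, ·), uniform for t in [0,T] (`exists_quadratic_lower_bound`). Since λ is
controlled only almost everywhere, V3 is used to pass the essential bound to every time: V(t, ·) is
convex with constant max(λ(t), -λ_T⁻) (`convexOn_sub_max`). The minorant excludes ∞ - ∞ and makes
the potential energy lower semicontinuous. V3 makes V(t, ·) - V(s, ·) quadratically bounded, whence
E2 and E3 with u* = δ₀, because d²(μ, δ₀) is the second moment. For E4 a penalty with small τ*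
absorbs the quadratic lower bounds.

Entropy. Integrating r a - exp(a - 1) ≤ r log r shows that the entropy is the supremum of
`dualEntropy` over bounded continuous h (`entropy_eq_iSup`). The weight -|x|² makes the exponential
integrable over the whole space. Each dual functional is continuous for d₂, which yields lower
semicontinuity, and h = 0 yields the lower bound.

E5. Given u, v₀, v₁, take a three-plan whose couplings of u with v₀ and of u with v₁ are optimal,
and let γ(s) be the law of (1-s)x + sy, where x and y are the v₀ and v₁ coordinates. Squared
distance from u and potential energy satisfy the required inequality with D = ∫|x-y|² dπ in place of
d²(v₀,v₁). As 1 + τ max(λ(t), -λ_T⁻) is nonnegative and D ≥ d²(v₀,v₁), this suffices. It remains to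
choose the plan so that the entropy is convex along γ (`exists_threePlan_entropy`).

This is done without Brenier maps or Jacobians. Replace u by a discrete measure and v₀, v₁ by
measures on a cube. Optimal plans from a discrete measure are given by Laguerre cells, and every
coupling of the i-th cell of v₀ with the i-th cell of v₁ is admissible. Inside a pair of cells,
masses are matched by repeated bisection of boxes in coordinate directions. Convexity of the entropy
then reduces to Jensen's inequality and concavity of the logarithm of the volume of a box under
interpolation of its corners (`exists_box_plan`). Interpolated Laguerre cells stay disjoint, so the
cellwise estimates add up (`exists_threePlan_of_discrete`). Finally the plans converge weakly along
an ultrafilter, and duality passes the entropy inequality to the limit. -/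

namespace TimeDepFlow

noncomputable section

/-! ### Duality for the entropy -/

/-- The Euclidean space `ℝᵈ`. -/
abbrev Euc (d : ℕ) := EuclideanSpace ℝ (Fin d)

/-- The integrand `ρ log ρ` of the entropy of a measure with Lebesgue density `ρ`. -/
def entDensity {d : ℕ} (μ : Measure (Euc d)) (x : Euc d) : ℝ :=
  (μ.rnDeriv volume x).toReal * Real.log (μ.rnDeriv volume x).toReal

/-- The functional of which the entropy is the supremum over bounded continuous `h`. -/
def dualEntropy {d : ℕ} (h : Euc d → ℝ) (μ : Measure (Euc d)) : ℝ :=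
  ∫ x, (h x - ‖x‖ ^ 2) ∂μ - ∫ x, Real.exp (h x - ‖x‖ ^ 2 - 1)

variable {d : ℕ}

theorem integrable_gaussian : Integrable (fun x : Euc d => Real.exp (-‖x‖ ^ 2 - 1)) := by
  have h := (GaussianFourier.integrable_cexp_neg_mul_sq_norm_add (V := Euc d) (b := 1)
    (by simp) 0 0).norm
  have h2 := h.mul_const (Real.exp (-1))
  refine h2.congr (Eventually.of_forall fun x => ?_)
  simp only [Complex.norm_exp]
  rw [← Real.exp_add]
  congr 1
  simp [← Complex.ofReal_pow]
  ring

theorem integrable_exp_sub {h : Euc d → ℝ} (hm : Measurable h) {M : ℝ} (hM : ∀ x, h x ≤ M) :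
    Integrable (fun x : Euc d => Real.exp (h x - ‖x‖ ^ 2 - 1)) := by
  refine (integrable_gaussian.const_mul (Real.exp M)).mono'
    (Measurable.aestronglyMeasurable (by fun_prop)) (Eventually.of_forall fun x => ?_)
  rw [Real.norm_of_nonneg (Real.exp_pos _).le, ← Real.exp_add]
  exact Real.exp_le_exp.2 (by linarith [hM x])

/-- Fenchel-Young inequality: exp(a - 1) is the convex conjugate of r log r, with equality at a = 1
+ log r when r > 0. At r = 0 the value 0 * log 0 = 0 is the right one. -/
theorem mul_sub_exp_le {r : ℝ} (hr : 0 ≤ r) (a : ℝ) :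
    r * a - Real.exp (a - 1) ≤ r * Real.log r := by
  rcases hr.eq_or_lt with rfl | hr
  · simpa using (Real.exp_pos _).le
  · have h1 := Real.add_one_le_exp (a - 1 - Real.log r)
    have h2 : Real.exp (a - 1) = r * Real.exp (a - 1 - Real.log r) := by
      rw [Real.exp_sub _ (Real.log r), Real.exp_log hr]; field_simp
    rw [h2]
    nlinarith

theorem measurable_entDensity (μ : Measure (Euc d)) : Measurable (entDensity μ) := by
  have := Measure.measurable_rnDeriv μ volume
  unfold entDensity
  fun_prop

/-- Fenchel-Young integrated with r the density. The version on a set C is what later lets estimates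
on disjoint cells be added. -/
theorem setIntegral_sub_exp_le {μ : Measure (Euc d)} [IsFiniteMeasure μ] (hac : μ ≪ volume)
    (hent : Integrable (entDensity μ)) {C : Set (Euc d)} (hC : MeasurableSet C)
    {k : Euc d → ℝ} (hk : IntegrableOn k C μ)
    (hk' : IntegrableOn (fun x => Real.exp (k x - 1)) C) :
    ∫ x in C, k x ∂μ - ∫ x in C, Real.exp (k x - 1) ≤ ∫ x in C, entDensity μ x := by
  have h1 : ∫ x in C, k x ∂μ = ∫ x in C, (μ.rnDeriv volume x).toReal * k x := by
    rw [← integral_indicator hC, ← integral_indicator hC, ← integral_rnDeriv_smul hac]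
    congr 1; ext x
    by_cases hx : x ∈ C <;> simp [hx]
  have h2 : IntegrableOn (fun x => (μ.rnDeriv volume x).toReal * k x) C := by
    rw [← integrable_indicator_iff hC] at hk ⊢
    rw [← integrable_rnDeriv_smul_iff hac] at hk
    refine hk.congr (Eventually.of_forall fun x => ?_)
    by_cases hx : x ∈ C <;> simp [hx]
  rw [h1, ← integral_sub h2 hk']
  refine setIntegral_mono (h2.sub hk') hent.integrableOn fun x => ?_
  exact mul_sub_exp_le ENNReal.toReal_nonneg _

theorem dualEntropy_le {μ : Measure (Euc d)} [IsFiniteMeasure μ] (hac : μ ≪ volume)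
    (hent : Integrable (entDensity μ)) (h2 : Integrable (fun x => ‖x‖ ^ 2) μ)
    {h : Euc d → ℝ} (hm : Measurable h) {M : ℝ} (hM : ∀ x, |h x| ≤ M) :
    dualEntropy h μ ≤ ∫ x, entDensity μ x := by
  have hi : Integrable h μ := Integrable.of_bound hm.aestronglyMeasurable M
    (Eventually.of_forall hM)
  have := setIntegral_sub_exp_le hac hent MeasurableSet.univ
    (k := fun x => h x - ‖x‖ ^ 2) (hi.sub h2).integrableOn
    (integrable_exp_sub hm fun x => (abs_le.1 (hM x)).2).integrableOn
  simpa [dualEntropy] using this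

theorem abs_exp_sub_exp_le {a b M : ℝ} (ha : a ≤ M) (hb : b ≤ M) :
    |Real.exp a - Real.exp b| ≤ Real.exp M * |a - b| := by
  wlog hab : b ≤ a generalizing a b
  · rw [abs_sub_comm, abs_sub_comm a b]; exact this hb ha (not_le.1 hab).le
  rw [abs_of_nonneg (sub_nonneg.2 (Real.exp_le_exp.2 hab)), abs_of_nonneg (sub_nonneg.2 hab)]
  have h1 := Real.add_one_le_exp (b - a)
  have h2 : Real.exp b = Real.exp a * Real.exp (b - a) := by rw [← Real.exp_add]; ring_nf
  have h3 := Real.exp_le_exp.2 ha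
  have h4 := Real.exp_pos a
  rw [h2]
  nlinarith [mul_le_mul_of_nonneg_right h3 (sub_nonneg.2 hab), mul_le_mul_of_nonneg_left h1 h4.le]

/-- A bound of the dual functional for bounded continuous functions extends to bounded measurable
functions. -/
theorem dualEntropy_le_of_forall_continuous {μ : Measure (Euc d)} [IsFiniteMeasure μ]
    (h2 : Integrable (fun x => ‖x‖ ^ 2) μ) {c : ℝ}
    (H : ∀ h : Euc d → ℝ, Continuous h → (∃ M, ∀ x, |h x| ≤ M) → dualEntropy h μ ≤ c)
    {h : Euc d → ℝ} (hm : Measurable h) {M : ℝ} (hM : ∀ x, |h x| ≤ M) :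
    dualEntropy h μ ≤ c := by
  set w : Euc d → ℝ := fun x => Real.exp (-‖x‖ ^ 2 - 1) with hw
  have hwc : Continuous w := by rw [hw]; fun_prop
  -- With the Gaussian weight absorbed into a finite measure G, the exponential term is ∫ exp(h) dG,
  -- and one L¹(μ + G) approximation of h controls both terms.
  set G : Measure (Euc d) := volume.withDensity fun x => ENNReal.ofReal (w x) with hG
  have hGfin : IsFiniteMeasure G :=
    isFiniteMeasure_withDensity_ofReal (integrable_gaussian).2
  have hGint : ∀ f : Euc d → ℝ, ∫ x, f x ∂G = ∫ x, w x * f x := by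
    intro f
    rw [hG, integral_withDensity_eq_integral_toReal_smul (by fun_prop)
      (Eventually.of_forall fun x => ENNReal.ofReal_lt_top)]
    refine integral_congr_ae (Eventually.of_forall fun x => ?_)
    simp [ENNReal.toReal_ofReal (Real.exp_pos _).le, hw]
  have hJ : ∀ f : Euc d → ℝ, ∫ x, Real.exp (f x - ‖x‖ ^ 2 - 1) = ∫ x, Real.exp (f x) ∂G := by
    intro f
    rw [hGint]
    refine integral_congr_ae (Eventually.of_forall fun x => ?_)
    simp only [hw, ← Real.exp_add]
    ring_nf
  have hint : ∀ ν : Measure (Euc d), IsFiniteMeasure ν → ∀ f : Euc d → ℝ, Measurable f →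
      (∀ x, |f x| ≤ M) → Integrable f ν := fun ν _ f hf hb =>
    Integrable.of_bound hf.aestronglyMeasurable M (Eventually.of_forall hb)
  have hexp : ∀ f : Euc d → ℝ, Measurable f → (∀ x, |f x| ≤ M) →
      Integrable (fun x => Real.exp (f x)) G := fun f hf hb =>
    Integrable.of_bound (C := Real.exp M) (by fun_prop) (Eventually.of_forall fun x => by
      rw [Real.norm_of_nonneg (Real.exp_pos _).le]
      exact Real.exp_le_exp.2 (abs_le.1 (hb x)).2)
  refine le_of_forall_pos_le_add fun ε hε => ?_
  have hK : 0 < 1 + Real.exp M := by positivity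
  -- The tolerance ε / (1 + exp M) is dictated by the Lipschitz constants on (-∞, M]: 1 for the
  -- linear term and exp M for the exponential one.
  obtain ⟨g, hg, -⟩ := (hint (μ + G) inferInstance h hm hM).exists_boundedContinuous_integral_sub_le
    (div_pos hε hK)
  have hM0 : 0 ≤ M := (abs_nonneg _).trans (hM 0)
  -- Clipping to [-M, M] restores the bound and does not increase the error, since h is unchanged by
  -- the same clipping.
  set g' : Euc d → ℝ := fun x => max (-M) (min M (g x)) with hg'
  have hg'c : Continuous g' := by rw [hg']; fun_prop
  have hg'b : ∀ x, |g' x| ≤ M := fun x => abs_le.2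
    ⟨le_max_left _ _, max_le (by linarith) (min_le_left _ _)⟩
  have hclose : ∀ x, |h x - g' x| ≤ ‖h x - g x‖ := by
    intro x
    have h3 : h x = max (-M) (min M (h x)) := by
      rw [min_eq_right (abs_le.1 (hM x)).2, max_eq_right (abs_le.1 (hM x)).1]
    rw [Real.norm_eq_abs]
    conv_lhs => rw [h3]
    calc |max (-M) (min M (h x)) - max (-M) (min M (g x))|
        ≤ |min M (h x) - min M (g x)| := by
          have := abs_max_sub_max_le_max (-M) (min M (h x)) (-M) (min M (g x))
          simpa using this
      _ ≤ |h x - g x| := by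
          have := abs_min_sub_min_le_max M (h x) M (g x)
          simpa using this
  have hdi : ∀ ν : Measure (Euc d), IsFiniteMeasure ν → Integrable (fun x => |h x - g' x|) ν :=
    fun ν hν => ((hint ν hν h hm hM).sub (hint ν hν g' hg'c.measurable hg'b)).abs
  have hgi : Integrable (fun x => ‖h x - g x‖) (μ + G) :=
    ((hint _ inferInstance h hm hM).sub (g.integrable _)).norm
  have hsum : ∫ x, |h x - g' x| ∂μ + ∫ x, |h x - g' x| ∂G ≤ ε / (1 + Real.exp M) := by
    rw [← integral_add_measure (hdi μ inferInstance) (hdi G inferInstance)]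
    exact (integral_mono (hdi _ inferInstance) hgi hclose).trans hg
  have hJg := H g' hg'c ⟨M, hg'b⟩
  have e1 : ∫ x, (h x - ‖x‖ ^ 2) ∂μ ≤ ∫ x, (g' x - ‖x‖ ^ 2) ∂μ + ∫ x, |h x - g' x| ∂μ := by
    have hgs : Integrable (fun x => g' x - ‖x‖ ^ 2) μ :=
      (hint μ inferInstance g' hg'c.measurable hg'b).sub h2
    rw [← integral_add hgs (hdi μ inferInstance)]
    refine integral_mono ((hint μ inferInstance h hm hM).sub h2)
      (hgs.add (hdi μ inferInstance)) fun x => ?_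
    have := le_abs_self (h x - g' x)
    linarith
  have e2 : ∫ x, Real.exp (g' x) ∂G ≤
      ∫ x, Real.exp (h x) ∂G + Real.exp M * ∫ x, |h x - g' x| ∂G := by
    rw [← integral_const_mul, ← integral_add (hexp h hm hM) ((hdi G inferInstance).const_mul _)]
    refine integral_mono (hexp g' hg'c.measurable hg'b)
      ((hexp h hm hM).add ((hdi G inferInstance).const_mul _)) fun x => ?_
    have := abs_exp_sub_exp_le (abs_le.1 (hM x)).2 (abs_le.1 (hg'b x)).2
    have := neg_abs_le (Real.exp (h x) - Real.exp (g' x))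
    linarith
  simp only [dualEntropy, hJ] at hJg ⊢
  have hA : 0 ≤ ∫ x, |h x - g' x| ∂μ := integral_nonneg fun x => abs_nonneg _
  have hB : 0 ≤ ∫ x, |h x - g' x| ∂G := integral_nonneg fun x => abs_nonneg _
  rw [le_div_iff₀ hK] at hsum
  nlinarith [mul_nonneg hA (Real.exp_pos M).le]

/-- Test with n times the indicator of a Lebesgue-null set N. The exponential integral does not see
N, so n μ(N) is bounded in n. -/
theorem absolutelyContinuous_of_dualEntropy_le {μ : Measure (Euc d)} [IsFiniteMeasure μ]
    (h2 : Integrable (fun x => ‖x‖ ^ 2) μ) {c : ℝ}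
    (H : ∀ h : Euc d → ℝ, Measurable h → (∃ M, ∀ x, |h x| ≤ M) → dualEntropy h μ ≤ c) :
    μ ≪ volume := by
  refine Measure.AbsolutelyContinuous.mk fun N hN hN0 => ?_
  have key : ∀ n : ℕ, n * μ.real N ≤ c + ∫ x, ‖x‖ ^ 2 ∂μ + ∫ x : Euc d, Real.exp (-‖x‖ ^ 2 - 1) := by
    intro n
    have hb : ∀ x, |N.indicator (fun _ => (n : ℝ)) x| ≤ n := fun x => by
      by_cases hx : x ∈ N <;> simp [hx]
    have hm : Measurable (N.indicator fun _ => (n : ℝ)) := measurable_const.indicator hN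
    have h3 := H _ hm ⟨n, hb⟩
    have h4 : ∫ x, (N.indicator (fun _ => (n : ℝ)) x - ‖x‖ ^ 2) ∂μ
        = n * μ.real N - ∫ x, ‖x‖ ^ 2 ∂μ := by
      rw [integral_sub (Integrable.of_bound hm.aestronglyMeasurable n (Eventually.of_forall hb)) h2,
        integral_indicator hN]
      simp [mul_comm]
    have h5 : ∫ x, Real.exp (N.indicator (fun _ => (n : ℝ)) x - ‖x‖ ^ 2 - 1)
        = ∫ x : Euc d, Real.exp (-‖x‖ ^ 2 - 1) := by
      refine integral_congr_ae ?_
      filter_upwards [measure_eq_zero_iff_ae_notMem.1 hN0] with x hx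
      simp [hx]
    rw [dualEntropy, h4, h5] at h3
    linarith
  by_contra hne
  have hpos : 0 < μ.real N := ENNReal.toReal_pos hne (measure_ne_top _ _)
  obtain ⟨n, hn⟩ := exists_nat_gt
    ((c + ∫ x, ‖x‖ ^ 2 ∂μ + ∫ x : Euc d, Real.exp (-‖x‖ ^ 2 - 1)) / μ.real N)
  rw [div_lt_iff₀ hpos] at hn
  linarith [key n]

/-- The truncated maximisers in the dual formula. -/
def clampLog (n : ℕ) (r q : ℝ) : ℝ :=
  -- At r = 0 the maximiser is -∞, whereas `Real.log 0 = 0`; hence the separate case.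
  if r = 0 then -n else max (-n) (min n (Real.log r + 1 + q))

theorem abs_clampLog_le (n : ℕ) (r q : ℝ) : |clampLog n r q| ≤ n := by
  have hn : (0 : ℝ) ≤ n := Nat.cast_nonneg n
  unfold clampLog
  split_ifs
  · simp
  · exact abs_le.2 ⟨le_max_left _ _, max_le (by linarith) (min_le_left _ _)⟩

theorem clampLog_zero (r q : ℝ) : clampLog 0 r q = 0 := by
  have := abs_clampLog_le 0 r q
  simpa using this

/-- The function a ↦ r a - exp(a - 1) is concave, and truncation moves a from -q towards its
maximiser without overshooting. This gives the minorant, independent of n, that Fatou's lemma needs.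
-/
theorem le_of_clampLog (n : ℕ) {r q : ℝ} (hr : 0 ≤ r) :
    r * (-q) - Real.exp (-q - 1) ≤ r * (clampLog n r q - q) - Real.exp (clampLog n r q - q - 1) := by
  have hn : (0 : ℝ) ≤ n := Nat.cast_nonneg n
  set y := clampLog n r q with hy
  have h1 := Real.add_one_le_exp (-y)
  have h2 : Real.exp (-q - 1) = Real.exp (y - q - 1) * Real.exp (-y) := by
    rw [← Real.exp_add]; ring_nf
  have h3 := Real.exp_pos (y - q - 1)
  -- Since 1 - exp(-y) ≤ y, the gain is at least this product, whose factors have equal sign.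
  suffices h : 0 ≤ (r - Real.exp (y - q - 1)) * y by
    rw [h2]; nlinarith [mul_le_mul_of_nonneg_left h1 h3.le]
  unfold clampLog at hy
  split_ifs at hy with h0
  · rw [h0, hy]; nlinarith [Real.exp_pos (-(n : ℝ) - q - 1)]
  · have hr' : 0 < r := lt_of_le_of_ne hr (Ne.symm h0)
    rcases le_total 0 (Real.log r + 1 + q) with hs | hs
    · have hy0 : 0 ≤ y := by rw [hy]; exact le_max_of_le_right (le_min hn hs)
      have hyl : y ≤ Real.log r + 1 + q := by
        rw [hy]; exact max_le (by linarith) (min_le_right _ _)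
      have : Real.exp (y - q - 1) ≤ r := by
        calc _ ≤ Real.exp (Real.log r) := Real.exp_le_exp.2 (by linarith)
          _ = r := Real.exp_log hr'
      exact mul_nonneg (by linarith) hy0
    · have hy0 : y ≤ 0 := by rw [hy]; exact max_le (by linarith) ((min_le_right _ _).trans hs)
      have hyl : Real.log r + 1 + q ≤ y := by
        rw [hy, min_eq_right (by linarith)]; exact le_max_right _ _
      have : r ≤ Real.exp (y - q - 1) := by
        calc r = Real.exp (Real.log r) := (Real.exp_log hr').symm
          _ ≤ _ := Real.exp_le_exp.2 (by linarith)
      nlinarith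

theorem tendsto_clampLog {r : ℝ} (hr : 0 ≤ r) (q : ℝ) :
    Tendsto (fun n : ℕ => r * (clampLog n r q - q) - Real.exp (clampLog n r q - q - 1)) atTop
      (𝓝 (r * Real.log r)) := by
  by_cases h0 : r = 0
  · subst h0
    simp only [clampLog, if_true, zero_mul, zero_sub]
    rw [← neg_zero]
    refine Tendsto.neg (Real.tendsto_exp_atBot.comp ?_)
    have : Tendsto (fun n : ℕ => -(n : ℝ)) atTop atBot :=
      tendsto_neg_atTop_atBot.comp tendsto_natCast_atTop_atTop
    exact tendsto_atBot_add_const_right _ (-1) (tendsto_atBot_add_const_right _ (-q) this)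
  · have hr' : 0 < r := lt_of_le_of_ne hr (Ne.symm h0)
    refine tendsto_const_nhds.congr' ?_
    obtain ⟨N, hN⟩ := exists_nat_ge |Real.log r + 1 + q|
    filter_upwards [eventually_ge_atTop N] with n hn
    have hn' : |Real.log r + 1 + q| ≤ n := hN.trans (by exact_mod_cast hn)
    simp only [clampLog, h0, if_false]
    rw [min_eq_right (abs_le.1 hn').2, max_eq_right (abs_le.1 hn').1,
      show Real.log r + 1 + q - q - 1 = Real.log r by ring, Real.exp_log hr']
    ring

/-- Inserting the truncated maximisers gives integrands F n that converge pointwise to ρ log ρ, lie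
above the integrable F 0, and have integral at most c. Fatou's lemma yields integrability and the
bound at once. -/
theorem integrable_entDensity_of_dualEntropy_le {μ : Measure (Euc d)} [IsFiniteMeasure μ]
    (h2 : Integrable (fun x => ‖x‖ ^ 2) μ) (hac : μ ≪ volume) {c : ℝ}
    (H : ∀ h : Euc d → ℝ, Measurable h → (∃ M, ∀ x, |h x| ≤ M) → dualEntropy h μ ≤ c) :
    Integrable (entDensity μ) ∧ ∫ x, entDensity μ x ≤ c := by
  set ρ : Euc d → ℝ := fun x => (μ.rnDeriv volume x).toReal with hρ
  have hρm : Measurable ρ := (Measure.measurable_rnDeriv μ volume).ennreal_toReal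
  have hρ0 : ∀ x, 0 ≤ ρ x := fun x => ENNReal.toReal_nonneg
  set h : ℕ → Euc d → ℝ := fun n x => clampLog n (ρ x) (‖x‖ ^ 2) with hh
  have hhm : ∀ n, Measurable (h n) := by
    intro n
    simp only [hh, clampLog]
    refine Measurable.ite (hρm (measurableSet_singleton 0)) measurable_const ?_
    fun_prop
  have hhb : ∀ n x, |h n x| ≤ n := fun n x => abs_clampLog_le _ _ _
  set F : ℕ → Euc d → ℝ := fun n x =>
    ρ x * (h n x - ‖x‖ ^ 2) - Real.exp (h n x - ‖x‖ ^ 2 - 1) with hF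
  have hi1 : ∀ n, Integrable (fun x => ρ x * (h n x - ‖x‖ ^ 2)) := fun n => by
    have : Integrable (fun x => h n x - ‖x‖ ^ 2) μ :=
      (Integrable.of_bound (hhm n).aestronglyMeasurable n (Eventually.of_forall (hhb n))).sub h2
    simpa using (integrable_rnDeriv_smul_iff hac).2 this
  have hi2 : ∀ n, Integrable (fun x => Real.exp (h n x - ‖x‖ ^ 2 - 1)) := fun n =>
    integrable_exp_sub (hhm n) fun x => (abs_le.1 (hhb n x)).2
  have hFi : ∀ n, Integrable (F n) := fun n => (hi1 n).sub (hi2 n)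
  have hFc : ∀ n, ∫ x, F n x ≤ c := by
    intro n
    have h3 := H (h n) (hhm n) ⟨n, hhb n⟩
    rw [dualEntropy, ← integral_rnDeriv_smul hac] at h3
    simp only [hF]
    rw [integral_sub (hi1 n) (hi2 n)]
    simpa using h3
  have hF0 : ∀ n x, F 0 x ≤ F n x := by
    intro n x
    have := le_of_clampLog n (q := ‖x‖ ^ 2) (hρ0 x)
    simp only [hF, hh] at this ⊢
    simpa [clampLog_zero] using this
  have hlim : ∀ x, Tendsto (fun n => F n x) atTop (𝓝 (entDensity μ x)) := fun x =>
    tendsto_clampLog (hρ0 x) _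
  have hE0 : ∀ x, F 0 x ≤ entDensity μ x := fun x => ge_of_tendsto' (hlim x) fun n => hF0 n x
  have hfat : ∫⁻ x, ENNReal.ofReal (entDensity μ x - F 0 x) ≤ ENNReal.ofReal (c - ∫ x, F 0 x) := by
    have h4 : ∀ x, ENNReal.ofReal (entDensity μ x - F 0 x)
        = liminf (fun n => ENNReal.ofReal (F n x - F 0 x)) atTop := fun x =>
      (((ENNReal.continuous_ofReal.tendsto _).comp ((hlim x).sub_const (F 0 x))).liminf_eq).symm
    simp_rw [h4]
    refine (lintegral_liminf_le' fun n =>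
      ((hFi n).sub (hFi 0)).aestronglyMeasurable.aemeasurable.ennreal_ofReal).trans ?_
    refine liminf_le_of_le (by isBoundedDefault) fun b hb => ?_
    obtain ⟨n, hn⟩ := hb.exists
    refine hn.trans ?_
    have h5 : ∫ x, (F n - F 0) x = (∫ x, F n x) - ∫ x, F 0 x := integral_sub' (hFi n) (hFi 0)
    rw [← ofReal_integral_eq_lintegral_ofReal ((hFi n).sub (hFi 0))
      (Eventually.of_forall fun x => sub_nonneg.2 (hF0 n x)), h5]
    exact ENNReal.ofReal_le_ofReal (by linarith [hFc n])
  have hdi : Integrable (fun x => entDensity μ x - F 0 x) := by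
    refine ⟨((measurable_entDensity μ).aestronglyMeasurable).sub (hFi 0).1, ?_⟩
    rw [hasFiniteIntegral_iff_ofReal (Eventually.of_forall fun x => sub_nonneg.2 (hE0 x))]
    exact hfat.trans_lt ENNReal.ofReal_lt_top
  have hei : Integrable (entDensity μ) := by
    refine (hdi.add (hFi 0)).congr (Eventually.of_forall fun x => ?_)
    simp
  refine ⟨hei, ?_⟩
  have h5 := ofReal_integral_eq_lintegral_ofReal hdi
      (Eventually.of_forall fun x => sub_nonneg.2 (hE0 x))
  rw [← h5, ENNReal.ofReal_le_ofReal_iff (by linarith [hFc 0]), integral_sub hei (hFi 0)] at hfat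
  linarith

/-- A measure has entropy at most `c` if the dual functional is at most `c` for all bounded
continuous functions. -/
theorem entropy_le_of_dualEntropy_le {μ : Measure (Euc d)} [IsFiniteMeasure μ]
    (h2 : Integrable (fun x => ‖x‖ ^ 2) μ) {c : ℝ}
    (H : ∀ h : Euc d → ℝ, Continuous h → (∃ M, ∀ x, |h x| ≤ M) → dualEntropy h μ ≤ c) :
    μ ≪ volume ∧ Integrable (entDensity μ) ∧ ∫ x, entDensity μ x ≤ c := by
  have H' : ∀ h : Euc d → ℝ, Measurable h → (∃ M, ∀ x, |h x| ≤ M) → dualEntropy h μ ≤ c :=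
    fun h hm ⟨M, hM⟩ => dualEntropy_le_of_forall_continuous h2 H hm hM
  have hac := absolutelyContinuous_of_dualEntropy_le h2 H'
  exact ⟨hac, integrable_entDensity_of_dualEntropy_le h2 hac H'⟩

end

noncomputable section

variable {d : ℕ}

/-! ### Extended integrals -/

theorem extIntegral_eq_coe {α : Type*} [MeasurableSpace α] {μ : Measure α} {f : α → ℝ}
    (hf : Integrable f μ) : extIntegral μ f = ((∫ x, f x ∂μ : ℝ) : EReal) := by
  have h1 : ∫⁻ x, ENNReal.ofReal (f x) ∂μ ≠ ∞ := hf.lintegral_lt_top.ne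
  have h2 : ∫⁻ x, ENNReal.ofReal (-f x) ∂μ ≠ ∞ := hf.neg.lintegral_lt_top.ne
  rw [extIntegral, integral_eq_lintegral_pos_part_sub_lintegral_neg_part hf, EReal.coe_sub,
    EReal.coe_ennreal_toReal h1, EReal.coe_ennreal_toReal h2]

/-- An integrable minorant makes the negative part finite, so failure of integrability can only come
from the positive part. -/
theorem extIntegral_eq_top {α : Type*} [MeasurableSpace α] {μ : Measure α} {f g : α → ℝ}
    (hm : AEStronglyMeasurable f μ) (hg : Integrable g μ) (hle : ∀ x, g x ≤ f x)
    (hf : ¬ Integrable f μ) : extIntegral μ f = ⊤ := by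
  have h2 : ∫⁻ x, ENNReal.ofReal (-f x) ∂μ ≠ ∞ :=
    ((lintegral_mono fun x => ENNReal.ofReal_le_ofReal (neg_le_neg (hle x))).trans_lt
      hg.neg.lintegral_lt_top).ne
  have h1 : ∫⁻ x, ENNReal.ofReal (f x) ∂μ = ∞ := by
    by_contra h1
    refine hf ⟨hm, ?_⟩
    have : ∀ x, ‖f x‖ₑ = ENNReal.ofReal (f x) + ENNReal.ofReal (-f x) := fun x => by
      rw [Real.enorm_eq_ofReal_abs]
      rcases le_total 0 (f x) with h | h
      · rw [abs_of_nonneg h, ENNReal.ofReal_of_nonpos (neg_nonpos.2 h), add_zero]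
      · rw [abs_of_nonpos h, ENNReal.ofReal_of_nonpos h, zero_add]
    rw [HasFiniteIntegral]
    simp_rw [this]
    rw [lintegral_add_left' hm.aemeasurable.ennreal_ofReal]
    exact ENNReal.add_lt_top.2 ⟨lt_top_iff_ne_top.2 h1, lt_top_iff_ne_top.2 h2⟩
  rw [extIntegral, h1]
  lift ∫⁻ x, ENNReal.ofReal (-f x) ∂μ to NNReal using h2 with b
  exact EReal.top_sub_coe _

theorem integrable_of_forall_integral_min_le {α : Type*} [MeasurableSpace α] {μ : Measure α}
    [IsFiniteMeasure μ] {F : α → ℝ} (hF : Measurable F) (h0 : ∀ x, 0 ≤ F x) {c : ℝ}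
    (h : ∀ n : ℕ, ∫ x, min (F x) n ∂μ ≤ c) : Integrable F μ ∧ ∫ x, F x ∂μ ≤ c := by
  have hi : ∀ n : ℕ, Integrable (fun x => min (F x) n) μ := fun n =>
    Integrable.of_bound (C := n) (Measurable.aestronglyMeasurable (by fun_prop))
      (Eventually.of_forall fun x => by
        rw [Real.norm_of_nonneg (le_min (h0 x) (Nat.cast_nonneg n))]; exact min_le_right _ _)
  -- The truncation at n = 0 is the zero function.
  have hc : 0 ≤ c := le_trans (by simp [h0]) (h 0)
  have hfat : ∫⁻ x, ENNReal.ofReal (F x) ∂μ ≤ ENNReal.ofReal c := by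
    have h4 : ∀ x, ENNReal.ofReal (F x) = liminf (fun n : ℕ => ENNReal.ofReal (min (F x) n)) atTop := by
      intro x
      refine (Tendsto.liminf_eq (tendsto_const_nhds.congr' ?_)).symm
      obtain ⟨N, hN⟩ := exists_nat_ge (F x)
      filter_upwards [eventually_ge_atTop N] with n hn
      rw [min_eq_left (hN.trans (by exact_mod_cast hn))]
    simp_rw [h4]
    refine (lintegral_liminf_le' fun n => (hi n).1.aemeasurable.ennreal_ofReal).trans ?_
    refine liminf_le_of_le (by isBoundedDefault) fun b hb => ?_
    obtain ⟨n, hn⟩ := hb.exists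
    refine hn.trans ?_
    rw [← ofReal_integral_eq_lintegral_ofReal (hi n)
      (Eventually.of_forall fun x => le_min (h0 x) (Nat.cast_nonneg n))]
    exact ENNReal.ofReal_le_ofReal (h n)
  have hFi : Integrable F μ := by
    refine ⟨hF.aestronglyMeasurable, ?_⟩
    rw [hasFiniteIntegral_iff_ofReal (Eventually.of_forall h0)]
    exact hfat.trans_lt ENNReal.ofReal_lt_top
  refine ⟨hFi, ?_⟩
  rwa [← ofReal_integral_eq_lintegral_ofReal hFi (Eventually.of_forall h0),
    ENNReal.ofReal_le_ofReal_iff hc] at hfat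

/-! ### Weak limits -/

/-- Lower semicontinuity under weak convergence: the truncations min(F, n) are bounded and
continuous, so their integrals converge, and then n → ∞. The bounds c i may vary, which allows other
convergent terms to be moved into them. -/
theorem integrable_of_tendsto {X ι : Type*} [TopologicalSpace X] [MeasurableSpace X]
    [BorelSpace X] {l : Filter ι} [l.NeBot] {π : ι → ProbabilityMeasure X}
    {π' : ProbabilityMeasure X} (hπ : Tendsto π l (𝓝 π')) {F : X → ℝ} (hF : Continuous F)
    (h0 : ∀ x, 0 ≤ F x) {c : ι → ℝ} {c' : ℝ} (hc : Tendsto c l (𝓝 c'))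
    (hi : ∀ i, Integrable F (π i)) (hle : ∀ i, ∫ x, F x ∂(π i : Measure X) ≤ c i) :
    Integrable F (π' : Measure X) ∧ ∫ x, F x ∂(π' : Measure X) ≤ c' := by
  refine integrable_of_forall_integral_min_le hF.measurable h0 fun n => ?_
  let f : BoundedContinuousFunction X ℝ := BoundedContinuousFunction.ofNormedAddCommGroup
    (fun x => min (F x) n) (by fun_prop) n fun x => by
      rw [Real.norm_of_nonneg (le_min (h0 x) (Nat.cast_nonneg n))]; exact min_le_right _ _
  have h1 := ProbabilityMeasure.tendsto_iff_forall_integral_tendsto.1 hπ f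
  refine le_of_tendsto_of_tendsto' h1 hc fun i => ?_
  exact (integral_mono (f.integrable _) (hi i) fun x => min_le_left _ _).trans (hle i)

/-- Chebyshev's inequality gives tightness and Prokhorov's theorem compactness. A limit along an
ultrafilter replaces the extraction of subsequences. -/
theorem exists_tendsto_of_moment_le {X : Type*} [NormedAddCommGroup X] [ProperSpace X]
    [MeasurableSpace X] [BorelSpace X] (π : ℕ → ProbabilityMeasure X) (C : ℝ)
    (h : ∀ n, ∫⁻ x, ‖x‖ₑ ^ 2 ∂(π n : Measure X) ≤ ENNReal.ofReal C) :
    ∃ π', Tendsto π (hyperfilter ℕ) (𝓝 π') := by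
  have htight : IsTightMeasureSet {x : Measure X | ∃ μ ∈ range π, ↑μ = x} := by
    refine isTightMeasureSet_of_tendsto_measure_norm_gt ?_
    have hlim : Tendsto (fun r : ℝ => ENNReal.ofReal C / ENNReal.ofReal r ^ 2) atTop (𝓝 0) := by
      have : Tendsto (fun r : ℝ => ENNReal.ofReal r ^ 2) atTop (𝓝 (∞ ^ 2)) :=
        ENNReal.Tendsto.pow ENNReal.tendsto_ofReal_atTop
      have h2 := ENNReal.Tendsto.const_div (a := ENNReal.ofReal C) this (Or.inr (by simp))
      simpa using h2
    refine tendsto_of_tendsto_of_tendsto_of_le_of_le' tendsto_const_nhds hlim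
      (Eventually.of_forall fun _ => zero_le) ?_
    filter_upwards [eventually_gt_atTop 0] with r hr
    refine iSup₂_le fun μ hμ => ?_
    obtain ⟨_, ⟨n, rfl⟩, rfl⟩ := hμ
    have hr2 : ENNReal.ofReal r ^ 2 ≠ 0 := pow_ne_zero 2 (by simpa using hr)
    have h3 := meas_ge_le_lintegral_div (μ := (π n : Measure X)) (f := fun x => ‖x‖ₑ ^ 2)
      (Measurable.aemeasurable (by fun_prop)) hr2 (by simp)
    refine (measure_mono fun x hx => ?_).trans (h3.trans (ENNReal.div_le_div_right (h n) _))
    have : r ≤ ‖x‖ := le_of_lt hx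
    change ENNReal.ofReal r ^ 2 ≤ ‖x‖ₑ ^ 2
    gcongr
    rw [← ofReal_norm]
    exact ENNReal.ofReal_le_ofReal this
  have hcpt := isCompact_closure_of_isTightMeasureSet htight
  obtain ⟨π', -, hπ'⟩ := hcpt.ultrafilter_le_nhds ((hyperfilter ℕ).map π) (by
    rw [le_principal_iff]
    exact mem_of_superset (Filter.image_mem_map univ_mem)
      (by rw [image_univ]; exact subset_closure))
  exact ⟨π', hπ'⟩

theorem hyperfilter_le_atTop : (hyperfilter ℕ : Filter ℕ) ≤ atTop := by
  rw [← Nat.cofinite_eq_atTop]; exact hyperfilter_le_cofinite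

/-! ### The topology of the Wasserstein space -/

theorem IsCoupling.isProbabilityMeasure {γ : Measure (Euc d × Euc d)} {μ ν : WassersteinSpace d}
    (h : IsCoupling γ μ ν) : IsProbabilityMeasure γ := by
  constructor
  rw [← preimage_univ (f := Prod.fst), ← Measure.map_apply measurable_fst MeasurableSet.univ, h.1]
  exact measure_univ

theorem IsCoupling.integrable_fst {γ : Measure (Euc d × Euc d)} {μ ν : WassersteinSpace d}
    (h : IsCoupling γ μ ν) : Integrable (fun p => ‖p.1‖ ^ 2) γ := by
  have := μ.integrable_norm_sq
  rw [← h.1] at this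
  exact this.comp_measurable measurable_fst

theorem IsCoupling.integrable_snd {γ : Measure (Euc d × Euc d)} {μ ν : WassersteinSpace d}
    (h : IsCoupling γ μ ν) : Integrable (fun p => ‖p.2‖ ^ 2) γ := by
  have := ν.integrable_norm_sq
  rw [← h.2] at this
  exact this.comp_measurable measurable_snd

theorem norm_sub_sq_le {E : Type*} [SeminormedAddCommGroup E] (x y : E) :
    ‖x - y‖ ^ 2 ≤ 2 * ‖x‖ ^ 2 + 2 * ‖y‖ ^ 2 := by
  have := norm_sub_le x y
  nlinarith [sq_nonneg (‖x‖ - ‖y‖), norm_nonneg (x - y), norm_nonneg x, norm_nonneg y]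

theorem integrable_norm_sub_sq {α : Type*} [MeasurableSpace α] {π : Measure α} {f g : α → Euc d}
    (hf : Measurable f) (hg : Measurable g) (h1 : Integrable (fun a => ‖f a‖ ^ 2) π)
    (h2 : Integrable (fun a => ‖g a‖ ^ 2) π) : Integrable (fun a => ‖f a - g a‖ ^ 2) π := by
  refine ((h1.const_mul 2).add (h2.const_mul 2)).mono'
    (Measurable.aestronglyMeasurable (by fun_prop)) (Eventually.of_forall fun a => ?_)
  rw [Real.norm_of_nonneg (by positivity)]
  exact norm_sub_sq_le _ _

theorem IsCoupling.integrable_cost {γ : Measure (Euc d × Euc d)} {μ ν : WassersteinSpace d}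
    (h : IsCoupling γ μ ν) : Integrable (fun p => ‖p.1 - p.2‖ ^ 2) γ :=
  integrable_norm_sub_sq measurable_fst measurable_snd h.integrable_fst h.integrable_snd

theorem IsCoupling.toReal_transportCost {γ : Measure (Euc d × Euc d)} {μ ν : WassersteinSpace d}
    (h : IsCoupling γ μ ν) : (transportCost γ).toReal = ∫ p, ‖p.1 - p.2‖ ^ 2 ∂γ := by
  rw [integral_eq_lintegral_of_nonneg_ae (Eventually.of_forall fun p => by positivity)
    h.integrable_cost.1, transportCost]
  congr 1
  refine lintegral_congr fun p => ?_
  rw [ENNReal.ofReal_pow (norm_nonneg _), ofReal_norm]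

theorem dist_sq_eq (μ ν : WassersteinSpace d) : dist μ ν ^ 2 = (wassersteinSq μ ν).toReal :=
  Real.sq_sqrt ENNReal.toReal_nonneg

theorem IsCoupling.dist_sq_le {γ : Measure (Euc d × Euc d)} {μ ν : WassersteinSpace d}
    (h : IsCoupling γ μ ν) : dist μ ν ^ 2 ≤ ∫ p, ‖p.1 - p.2‖ ^ 2 ∂γ := by
  rw [dist_sq_eq, ← h.toReal_transportCost]
  exact ENNReal.toReal_mono h.transportCost_lt_top.ne (iInf_le
    (fun γ : {γ : Measure (Euc d × Euc d) // IsCoupling γ μ ν} => transportCost γ.1) ⟨γ, h⟩)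

theorem exists_coupling_lt (μ ν : WassersteinSpace d) {c : ℝ} (hc : dist μ ν ^ 2 < c) :
    ∃ γ, IsCoupling γ μ ν ∧ ∫ p, ‖p.1 - p.2‖ ^ 2 ∂γ < c := by
  have hc0 : 0 ≤ c := (sq_nonneg _).trans hc.le
  rw [dist_sq_eq, ← ENNReal.lt_ofReal_iff_toReal_lt (wassersteinSq_lt_top μ ν).ne] at hc
  obtain ⟨⟨γ, hγ⟩, hlt⟩ := iInf_lt_iff.1 hc
  refine ⟨γ, hγ, ?_⟩
  rw [← hγ.toReal_transportCost]
  exact (ENNReal.lt_ofReal_iff_toReal_lt hγ.transportCost_lt_top.ne).1 hlt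

/-- The Dirac mass at the origin. -/
def diracZero (d : ℕ) : WassersteinSpace d where
  measure := Measure.dirac 0
  isProbabilityMeasure := inferInstance
  integrable_norm_sq := integrable_dirac (by simp)

/-- Every coupling with δ₀ is concentrated on {y = 0}, so all have the same cost. In particular the
second moment is continuous for d₂. -/
theorem dist_diracZero_sq (μ : WassersteinSpace d) :
    dist μ (diracZero d) ^ 2 = ∫ x, ‖x‖ ^ 2 ∂μ.measure := by
  have key : ∀ γ, IsCoupling γ μ (diracZero d) →
      ∫ p, ‖p.1 - p.2‖ ^ 2 ∂γ = ∫ x, ‖x‖ ^ 2 ∂μ.measure := by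
    intro γ hγ
    have h0 : ∀ᵐ p ∂γ, p.2 = 0 := by
      have : ∀ᵐ y ∂(γ.map Prod.snd), y = 0 := by
        rw [hγ.2]; simp [diracZero, ae_dirac_eq]
      exact ae_of_ae_map measurable_snd.aemeasurable this
    rw [← hγ.1, integral_map measurable_fst.aemeasurable
      (Measurable.aestronglyMeasurable (by fun_prop))]
    refine integral_congr_ae ?_
    filter_upwards [h0] with p hp
    rw [hp, sub_zero]
  refine le_antisymm ?_ (le_of_forall_gt fun c hc => ?_)
  · rw [← key _ (isCoupling_prod _ _)]
    exact (isCoupling_prod _ _).dist_sq_le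
  · obtain ⟨γ, hγ, hlt⟩ := exists_coupling_lt _ _ hc
    rwa [key γ hγ] at hlt

theorem continuous_secondMoment :
    Continuous fun μ : WassersteinSpace d => ∫ x, ‖x‖ ^ 2 ∂μ.measure := by
  simp_rw [← dist_diracZero_sq]
  fun_prop

/-- The variance is nonnegative. -/
theorem sq_integral_le {α : Type*} [MeasurableSpace α] {π : Measure α} [IsProbabilityMeasure π]
    {f : α → ℝ} (hf : Integrable f π) (hf2 : Integrable (fun x => f x ^ 2) π) :
    (∫ x, f x ∂π) ^ 2 ≤ ∫ x, f x ^ 2 ∂π := by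
  set c := ∫ x, f x ∂π with hc
  have h : 0 ≤ ∫ x, (f x ^ 2 - (2 * c * f x - c ^ 2)) ∂π := by
    refine integral_nonneg fun x => ?_
    simp only [Pi.zero_apply]
    nlinarith [sq_nonneg (f x - c)]
  have h2 : Integrable (fun x => 2 * c * f x - c ^ 2) π :=
    (hf.const_mul _).sub (integrable_const _)
  rw [integral_sub hf2 h2,
    integral_sub (hf.const_mul _) (integrable_const _), integral_const_mul, ← hc] at h
  simp at h
  nlinarith

theorem integrable_norm_of_sq {α : Type*} [MeasurableSpace α] {π : Measure α} [IsFiniteMeasure π]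
    {f : α → Euc d} (hf : Measurable f) (h : Integrable (fun a => ‖f a‖ ^ 2) π) :
    Integrable (fun a => ‖f a‖) π := by
  refine ((integrable_const 1).add h).mono' (Measurable.aestronglyMeasurable (by fun_prop))
    (Eventually.of_forall fun a => ?_)
  rw [norm_norm]
  simp only [Pi.add_apply]
  nlinarith [sq_nonneg (‖f a‖ - 1 / 2)]

/-- Integrate the Lipschitz bound against a nearly optimal coupling and apply Cauchy-Schwarz. It
shows that d₂-convergence implies weak convergence, for which bounded Lipschitz test functions
suffice. -/
theorem abs_integral_sub_le_of_lipschitz {μ ν : WassersteinSpace d} {h : Euc d → ℝ}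
    (hb : ∃ M, ∀ x, |h x| ≤ M) {K : NNReal} (hK : LipschitzWith K h) :
    |∫ x, h x ∂μ.measure - ∫ x, h x ∂ν.measure| ≤ K * dist μ ν := by
  obtain ⟨M, hM⟩ := hb
  have hm : Measurable h := hK.continuous.measurable
  refine le_of_forall_gt_imp_ge_of_dense fun c hc => ?_
  by_cases hK0 : (K : ℝ) = 0
  · have hconst : ∀ x, h x = h 0 := fun x => by
      have := hK.dist_le_mul x 0
      rw [hK0, zero_mul] at this
      exact dist_le_zero.1 this
    simp_rw [hconst]
    simp only [hK0, zero_mul] at hc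
    simpa using hc.le
  have hKp : (0 : ℝ) < K := lt_of_le_of_ne K.2 (Ne.symm hK0)
  have hcK : dist μ ν ^ 2 < (c / K) ^ 2 := by
    have : dist μ ν < c / K := by rw [lt_div_iff₀ hKp]; linarith
    have h0 := dist_nonneg (x := μ) (y := ν)
    nlinarith
  have hc0 : 0 ≤ c / K := div_nonneg (le_trans (by positivity) hc.le) hKp.le
  obtain ⟨γ, hγ, hlt⟩ := exists_coupling_lt _ _ hcK
  have := hγ.isProbabilityMeasure
  rw [← hγ.1, ← hγ.2, integral_map measurable_fst.aemeasurable hm.aestronglyMeasurable,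
    integral_map measurable_snd.aemeasurable hm.aestronglyMeasurable]
  have hi : ∀ f : Euc d × Euc d → Euc d, Measurable f → Integrable (fun p => h (f p)) γ :=
    fun f hf => Integrable.of_bound (hm.comp hf).aestronglyMeasurable M
      (Eventually.of_forall fun p => hM _)
  have hi2 := hγ.integrable_cost
  have hi1 : Integrable (fun p : Euc d × Euc d => ‖p.1 - p.2‖) γ :=
    integrable_norm_of_sq (by fun_prop) hi2
  rw [← integral_sub (hi _ measurable_fst) (hi _ measurable_snd)]
  calc |∫ p, (h p.1 - h p.2) ∂γ| ≤ ∫ p, |h p.1 - h p.2| ∂γ := abs_integral_le_integral_abs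
    _ ≤ ∫ p, K * ‖p.1 - p.2‖ ∂γ := by
        refine integral_mono ((hi _ measurable_fst).sub (hi _ measurable_snd)).abs
          (hi1.const_mul _) fun p => ?_
        have := hK.dist_le_mul p.1 p.2
        rwa [Real.dist_eq, dist_eq_norm] at this
    _ = K * ∫ p, ‖p.1 - p.2‖ ∂γ := integral_const_mul _ _
    _ ≤ K * (c / K) := by
        gcongr
        exact abs_le_of_sq_le_sq' ((sq_integral_le hi1 hi2).trans hlt.le) hc0 |>.2
    _ = c := by field_simp

/-- An element of the Wasserstein space as a bundled probability measure. -/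
def WassersteinSpace.toProb (μ : WassersteinSpace d) : ProbabilityMeasure (Euc d) :=
  ⟨μ.measure, inferInstance⟩

theorem continuous_toProb : Continuous (WassersteinSpace.toProb (d := d)) := by
  refine continuous_iff_continuousAt.2 fun μ => ?_
  refine tendsto_iff_forall_lipschitz_integral_tendsto.2 fun f ⟨C, hC⟩ ⟨L, hL⟩ => ?_
  have hb : ∃ M, ∀ x, |f x| ≤ M := by
    refine ⟨|f 0| + C, fun x => ?_⟩
    have h1 := hC x 0
    rw [Real.dist_eq] at h1
    have := abs_sub_abs_le_abs_sub (f x) (f 0)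
    linarith
  rw [tendsto_iff_dist_tendsto_zero]
  have h0 : Tendsto (fun ν : WassersteinSpace d => L * dist ν μ) (𝓝 μ) (𝓝 0) := by
    have : Continuous fun ν : WassersteinSpace d => (L : ℝ) * dist ν μ := by fun_prop
    simpa using this.tendsto μ
  refine squeeze_zero (fun _ => dist_nonneg) (fun ν => ?_) h0
  rw [Real.dist_eq]
  exact abs_integral_sub_le_of_lipschitz hb hL

theorem continuous_integral_of_bounded {h : Euc d → ℝ} (hc : Continuous h)
    (hb : ∃ M, ∀ x, |h x| ≤ M) :
    Continuous fun μ : WassersteinSpace d => ∫ x, h x ∂μ.measure := by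
  obtain ⟨M, hM⟩ := hb
  let f : BoundedContinuousFunction (Euc d) ℝ :=
    BoundedContinuousFunction.ofNormedAddCommGroup h hc M hM
  refine continuous_iff_continuousAt.2 fun μ => ?_
  exact ProbabilityMeasure.tendsto_iff_forall_integral_tendsto.1
    (continuous_toProb.tendsto μ) f

theorem enorm_prod_sq_le {X Y : Type*} [SeminormedAddCommGroup X] [SeminormedAddCommGroup Y]
    (p : X × Y) : ‖p‖ₑ ^ 2 ≤ ‖p.1‖ₑ ^ 2 + ‖p.2‖ₑ ^ 2 := by
  have h : ‖p‖₊ ^ 2 ≤ ‖p.1‖₊ ^ 2 + ‖p.2‖₊ ^ 2 := by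
    rw [Prod.nnnorm_def]
    rcases le_total ‖p.1‖₊ ‖p.2‖₊ with h | h
    · rw [max_eq_right h]; exact le_add_self
    · rw [max_eq_left h]; exact le_self_add
  simp only [enorm_eq_nnnorm]
  exact_mod_cast h

/-- Image measures under continuous maps pass to weak limits, and weak limits are unique. This is
how limits of plans keep their marginals, even when the marginals vary. -/
theorem map_eq_of_tendsto {X ι : Type*} [TopologicalSpace X] [MeasurableSpace X] [BorelSpace X]
    {l : Filter ι} [l.NeBot] {π : ι → ProbabilityMeasure X} {π' : ProbabilityMeasure X}
    (hπ : Tendsto π l (𝓝 π')) {f : X → Euc d} (hf : Continuous f) {μ : ι → WassersteinSpace d}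
    {μ' : WassersteinSpace d} (hμ : Tendsto μ l (𝓝 μ'))
    (h : ∀ i, (π i : Measure X).map f = (μ i).measure) : (π' : Measure X).map f = μ'.measure := by
  have h1 := ProbabilityMeasure.tendsto_map_of_tendsto_of_continuous π π' hπ hf
  have h2 : ∀ i, (π i).map hf.measurable.aemeasurable = (μ i).toProb := fun i =>
    Subtype.ext (h i)
  simp_rw [h2] at h1
  have h3 : Tendsto (fun i => (μ i).toProb) l (𝓝 μ'.toProb) :=
    (continuous_toProb.tendsto μ').comp hμ
  have h4 : π'.map hf.measurable.aemeasurable = μ'.toProb := tendsto_nhds_unique h1 h3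
  exact congrArg (fun p : ProbabilityMeasure (Euc d) => (p : Measure (Euc d))) h4

theorem lintegral_enorm_sq_eq {α : Type*} [MeasurableSpace α] {π : Measure α} {f : α → Euc d}
    (h : Integrable (fun a => ‖f a‖ ^ 2) π) :
    ∫⁻ a, ‖f a‖ₑ ^ 2 ∂π = ENNReal.ofReal (∫ a, ‖f a‖ ^ 2 ∂π) := by
  rw [ofReal_integral_eq_lintegral_ofReal h (Eventually.of_forall fun a => by positivity)]
  refine lintegral_congr fun a => ?_
  rw [ENNReal.ofReal_pow (norm_nonneg _), ofReal_norm]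

theorem IsCoupling.lintegral_enorm_sq_le {γ : Measure (Euc d × Euc d)} {μ ν : WassersteinSpace d}
    (h : IsCoupling γ μ ν) : ∫⁻ p, ‖p‖ₑ ^ 2 ∂γ
      ≤ ENNReal.ofReal (∫ x, ‖x‖ ^ 2 ∂μ.measure + ∫ x, ‖x‖ ^ 2 ∂ν.measure) := by
  refine (lintegral_mono enorm_prod_sq_le).trans ?_
  rw [lintegral_add_left (by fun_prop), lintegral_enorm_sq_eq h.integrable_fst,
    lintegral_enorm_sq_eq h.integrable_snd, ← ENNReal.ofReal_add
    (integral_nonneg fun _ => by positivity) (integral_nonneg fun _ => by positivity),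
    ← h.1, ← h.2, integral_map measurable_fst.aemeasurable
      (Measurable.aestronglyMeasurable (by fun_prop)), integral_map measurable_snd.aemeasurable
      (Measurable.aestronglyMeasurable (by fun_prop))]

theorem exists_tendsto_isCoupling {μ ν : WassersteinSpace d}
    {γ : ℕ → ProbabilityMeasure (Euc d × Euc d)}
    (hγ : ∀ n, IsCoupling (γ n : Measure (Euc d × Euc d)) μ ν) :
    ∃ γ', Tendsto γ (hyperfilter ℕ) (𝓝 γ') ∧
      IsCoupling (γ' : Measure (Euc d × Euc d)) μ ν := by
  obtain ⟨γ', hγ'⟩ := exists_tendsto_of_moment_le γ _ fun n => (hγ n).lintegral_enorm_sq_le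
  exact ⟨γ', hγ', map_eq_of_tendsto hγ' continuous_fst tendsto_const_nhds fun n => (hγ n).1,
    map_eq_of_tendsto hγ' continuous_snd tendsto_const_nhds fun n => (hγ n).2⟩

/-- Direct method: the fixed marginals bound the second moments of a minimising sequence, and the
cost is weakly lower semicontinuous. -/
theorem exists_optimal_coupling (μ ν : WassersteinSpace d) :
    ∃ γ, IsCoupling γ μ ν ∧ ∫ p, ‖p.1 - p.2‖ ^ 2 ∂γ = dist μ ν ^ 2 := by
  have hex : ∀ n : ℕ, ∃ γ, IsCoupling γ μ ν ∧
      ∫ p, ‖p.1 - p.2‖ ^ 2 ∂γ < dist μ ν ^ 2 + 1 / ((n : ℝ) + 1) := fun n =>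
    exists_coupling_lt μ ν (by have : 0 < 1 / ((n : ℝ) + 1) := by positivity
                               linarith)
  choose γ hγ hlt using hex
  let π : ℕ → ProbabilityMeasure (Euc d × Euc d) := fun n => ⟨γ n, (hγ n).isProbabilityMeasure⟩
  obtain ⟨π', hπ', hc⟩ := exists_tendsto_isCoupling (γ := π) hγ
  have hlim : Tendsto (fun n : ℕ => dist μ ν ^ 2 + 1 / ((n : ℝ) + 1)) (hyperfilter ℕ)
      (𝓝 (dist μ ν ^ 2)) := by
    have := (tendsto_one_div_add_atTop_nhds_zero_nat (𝕜 := ℝ)).const_add (dist μ ν ^ 2)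
    rw [add_zero] at this
    exact this.mono_left hyperfilter_le_atTop
  refine ⟨π', hc, le_antisymm ?_ hc.dist_sq_le⟩
  exact (integrable_of_tendsto hπ' (F := fun p => ‖p.1 - p.2‖ ^ 2) (by fun_prop)
    (fun _ => by positivity) hlim (fun n => (hγ n).integrable_cost) fun n => (hlt n).le).2

end

noncomputable section

variable {d : ℕ}

/-! ### The entropy on the Wasserstein space -/

theorem entropy_eq_coe {μ : WassersteinSpace d} (hac : μ.measure ≪ volume)
    (hent : Integrable (entDensity μ.measure)) :
    entropy μ = ((∫ x, entDensity μ.measure x : ℝ) : EReal) := by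
  rw [entropy, if_pos hac]
  exact extIntegral_eq_coe hent

/-- Fenchel-Young at a = -|x|². For absolutely continuous μ with finite second moment the left side
is integrable, so the entropy is either a finite integral or +∞. -/
theorem neg_sub_exp_le_entDensity (μ : Measure (Euc d)) (x : Euc d) :
    -((μ.rnDeriv volume x).toReal * ‖x‖ ^ 2) - Real.exp (-‖x‖ ^ 2 - 1) ≤ entDensity μ x := by
  have := mul_sub_exp_le (r := (μ.rnDeriv volume x).toReal) ENNReal.toReal_nonneg (-‖x‖ ^ 2)
  unfold entDensity
  linarith

theorem entropy_eq_top {μ : WassersteinSpace d}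
    (h : ¬ (μ.measure ≪ volume ∧ Integrable (entDensity μ.measure))) : entropy μ = ⊤ := by
  by_cases hac : μ.measure ≪ volume
  · rw [entropy, if_pos hac]
    refine extIntegral_eq_top (measurable_entDensity _).aestronglyMeasurable
      (Integrable.sub ?_ integrable_gaussian) (neg_sub_exp_le_entDensity μ.measure)
      fun hi => h ⟨hac, hi⟩
    refine Integrable.neg ?_
    simpa using (integrable_rnDeriv_smul_iff hac).2 μ.integrable_norm_sq
  · rw [entropy, if_neg hac]

theorem dualEntropy_le_entropy (μ : WassersteinSpace d) {h : Euc d → ℝ} (hc : Continuous h)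
    (hb : ∃ M, ∀ x, |h x| ≤ M) : (dualEntropy h μ.measure : EReal) ≤ entropy μ := by
  by_cases hμ : μ.measure ≪ volume ∧ Integrable (entDensity μ.measure)
  · obtain ⟨M, hM⟩ := hb
    rw [entropy_eq_coe hμ.1 hμ.2, EReal.coe_le_coe_iff]
    exact dualEntropy_le hμ.1 hμ.2 μ.integrable_norm_sq hc.measurable hM
  · rw [entropy_eq_top hμ]; exact le_top

/-- The nontrivial inequality: any real c above the supremum bounds all dual functionals, hence the
entropy by `entropy_le_of_dualEntropy_le`. -/
theorem entropy_eq_iSup (μ : WassersteinSpace d) :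
    entropy μ = ⨆ h : {h : Euc d → ℝ // Continuous h ∧ ∃ M, ∀ x, |h x| ≤ M},
      (dualEntropy h.1 μ.measure : EReal) := by
  refine le_antisymm ?_ (iSup_le fun h => dualEntropy_le_entropy μ h.2.1 h.2.2)
  refine EReal.le_of_forall_lt_iff_le.1 fun c hc => ?_
  have h1 := entropy_le_of_dualEntropy_le μ.integrable_norm_sq (c := c) fun h hcont hb => by
    have h2 := (le_iSup (fun h : {h : Euc d → ℝ // Continuous h ∧ ∃ M, ∀ x, |h x| ≤ M} =>
      (dualEntropy h.1 μ.measure : EReal)) ⟨h, hcont, hb⟩).trans hc.le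
    exact EReal.coe_le_coe_iff.1 h2
  rw [entropy_eq_coe h1.1 h1.2.1]
  exact EReal.coe_le_coe_iff.2 h1.2.2

theorem continuous_dualEntropy {h : Euc d → ℝ} (hc : Continuous h) (hb : ∃ M, ∀ x, |h x| ≤ M) :
    Continuous fun μ : WassersteinSpace d => dualEntropy h μ.measure := by
  have h1 : ∀ μ : WassersteinSpace d, ∫ x, (h x - ‖x‖ ^ 2) ∂μ.measure
      = ∫ x, h x ∂μ.measure - ∫ x, ‖x‖ ^ 2 ∂μ.measure := fun μ => by
    obtain ⟨M, hM⟩ := hb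
    exact integral_sub (Integrable.of_bound hc.aestronglyMeasurable M (Eventually.of_forall hM))
      μ.integrable_norm_sq
  simp only [dualEntropy, h1]
  exact ((continuous_integral_of_bounded hc hb).sub continuous_secondMoment).sub continuous_const

theorem lowerSemicontinuous_entropy : LowerSemicontinuous (entropy (d := d)) := by
  have : entropy (d := d) = fun μ => ⨆ h : {h : Euc d → ℝ // Continuous h ∧ ∃ M, ∀ x, |h x| ≤ M},
      (dualEntropy h.1 μ.measure : EReal) := funext entropy_eq_iSup
  rw [this]
  exact lowerSemicontinuous_iSup fun h =>
    (continuous_coe_real_ereal.comp (continuous_dualEntropy h.2.1 h.2.2)).lowerSemicontinuous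

theorem neg_sub_le_integral_entDensity {μ : WassersteinSpace d} (hac : μ.measure ≪ volume)
    (hent : Integrable (entDensity μ.measure)) :
    -∫ x, ‖x‖ ^ 2 ∂μ.measure - ∫ x : Euc d, Real.exp (-‖x‖ ^ 2 - 1)
      ≤ ∫ x, entDensity μ.measure x := by
  have := dualEntropy_le hac hent μ.integrable_norm_sq (h := 0) measurable_zero (M := 0) (by simp)
  simpa [dualEntropy, integral_neg] using this

/-! ### Lower semicontinuity of potential energies -/

theorem integrable_quadratic (μ : WassersteinSpace d) (A B : ℝ) :
    Integrable (fun x => A + B * ‖x‖ ^ 2) μ.measure :=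
  (integrable_const A).add (μ.integrable_norm_sq.const_mul B)

theorem integral_quadratic (μ : WassersteinSpace d) (A B : ℝ) :
    ∫ x, (A + B * ‖x‖ ^ 2) ∂μ.measure = A + B * ∫ x, ‖x‖ ^ 2 ∂μ.measure := by
  rw [integral_add (integrable_const A) (μ.integrable_norm_sq.const_mul B), integral_const_mul]
  simp

theorem extIntegral_ne_bot {μ : WassersteinSpace d} {F : Euc d → ℝ} (hF : Continuous F) {A B : ℝ}
    (hle : ∀ x, A + B * ‖x‖ ^ 2 ≤ F x) : extIntegral μ.measure F ≠ ⊥ := by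
  by_cases hi : Integrable F μ.measure
  · rw [extIntegral_eq_coe hi]; exact EReal.coe_ne_bot _
  · rw [extIntegral_eq_top hF.aestronglyMeasurable (integrable_quadratic μ A B) hle hi]
    exact top_ne_bot

/-- Subtract the quadratic minorant, whose integral is continuous for d₂. The nonnegative remainder
G has integral the supremum over n of ∫ min(G, n), and each of these is continuous. -/
theorem lowerSemicontinuous_extIntegral {F : Euc d → ℝ} (hF : Continuous F) {A B : ℝ}
    (hle : ∀ x, A + B * ‖x‖ ^ 2 ≤ F x) :
    LowerSemicontinuous fun μ : WassersteinSpace d => extIntegral μ.measure F := by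
  set G : Euc d → ℝ := fun x => F x - (A + B * ‖x‖ ^ 2) with hG
  have hGc : Continuous G := by rw [hG]; fun_prop
  have hG0 : ∀ x, 0 ≤ G x := fun x => sub_nonneg.2 (hle x)
  have hmb : ∀ n : ℕ, ∀ x, |min (G x) n| ≤ n := fun n x => by
    rw [abs_of_nonneg (le_min (hG0 x) (Nat.cast_nonneg n))]; exact min_le_right _ _
  have hmi : ∀ (n : ℕ) (μ : WassersteinSpace d), Integrable (fun x => min (G x) n) μ.measure :=
    fun n μ => Integrable.of_bound (C := n) (Measurable.aestronglyMeasurable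
      (by have := hGc.measurable; fun_prop)) (Eventually.of_forall (hmb n))
  have heq : (fun μ : WassersteinSpace d => extIntegral μ.measure F) = fun μ => ⨆ n : ℕ,
      ((∫ x, min (G x) n ∂μ.measure + (A + B * ∫ x, ‖x‖ ^ 2 ∂μ.measure) : ℝ) : EReal) := by
    funext μ
    have hq := integrable_quadratic μ A B
    refine le_antisymm ?_ (iSup_le fun n => ?_)
    · refine EReal.le_of_forall_lt_iff_le.1 fun c hc => ?_
      have h1 : ∀ n : ℕ, ∫ x, min (G x) n ∂μ.measure
          ≤ c - (A + B * ∫ x, ‖x‖ ^ 2 ∂μ.measure) := fun n => by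
        have h2 := (le_iSup (fun n : ℕ => ((∫ x, min (G x) n ∂μ.measure
          + (A + B * ∫ x, ‖x‖ ^ 2 ∂μ.measure) : ℝ) : EReal)) n).trans hc.le
        have h3 := EReal.coe_le_coe_iff.1 h2
        linarith
      obtain ⟨hi, hle'⟩ := integrable_of_forall_integral_min_le hGc.measurable hG0 h1
      have hFi : Integrable F μ.measure :=
        (hi.add hq).congr (Eventually.of_forall fun x => by simp [hG])
      rw [extIntegral_eq_coe hFi, EReal.coe_le_coe_iff]
      rw [← integral_quadratic, hG, integral_sub hFi hq] at hle'
      linarith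
    · by_cases hi : Integrable F μ.measure
      · rw [extIntegral_eq_coe hi, EReal.coe_le_coe_iff, ← integral_quadratic,
          ← integral_add (hmi n μ) hq]
        refine integral_mono ((hmi n μ).add hq) hi fun x => ?_
        have : min (G x) n ≤ G x := min_le_left _ _
        simp only [hG] at this ⊢
        linarith
      · rw [extIntegral_eq_top hF.aestronglyMeasurable hq hle hi]; exact le_top
  rw [heq]
  refine lowerSemicontinuous_iSup fun n => (continuous_coe_real_ereal.comp ?_).lowerSemicontinuous
  exact (continuous_integral_of_bounded (hGc.min continuous_const) ⟨n, hmb n⟩).add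
    (continuous_const.add (continuous_const.mul continuous_secondMoment))

/-! ### The time-dependent potential -/

variable {V : ℝ → Euc d → ℝ} {lam : ℝ → ℝ}

theorem norm_combo_sq (x y : Euc d) (s : ℝ) :
    ‖(1 - s) • x + s • y‖ ^ 2
      = (1 - s) * ‖x‖ ^ 2 + s * ‖y‖ ^ 2 - s * (1 - s) * ‖x - y‖ ^ 2 := by
  rw [norm_add_sq_real, norm_sub_sq_real, norm_smul, norm_smul, inner_smul_left, inner_smul_right,
    mul_pow, mul_pow, Real.norm_eq_abs, Real.norm_eq_abs, sq_abs, sq_abs]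
  simp
  ring

theorem combo_le_of_convexOn {f : Euc d → ℝ} {ν : ℝ}
    (hf : ConvexOn ℝ univ fun x => f x - ν / 2 * ‖x‖ ^ 2) (x y : Euc d) {s : ℝ}
    (hs : s ∈ Icc (0 : ℝ) 1) :
    f ((1 - s) • x + s • y) ≤ (1 - s) * f x + s * f y - ν / 2 * (s * (1 - s)) * ‖x - y‖ ^ 2 := by
  have h := hf.2 (mem_univ x) (mem_univ y) (sub_nonneg.2 hs.2) hs.1 (by ring)
  simp only [norm_combo_sq, smul_eq_mul] at h
  nlinarith

theorem continuous_of_convexOn_sub {f : Euc d → ℝ} {ν : ℝ}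
    (hf : ConvexOn ℝ univ fun x => f x - ν / 2 * ‖x‖ ^ 2) : Continuous f := by
  have h := hf.locallyLipschitz.continuous
  have h2 : f = fun x => (f x - ν / 2 * ‖x‖ ^ 2) + ν / 2 * ‖x‖ ^ 2 := by ext x; ring
  rw [h2]
  fun_prop

/-- A Fréchet subgradient of a `ν`-convex function is a global one. -/
theorem le_of_mem_subdifferential {f : Euc d → ℝ} {ν : ℝ}
    (hf : ConvexOn ℝ univ fun x => f x - ν / 2 * ‖x‖ ^ 2) {p : Euc d}
    (hp : p ∈ subdifferential f 0) (x : Euc d) :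
    f 0 + inner ℝ p x + ν / 2 * ‖x‖ ^ 2 ≤ f x := by
  refine le_of_forall_pos_le_add fun δ hδ => ?_
  set ε := δ / (1 + ‖x‖) with hε
  have hx1 : 0 < 1 + ‖x‖ := by positivity
  have hεp : 0 < ε := by positivity
  have h1 := hp ε hεp
  have ht : Tendsto (fun s : ℝ => s • x) (𝓝[>] 0) (𝓝 0) := by
    have : Continuous fun s : ℝ => s • x := by fun_prop
    simpa using (this.tendsto 0).mono_left nhdsWithin_le_nhds
  have h2 := ht.eventually h1
  have hlim : Tendsto (fun s : ℝ => f 0 + inner ℝ p x - ε * ‖x‖ + ν / 2 * (1 - s) * ‖x‖ ^ 2)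
      (𝓝[>] 0) (𝓝 (f 0 + inner ℝ p x - ε * ‖x‖ + ν / 2 * (1 - 0) * ‖x‖ ^ 2)) := by
    have : Continuous fun s : ℝ => f 0 + inner ℝ p x - ε * ‖x‖ + ν / 2 * (1 - s) * ‖x‖ ^ 2 := by
      fun_prop
    exact (this.tendsto 0).mono_left nhdsWithin_le_nhds
  have h3 : f 0 + inner ℝ p x - ε * ‖x‖ + ν / 2 * (1 - 0) * ‖x‖ ^ 2 ≤ f x := by
    refine le_of_tendsto hlim ?_
    filter_upwards [h2, self_mem_nhdsWithin, Ioo_mem_nhdsGT (zero_lt_one' ℝ)] with s hs hs0 hs1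
    have hs0 : 0 < s := hs0
    have h4 := combo_le_of_convexOn hf 0 x ⟨hs0.le, hs1.2.le⟩
    simp only [smul_zero, zero_add, zero_sub, norm_neg] at h4
    simp only [sub_zero, inner_smul_right, norm_smul, Real.norm_eq_abs, abs_of_pos hs0] at hs
    -- The subgradient inequality at s x, combined with the convexity bound for f(s x) between 0 and
    -- x. Dividing by s and letting s → 0 makes the local inequality global.
    have h5 : s * (f 0 + inner ℝ p x - ε * ‖x‖ + ν / 2 * (1 - s) * ‖x‖ ^ 2) ≤ s * f x := by
      nlinarith
    exact le_of_mul_le_mul_left h5 hs0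
  have h6 : ε * ‖x‖ ≤ δ := by
    rw [hε, div_mul_eq_mul_div, div_le_iff₀ hx1]
    nlinarith
  linarith

theorem abs_sub_le_abs_integral {β : ℝ → ℝ}
    (hβ : ∀ s t, 0 ≤ s → s < t → ∀ x, |V s x - V t x| ≤ (∫ r in s..t, β r) * (1 + ‖x‖ ^ 2))
    {s t : ℝ} (hs : 0 ≤ s) (ht : 0 ≤ t) (x : Euc d) :
    |V s x - V t x| ≤ |∫ r in s..t, β r| * (1 + ‖x‖ ^ 2) := by
  have hx : 0 ≤ 1 + ‖x‖ ^ 2 := by positivity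
  rcases lt_trichotomy s t with h | rfl | h
  · exact (hβ s t hs h x).trans (mul_le_mul_of_nonneg_right (le_abs_self _) hx)
  · simp
  · rw [abs_sub_comm, intervalIntegral.integral_symm, abs_neg]
    exact (hβ t s ht h x).trans (mul_le_mul_of_nonneg_right (le_abs_self _) hx)

theorem intervalIntegrable_of_locallyIntegrableOn {β : ℝ → ℝ}
    (hβ : LocallyIntegrableOn β (Ici 0)) {s t : ℝ} (hs : 0 ≤ s) (ht : 0 ≤ t) :
    IntervalIntegrable β volume s t := by
  refine IntegrableOn.intervalIntegrable (hβ.integrableOn_compact_subset ?_ isCompact_uIcc)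
  intro r hr
  exact (le_min hs ht).trans hr.1

theorem HypV3.tendsto (hV3 : HypV3 V) {t : ℝ} (ht : 0 ≤ t) (x : Euc d) :
    Tendsto (fun s => V s x) (𝓝[Ici 0] t) (𝓝 (V t x)) := by
  obtain ⟨β, hβi, hβ⟩ := hV3
  have hc : ContinuousOn (fun s => ∫ r in t..s, β r) (uIcc 0 (t + 1)) :=
    intervalIntegral.continuousOn_primitive_interval'
      (intervalIntegrable_of_locallyIntegrableOn hβi le_rfl (by linarith))
      (by rw [uIcc_of_le (by linarith)]; exact ⟨ht, by linarith⟩)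
  rw [uIcc_of_le (by linarith)] at hc
  have h1 : Tendsto (fun s => ∫ r in t..s, β r) (𝓝[Ici 0] t) (𝓝 0) := by
    have h2 := hc t ⟨ht, by linarith⟩
    have h3 : 𝓝[Icc 0 (t + 1)] t = 𝓝[Ici 0] t := by
      rw [← Ici_inter_Iic]
      exact nhdsWithin_inter_of_mem' (mem_nhdsWithin_of_mem_nhds (Iic_mem_nhds (lt_add_one t)))
    rw [ContinuousWithinAt, h3] at h2
    simpa using h2
  rw [tendsto_iff_dist_tendsto_zero]
  have h4 : Tendsto (fun s => |∫ r in t..s, β r| * (1 + ‖x‖ ^ 2)) (𝓝[Ici 0] t) (𝓝 0) := by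
    simpa using h1.abs.mul_const (1 + ‖x‖ ^ 2)
  refine squeeze_zero' (Eventually.of_forall fun _ => dist_nonneg) ?_ h4
  filter_upwards [self_mem_nhdsWithin] with s hs
  rw [dist_comm, Real.dist_eq]
  exact abs_sub_le_abs_integral hβ ht hs x

theorem negBound_lt_top (h : LocallyEssBounded lam) {T : ℝ} (hT : 0 < T) : negBound lam T < ∞ := by
  refine lt_of_le_of_lt ?_ (h T hT).2
  rw [eLpNorm_exponent_top, eLpNormEssSup]
  refine essSup_mono_ae (Eventually.of_forall fun t => ?_)
  change ENNReal.ofReal (-lam t) ≤ ‖lam t‖ₑ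
  rw [Real.enorm_eq_ofReal_abs]
  exact ENNReal.ofReal_le_ofReal (neg_le_abs _)

theorem ae_neg_le_negBound (h : LocallyEssBounded lam) {T : ℝ} (hT : 0 < T) :
    ∀ᵐ t ∂(volume.restrict (Icc 0 T)), -(negBound lam T).toReal ≤ lam t := by
  filter_upwards [ENNReal.ae_le_essSup (μ := volume.restrict (Icc 0 T))
    fun t => ENNReal.ofReal (-lam t)] with t ht
  have h1 : ENNReal.ofReal (-lam t) ≤ negBound lam T := ht
  rw [ENNReal.ofReal_le_iff_le_toReal (negBound_lt_top h hT).ne] at h1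
  linarith

/-- By continuity in time the potential is convex with the essential bound at every time. -/
theorem convexOn_sub_max (hV1 : HypV1 V lam) (hV3 : HypV3 V) {T : ℝ} (hT : 0 < T) {t : ℝ}
    (ht : t ∈ Icc 0 T) :
    ConvexOn ℝ univ fun x => V t x - max (lam t) (-(negBound lam T).toReal) / 2 * ‖x‖ ^ 2 := by
  rcases le_total (-(negBound lam T).toReal) (lam t) with hle | hle
  · rw [max_eq_left hle]; exact hV1.2 t ht.1
  rw [max_eq_right hle]
  set Λ := (negBound lam T).toReal with hΛ
  set G : Set ℝ := {s | s ∈ Icc 0 T ∧ -Λ ≤ lam s} with hG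
  -- The good times G have full measure in [0, T], so they are dense there. The interval below has
  -- positive length even when t is an endpoint.
  have hne : (𝓝[G] t).NeBot := by
    rw [← mem_closure_iff_nhdsWithin_neBot, Metric.mem_closure_iff]
    intro ε hε
    have hpos : 0 < volume.restrict (Icc 0 T) (Ioo (max (t - ε) 0) (min (t + ε) T)) := by
      rw [Measure.restrict_apply measurableSet_Ioo, inter_eq_left.2, Real.volume_Ioo]
      · simp only [ENNReal.ofReal_pos, sub_pos, max_lt_iff, lt_min_iff]
        refine ⟨⟨?_, ?_⟩, ?_, ?_⟩ <;> linarith [ht.1, ht.2]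
      · intro r hr
        exact ⟨(le_max_right _ _).trans hr.1.le, hr.2.le.trans (min_le_right _ _)⟩
    obtain ⟨s, hs, hs'⟩ : ∃ s ∈ Ioo (max (t - ε) 0) (min (t + ε) T), -Λ ≤ lam s := by
      by_contra! hcon
      refine hpos.ne' (measure_mono_null (fun s hs => ?_)
        (ae_iff.1 (ae_neg_le_negBound hV1.1 hT)))
      exact not_le.2 (hcon s hs)
    simp only [mem_Ioo, max_lt_iff, lt_min_iff] at hs
    refine ⟨s, ⟨⟨hs.1.2.le, hs.2.2.le⟩, hs'⟩, ?_⟩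
    rw [Real.dist_eq, abs_lt]
    constructor <;> linarith [hs.1.1, hs.2.1]
  have hlim : ∀ x, Tendsto (fun s => V s x - -Λ / 2 * ‖x‖ ^ 2) (𝓝[G] t)
      (𝓝 (V t x - -Λ / 2 * ‖x‖ ^ 2)) := fun x =>
    ((hV3.tendsto ht.1 x).mono_left (nhdsWithin_mono _ fun s hs => hs.1.1)).sub_const _
  refine ⟨convex_univ, fun x _ y _ a b ha hb hab => ?_⟩
  -- At good times the convexity inequality with constant -Λ holds, and both of its sides are
  -- continuous in time by V3.
  refine le_of_tendsto_of_tendsto (hlim _) (((hlim x).const_mul a).add ((hlim y).const_mul b)) ?_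
  filter_upwards [self_mem_nhdsWithin] with s hs
  have h1 := combo_le_of_convexOn (hV1.2 s hs.1.1) x y (s := b) ⟨hb, by linarith⟩
  obtain rfl : a = 1 - b := by linarith
  rw [norm_combo_sq]
  have h2 : 0 ≤ (lam s + Λ) / 2 * (b * (1 - b)) * ‖x - y‖ ^ 2 := by
    have : 0 ≤ lam s + Λ := by linarith [hs.2]
    positivity
  nlinarith

theorem continuous_potential (hV1 : HypV1 V lam) {t : ℝ} (ht : 0 ≤ t) : Continuous (V t) :=
  continuous_of_convexOn_sub (hV1.2 t ht)

/-- The global subgradient inequality at 0, where V2 bounds p and V(t, 0) and the convexity constant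
is at least -Λ. The linear term is absorbed by ⟪p, x⟫ ≥ -(C² + |x|²)/2. -/
theorem exists_quadratic_lower_bound (hV1 : HypV1 V lam) (hV2 : HypV2 V) (hV3 : HypV3 V) {T : ℝ}
    (hT : 0 < T) : ∃ A B : ℝ, ∀ t ∈ Icc 0 T, ∀ x, A + B * ‖x‖ ^ 2 ≤ V t x := by
  obtain ⟨C, hC⟩ := hV2.1 T hT
  obtain ⟨m, hm⟩ := hV2.2 T hT
  set Λ := (negBound lam T).toReal with hΛ
  refine ⟨m - C ^ 2 / 2, -1 / 2 - Λ / 2, fun t ht x => ?_⟩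
  obtain ⟨p, hp, hpC⟩ := hC t ht
  have h1 := le_of_mem_subdifferential (convexOn_sub_max hV1 hV3 hT ht) hp.1 x
  have h2 := hm t ht
  have h3 : -(‖p‖ * ‖x‖) ≤ inner ℝ p x := neg_le_of_abs_le (abs_real_inner_le_norm p x)
  have h4 : -Λ / 2 * ‖x‖ ^ 2 ≤ max (lam t) (-Λ) / 2 * ‖x‖ ^ 2 := by
    have : -Λ ≤ max (lam t) (-Λ) := le_max_right _ _
    gcongr
  nlinarith [sq_nonneg (‖x‖ - ‖p‖), norm_nonneg p, mul_self_le_mul_self (norm_nonneg p) hpC]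

end

noncomputable section

variable {d : ℕ} {V : ℝ → Euc d → ℝ} {lam : ℝ → ℝ} {κ : ℝ}

/-! ### The energy as a real number on its domain -/

/-- The entropy term `κ 𝒰(μ)` is finite. -/
def EntropyTermFinite (κ : ℝ) (μ : WassersteinSpace d) : Prop :=
  κ = 0 ∨ (μ.measure ≪ volume ∧ Integrable (entDensity μ.measure))

theorem mul_entropy_eq_coe {μ : WassersteinSpace d} (h : EntropyTermFinite κ μ) :
    (κ : EReal) * entropy μ = ((κ * ∫ x, entDensity μ.measure x : ℝ) : EReal) := by
  rcases h with rfl | ⟨h1, h2⟩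
  · simp
  · rw [entropy_eq_coe h1 h2, EReal.coe_mul]

theorem mul_entropy_eq_top (hκ : 0 ≤ κ) {μ : WassersteinSpace d} (h : ¬ EntropyTermFinite κ μ) :
    (κ : EReal) * entropy μ = ⊤ := by
  rw [EntropyTermFinite, not_or] at h
  rw [entropy_eq_top h.2]
  exact EReal.coe_mul_top_of_pos (lt_of_le_of_ne hκ (Ne.symm h.1))

theorem mul_entropy_ne_bot (hκ : 0 ≤ κ) (μ : WassersteinSpace d) :
    (κ : EReal) * entropy μ ≠ ⊥ := by
  by_cases h : EntropyTermFinite κ μ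
  · rw [mul_entropy_eq_coe h]; exact EReal.coe_ne_bot _
  · rw [mul_entropy_eq_top hκ h]; exact top_ne_bot

/-- The energy at time `t` is finite. -/
def EnergyFinite (κ : ℝ) (V : ℝ → Euc d → ℝ) (t : ℝ) (μ : WassersteinSpace d) : Prop :=
  EntropyTermFinite κ μ ∧ Integrable (V t) μ.measure

theorem energyOne_eq_coe {t : ℝ} {μ : WassersteinSpace d} (h : EnergyFinite κ V t μ) :
    energyOne κ V t μ
      = ((κ * (∫ x, entDensity μ.measure x) + ∫ x, V t x ∂μ.measure : ℝ) : EReal) := by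
  rw [energyOne, mul_entropy_eq_coe h.1, potentialEnergy, extIntegral_eq_coe h.2, EReal.coe_add]

/-- Neither summand is -∞, so the convention ⊤ + ⊥ = ⊥ never intervenes. -/
theorem energyOne_eq_top (hκ : 0 ≤ κ) {t : ℝ} (hc : Continuous (V t)) {A B : ℝ}
    (hle : ∀ x, A + B * ‖x‖ ^ 2 ≤ V t x) {μ : WassersteinSpace d}
    (h : ¬ EnergyFinite κ V t μ) : energyOne κ V t μ = ⊤ := by
  rw [energyOne, potentialEnergy]
  by_cases h1 : EntropyTermFinite κ μ
  · have h2 : ¬ Integrable (V t) μ.measure := fun h2 => h ⟨h1, h2⟩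
    rw [extIntegral_eq_top hc.aestronglyMeasurable (integrable_quadratic μ A B) hle h2]
    exact EReal.add_top_of_ne_bot (mul_entropy_ne_bot hκ μ)
  · rw [mul_entropy_eq_top hκ h1]
    exact EReal.top_add_of_ne_bot (extIntegral_ne_bot hc hle)

theorem mem_effDomain_iff (hκ : 0 ≤ κ) {t : ℝ} (hc : Continuous (V t)) {A B : ℝ}
    (hle : ∀ x, A + B * ‖x‖ ^ 2 ≤ V t x) {μ : WassersteinSpace d} :
    μ ∈ effDomain (energyOne κ V t) ↔ EnergyFinite κ V t μ := by
  rw [effDomain, mem_ofPred_eq]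
  by_cases h : EnergyFinite κ V t μ
  · simp only [h, iff_true]
    rw [energyOne_eq_coe h]; exact EReal.coe_lt_top _
  · simp only [h, iff_false, not_lt, top_le_iff]
    exact energyOne_eq_top hκ hc hle h

theorem exists_lower_bound_at (hV1 : HypV1 V lam) (hV2 : HypV2 V) (hV3 : HypV3 V) {t : ℝ}
    (ht : 0 ≤ t) : ∃ A B : ℝ, ∀ x, A + B * ‖x‖ ^ 2 ≤ V t x := by
  obtain ⟨A, B, h⟩ := exists_quadratic_lower_bound hV1 hV2 hV3 (T := t + 1) (by linarith)
  exact ⟨A, B, h t ⟨ht, by linarith⟩⟩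

/-- By V3 the difference V(t, ·) - V(s, ·) is bounded by a multiple of 1 + |x|², which every element
of the Wasserstein space integrates. -/
theorem integrable_potential_of_integrable (hV1 : HypV1 V lam) (hV3 : HypV3 V) {s t : ℝ}
    (hs : 0 ≤ s) (ht : 0 ≤ t) {μ : WassersteinSpace d} (h : Integrable (V s) μ.measure) :
    Integrable (V t) μ.measure := by
  obtain ⟨β, -, hβ⟩ := hV3
  set c := |∫ r in t..s, β r|
  have h1 : Integrable (fun x => V t x - V s x) μ.measure := by
    refine (integrable_quadratic μ c c).mono' ((continuous_potential hV1 ht).sub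
      (continuous_potential hV1 hs)).aestronglyMeasurable (Eventually.of_forall fun x => ?_)
    rw [Real.norm_eq_abs]
    have := abs_sub_le_abs_integral hβ ht hs x
    linarith
  exact (h1.add h).congr (Eventually.of_forall fun x => by simp)

theorem energyFinite_iff (hV1 : HypV1 V lam) (hV3 : HypV3 V) {s t : ℝ}
    (hs : 0 ≤ s) (ht : 0 ≤ t) {μ : WassersteinSpace d} :
    EnergyFinite κ V s μ ↔ EnergyFinite κ V t μ :=
  ⟨fun h => ⟨h.1, integrable_potential_of_integrable hV1 hV3 hs ht h.2⟩,
    fun h => ⟨h.1, integrable_potential_of_integrable hV1 hV3 ht hs h.2⟩⟩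

/-! ### Conditions E1 to E4 -/

theorem hypE2_energyOne (hκ : 0 ≤ κ) (hV1 : HypV1 V lam) (hV2 : HypV2 V) (hV3 : HypV3 V) :
    HypE2 (energyOne κ V) := by
  intro s t hs ht
  obtain ⟨A, B, h1⟩ := exists_lower_bound_at hV1 hV2 hV3 hs
  obtain ⟨A', B', h2⟩ := exists_lower_bound_at hV1 hV2 hV3 ht
  ext μ
  rw [mem_effDomain_iff hκ (continuous_potential hV1 hs) h1,
    mem_effDomain_iff hκ (continuous_potential hV1 ht) h2, energyFinite_iff hV1 hV3 hs ht]

theorem lowerSemicontinuous_mul_entropy (hκ : 0 ≤ κ) :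
    LowerSemicontinuous fun μ : WassersteinSpace d => (κ : EReal) * entropy μ := by
  rcases hκ.eq_or_lt with rfl | hκ
  · simpa using lowerSemicontinuous_const
  · have hg : Continuous fun x : EReal => (κ : EReal) * x := by
      refine continuous_iff_continuousAt.2 fun x => ?_
      have h0 : (κ : EReal) ≠ 0 := by exact_mod_cast hκ.ne'
      exact (EReal.continuousAt_mul (p := ((κ : EReal), x)) (Or.inl h0) (Or.inl h0)
        (Or.inl (EReal.coe_ne_bot _)) (Or.inl (EReal.coe_ne_top _))).comp
        (continuousAt_const.prodMk continuousAt_id)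
    exact hg.comp_lowerSemicontinuous lowerSemicontinuous_entropy fun x y hxy =>
      mul_le_mul_of_nonneg_left hxy (by exact_mod_cast hκ.le)

theorem hypE1_energyOne (hκ : 0 ≤ κ) (hV1 : HypV1 V lam) (hV2 : HypV2 V) (hV3 : HypV3 V)
    (hμ : ∃ μ : WassersteinSpace d,
      μ.measure ≪ volume ∧ entropy μ < ⊤ ∧ potentialEnergy V 0 μ < ⊤) :
    HypE1 (energyOne κ V) := by
  intro t ht
  obtain ⟨A, B, hAB⟩ := exists_lower_bound_at hV1 hV2 hV3 ht
  have hc := continuous_potential hV1 ht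
  refine ⟨fun μ => ?_, ?_, ?_⟩
  · by_cases h : EnergyFinite κ V t μ
    · rw [energyOne_eq_coe h]; exact EReal.coe_ne_bot _
    · rw [energyOne_eq_top hκ hc hAB h]; exact top_ne_bot
  · obtain ⟨μ, -, h1, h2⟩ := hμ
    obtain ⟨A', B', hAB'⟩ := exists_lower_bound_at hV1 hV2 hV3 le_rfl
    refine ⟨μ, ?_⟩
    -- The given measure has finite energy at time 0; E2 carries this to time t.
    rw [hypE2_energyOne hκ hV1 hV2 hV3 t 0 ht le_rfl]
    refine (mem_effDomain_iff hκ (continuous_potential hV1 le_rfl) hAB').2 ⟨Or.inr ?_, ?_⟩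
    · by_contra h; exact h1.ne (entropy_eq_top h)
    · by_contra h
      exact h2.ne (extIntegral_eq_top (continuous_potential hV1 le_rfl).aestronglyMeasurable
        (integrable_quadratic μ A' B') hAB' h)
  · refine LowerSemicontinuous.add' (lowerSemicontinuous_mul_entropy hκ)
      (lowerSemicontinuous_extIntegral hc hAB) fun μ => ?_
    exact EReal.continuousAt_add (Or.inr (extIntegral_ne_bot hc hAB))
      (Or.inl (mul_entropy_ne_bot hκ μ))

theorem hypE3_energyOne (hκ : 0 ≤ κ) (hV1 : HypV1 V lam) (hV2 : HypV2 V) (hV3 : HypV3 V) :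
    HypE3 (energyOne κ V) := by
  have hV3' := hV3
  obtain ⟨β, hβi, hβ⟩ := hV3'
  -- E3 asks for a nonnegative rate, which V3 does not supply pointwise; hence |β|. The entropy
  -- cancels in time differences, and distance to δ₀ turns 1 + |x|² into 1 + d².
  refine ⟨diracZero d, fun r => |β r|, fun r _ => abs_nonneg _, hβi.norm, fun μ hμ s t hs hst => ?_⟩
  obtain ⟨A, B, hAB⟩ := exists_lower_bound_at hV1 hV2 hV3 le_rfl
  rw [mem_effDomain_iff hκ (continuous_potential hV1 le_rfl) hAB] at hμ
  have ht : 0 ≤ t := hs.trans hst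
  have hs' := (energyFinite_iff hV1 hV3 le_rfl hs).1 hμ
  have ht' := (energyFinite_iff hV1 hV3 le_rfl ht).1 hμ
  rw [energyOne_eq_coe hs', energyOne_eq_coe ht', EReal.toReal_coe, EReal.toReal_coe,
    add_sub_add_left_eq_sub, ← integral_sub ht'.2 hs'.2, dist_diracZero_sq]
  set c := ∫ r in s..t, |β r| with hc
  have hb : ∀ x, |V t x - V s x| ≤ c + c * ‖x‖ ^ 2 := fun x => by
    have h1 := abs_sub_le_abs_integral hβ hs ht x
    have h2 : |∫ r in s..t, β r| ≤ c := intervalIntegral.abs_integral_le_integral_abs hst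
    rw [abs_sub_comm]
    nlinarith [sq_nonneg ‖x‖]
  calc |∫ x, (V t x - V s x) ∂μ.measure| ≤ ∫ x, |V t x - V s x| ∂μ.measure :=
        abs_integral_le_integral_abs
    _ ≤ ∫ x, (c + c * ‖x‖ ^ 2) ∂μ.measure :=
        integral_mono (ht'.2.sub hs'.2).abs (integrable_quadratic μ c c) hb
    _ = c * (1 + ∫ x, ‖x‖ ^ 2 ∂μ.measure) := by rw [integral_quadratic]; ring

theorem hypE4_energyOne (hκ : 0 ≤ κ) (hV1 : HypV1 V lam) (hV2 : HypV2 V) (hV3 : HypV3 V) :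
    HypE4 (energyOne κ V) := by
  intro T hT
  obtain ⟨A, B, hAB⟩ := exists_quadratic_lower_bound hV1 hV2 hV3 hT
  set D : ℝ := 1 + κ + |B| with hD
  have hDpos : 0 < D := by positivity
  set g := ∫ x : Euc d, Real.exp (-‖x‖ ^ 2 - 1) with hg
  -- With τ* = 1 / (2D) the penalty is D ∫|x|² dμ. It dominates the κ ∫|x|² lost in the entropy
  -- bound and the |B| ∫|x|² lost in the potential bound.
  refine ⟨diracZero d, 1 / (2 * D), by positivity, A - κ * g, fun t ht => le_iInf fun μ => ?_⟩
  rw [penalized]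
  by_cases h : EnergyFinite κ V t μ
  · rw [energyOne_eq_coe h, ← EReal.coe_add, EReal.coe_le_coe_iff, dist_comm, dist_diracZero_sq]
    have h1 : κ * (-∫ x, ‖x‖ ^ 2 ∂μ.measure - g) ≤ κ * ∫ x, entDensity μ.measure x := by
      rcases h.1 with h0 | h0
      · simp [h0]
      · exact mul_le_mul_of_nonneg_left (neg_sub_le_integral_entDensity h0.1 h0.2) hκ
    have h2 : A + B * ∫ x, ‖x‖ ^ 2 ∂μ.measure ≤ ∫ x, V t x ∂μ.measure := by
      rw [← integral_quadratic]
      exact integral_mono (integrable_quadratic μ A B) h.2 (hAB t ht)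
    have h3 : (∫ x, ‖x‖ ^ 2 ∂μ.measure) / (2 * (1 / (2 * D))) = D * ∫ x, ‖x‖ ^ 2 ∂μ.measure := by
      field_simp
    have h4 : 0 ≤ ∫ x, ‖x‖ ^ 2 ∂μ.measure := integral_nonneg fun x => by positivity
    rw [h3, hD]
    nlinarith [neg_abs_le B]
  · rw [energyOne_eq_top hκ (continuous_potential hV1 ht.1) (hAB t ht) h, EReal.top_add_coe]
    exact le_top

/-! ### Interpolation along a three-plan -/

/-- A plan on `ℝᵈ × (ℝᵈ × ℝᵈ)` with marginals `u`, `v₀`, `v₁` whose projections on the first and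
second, and on the first and third, factors are optimal. -/
structure IsThreePlan (π : Measure (Euc d × (Euc d × Euc d))) (u v₀ v₁ : WassersteinSpace d) :
    Prop where
  map_fst : π.map (fun p => p.1) = u.measure
  map_snd : π.map (fun p => p.2.1) = v₀.measure
  map_trd : π.map (fun p => p.2.2) = v₁.measure
  cost_snd : ∫ p, ‖p.1 - p.2.1‖ ^ 2 ∂π ≤ dist u v₀ ^ 2
  cost_trd : ∫ p, ‖p.1 - p.2.2‖ ^ 2 ∂π ≤ dist u v₁ ^ 2

theorem exists_isThreePlan (u v₀ v₁ : WassersteinSpace d) : ∃ π, IsThreePlan π u v₀ v₁ := by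
  obtain ⟨γ₀, h₀, e₀⟩ := exists_optimal_coupling u v₀
  obtain ⟨γ₁, h₁, e₁⟩ := exists_optimal_coupling u v₁
  obtain ⟨π, p₀, p₁⟩ := exists_gluing h₀ h₁
  refine ⟨π, ?_, ?_, ?_, ?_, ?_⟩
  · rw [← h₀.1, ← p₀, Measure.map_map (by fun_prop) (by fun_prop)]; rfl
  · rw [← h₀.2, ← p₀, Measure.map_map (by fun_prop) (by fun_prop)]; rfl
  · rw [← h₁.2, ← p₁, Measure.map_map (by fun_prop) (by fun_prop)]; rfl
  · rw [← e₀, ← p₀, integral_map (by fun_prop)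
      (Measurable.aestronglyMeasurable (by fun_prop))]
  · rw [← e₁, ← p₁, integral_map (by fun_prop)
      (Measurable.aestronglyMeasurable (by fun_prop))]

/-- The interpolation map `(a, x, y) ↦ (1 - s) x + s y`. -/
def interp (s : ℝ) (p : Euc d × (Euc d × Euc d)) : Euc d := (1 - s) • p.2.1 + s • p.2.2

theorem continuous_interp (s : ℝ) : Continuous (interp (d := d) s) := by
  unfold interp; fun_prop

namespace IsThreePlan

variable {π : Measure (Euc d × (Euc d × Euc d))} {u v₀ v₁ : WassersteinSpace d}

theorem isProbabilityMeasure (h : IsThreePlan π u v₀ v₁) : IsProbabilityMeasure π := by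
  constructor
  rw [← preimage_univ (f := fun p : Euc d × (Euc d × Euc d) => p.1),
    ← Measure.map_apply (by fun_prop) MeasurableSet.univ, h.map_fst]
  exact measure_univ

theorem integrable_fst (h : IsThreePlan π u v₀ v₁) : Integrable (fun p => ‖p.1‖ ^ 2) π := by
  have := u.integrable_norm_sq
  rw [← h.map_fst] at this
  exact this.comp_measurable (by fun_prop)

theorem integrable_comp_snd (h : IsThreePlan π u v₀ v₁) {f : Euc d → ℝ}
    (hf : Integrable f v₀.measure) : Integrable (fun p => f p.2.1) π := by
  rw [← h.map_snd] at hf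
  exact hf.comp_measurable (by fun_prop)

theorem integrable_comp_trd (h : IsThreePlan π u v₀ v₁) {f : Euc d → ℝ}
    (hf : Integrable f v₁.measure) : Integrable (fun p => f p.2.2) π := by
  rw [← h.map_trd] at hf
  exact hf.comp_measurable (by fun_prop)

theorem integral_comp_snd (h : IsThreePlan π u v₀ v₁) {f : Euc d → ℝ} (hf : Continuous f) :
    ∫ p, f p.2.1 ∂π = ∫ x, f x ∂v₀.measure := by
  rw [← h.map_snd, integral_map (by fun_prop) hf.aestronglyMeasurable]

theorem integral_comp_trd (h : IsThreePlan π u v₀ v₁) {f : Euc d → ℝ} (hf : Continuous f) :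
    ∫ p, f p.2.2 ∂π = ∫ x, f x ∂v₁.measure := by
  rw [← h.map_trd, integral_map (by fun_prop) hf.aestronglyMeasurable]

theorem integrable_snd_sub_trd (h : IsThreePlan π u v₀ v₁) :
    Integrable (fun p => ‖p.2.1 - p.2.2‖ ^ 2) π :=
  integrable_norm_sub_sq (by fun_prop) (by fun_prop) (h.integrable_comp_snd v₀.integrable_norm_sq)
    (h.integrable_comp_trd v₁.integrable_norm_sq)

theorem integrable_fst_sub_snd (h : IsThreePlan π u v₀ v₁) :
    Integrable (fun p => ‖p.1 - p.2.1‖ ^ 2) π :=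
  integrable_norm_sub_sq (by fun_prop) (by fun_prop) h.integrable_fst
    (h.integrable_comp_snd v₀.integrable_norm_sq)

theorem integrable_fst_sub_trd (h : IsThreePlan π u v₀ v₁) :
    Integrable (fun p => ‖p.1 - p.2.2‖ ^ 2) π :=
  integrable_norm_sub_sq (by fun_prop) (by fun_prop) h.integrable_fst
    (h.integrable_comp_trd v₁.integrable_norm_sq)

theorem integrable_interp_sq (h : IsThreePlan π u v₀ v₁) (s : ℝ) :
    Integrable (fun p => ‖interp s p‖ ^ 2) π := by
  simp only [interp, norm_combo_sq]
  exact (((h.integrable_comp_snd v₀.integrable_norm_sq).const_mul _).add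
    ((h.integrable_comp_trd v₁.integrable_norm_sq).const_mul _)).sub
    (h.integrable_snd_sub_trd.const_mul _)

/-- The curve of interpolations along a three-plan. -/
def curve (h : IsThreePlan π u v₀ v₁) (s : ℝ) : WassersteinSpace d where
  measure := π.map (interp s)
  isProbabilityMeasure :=
    have := h.isProbabilityMeasure
    Measure.isProbabilityMeasure_map (continuous_interp s).measurable.aemeasurable
  integrable_norm_sq := by
    rw [integrable_map_measure (Measurable.aestronglyMeasurable (by fun_prop))
      (continuous_interp s).measurable.aemeasurable]
    exact h.integrable_interp_sq s

theorem curve_zero (h : IsThreePlan π u v₀ v₁) : h.curve 0 = v₀ := by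
  refine WassersteinSpace.ext ?_
  have : interp (d := d) 0 = fun p => p.2.1 := by ext1 p; simp [interp]
  rw [← h.map_snd, ← this]
  rfl

theorem curve_one (h : IsThreePlan π u v₀ v₁) : h.curve 1 = v₁ := by
  refine WassersteinSpace.ext ?_
  have : interp (d := d) 1 = fun p => p.2.2 := by ext1 p; simp [interp]
  rw [← h.map_trd, ← this]
  rfl

theorem dist_le_of_map {α : Type*} [MeasurableSpace α] {π : Measure α} {f g : α → Euc d}
    (hf : Measurable f) (hg : Measurable g) {μ ν : WassersteinSpace d}
    (h1 : π.map f = μ.measure) (h2 : π.map g = ν.measure) :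
    dist μ ν ^ 2 ≤ ∫ a, ‖f a - g a‖ ^ 2 ∂π := by
  have hc : IsCoupling (π.map fun a => (f a, g a)) μ ν := by
    constructor
    · rw [Measure.map_map measurable_fst (by fun_prop), ← h1]; rfl
    · rw [Measure.map_map measurable_snd (by fun_prop), ← h2]; rfl
  refine hc.dist_sq_le.trans_eq ?_
  rw [integral_map (by fun_prop) (Measurable.aestronglyMeasurable (by fun_prop))]

theorem dist_sq_le (h : IsThreePlan π u v₀ v₁) :
    dist v₀ v₁ ^ 2 ≤ ∫ p, ‖p.2.1 - p.2.2‖ ^ 2 ∂π :=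
  dist_le_of_map (by fun_prop) (by fun_prop) h.map_snd h.map_trd

theorem dist_curve_sq_le (h : IsThreePlan π u v₀ v₁) (s t : ℝ) :
    dist (h.curve s) (h.curve t) ^ 2 ≤ (s - t) ^ 2 * ∫ p, ‖p.2.1 - p.2.2‖ ^ 2 ∂π := by
  refine (dist_le_of_map (continuous_interp s).measurable (continuous_interp t).measurable
    rfl rfl).trans_eq ?_
  rw [← integral_const_mul]
  congr 1; ext p
  have : interp s p - interp t p = (t - s) • (p.2.1 - p.2.2) := by
    simp only [interp]; module
  rw [this, norm_smul, mul_pow, Real.norm_eq_abs, sq_abs]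
  ring

theorem continuous_curve (h : IsThreePlan π u v₀ v₁) : Continuous h.curve := by
  set C := ∫ p, ‖p.2.1 - p.2.2‖ ^ 2 ∂π with hC
  have hC0 : 0 ≤ C := integral_nonneg fun _ => by positivity
  refine (LipschitzWith.of_dist_le_mul (K := (Real.sqrt C).toNNReal) fun s t => ?_).continuous
  rw [Real.coe_toNNReal _ (Real.sqrt_nonneg C), Real.dist_eq]
  refine abs_le_of_sq_le_sq' ?_ (by positivity) |>.2
  rw [mul_pow, Real.sq_sqrt hC0, sq_abs, mul_comm]
  exact h.dist_curve_sq_le s t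

/-- The plan couples u with the interpolant, and the Hilbert-space identity for |a - (1-s)x - sy|²
is integrated. Keeping the plan cost instead of d²(v₀, v₁) is essential: the plan need not be
optimal between v₀ and v₁, and the potential contributes the same integral with a possibly negative
factor. -/
theorem dist_sq_curve_le (h : IsThreePlan π u v₀ v₁) {s : ℝ} (hs : s ∈ Icc (0 : ℝ) 1) :
    dist u (h.curve s) ^ 2 ≤ (1 - s) * dist u v₀ ^ 2 + s * dist u v₁ ^ 2
      - s * (1 - s) * ∫ p, ‖p.2.1 - p.2.2‖ ^ 2 ∂π := by
  have h1 := dist_le_of_map (f := fun p : Euc d × (Euc d × Euc d) => p.1) (by fun_prop)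
    (continuous_interp s).measurable h.map_fst (ν := h.curve s) rfl
  have h2 : ∀ p : Euc d × (Euc d × Euc d), ‖p.1 - interp s p‖ ^ 2
      = (1 - s) * ‖p.1 - p.2.1‖ ^ 2 + s * ‖p.1 - p.2.2‖ ^ 2
        - s * (1 - s) * ‖p.2.1 - p.2.2‖ ^ 2 := by
    intro p
    have h3 : p.1 - interp s p = (1 - s) • (p.1 - p.2.1) + s • (p.1 - p.2.2) := by
      simp only [interp]; module
    rw [h3, norm_combo_sq, sub_sub_sub_cancel_left, norm_sub_rev p.2.2]
  have i0 := h.integrable_fst_sub_snd.const_mul (1 - s)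
  have i1 := h.integrable_fst_sub_trd.const_mul s
  simp_rw [h2] at h1
  have i01 : Integrable (fun p : Euc d × (Euc d × Euc d) =>
    (1 - s) * ‖p.1 - p.2.1‖ ^ 2 + s * ‖p.1 - p.2.2‖ ^ 2) π := i0.add i1
  rw [integral_sub i01 (h.integrable_snd_sub_trd.const_mul _),
    integral_add i0 i1, integral_const_mul, integral_const_mul, integral_const_mul] at h1
  have h4 := mul_le_mul_of_nonneg_left h.cost_snd (sub_nonneg.2 hs.2)
  have h5 := mul_le_mul_of_nonneg_left h.cost_trd hs.1
  linarith

theorem integrable_curve {f : Euc d → ℝ} {ν : ℝ}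
    (hf : ConvexOn ℝ univ fun x => f x - ν / 2 * ‖x‖ ^ 2) {A B : ℝ}
    (hAB : ∀ x, A + B * ‖x‖ ^ 2 ≤ f x) (h : IsThreePlan π u v₀ v₁)
    (h₀ : Integrable f v₀.measure) (h₁ : Integrable f v₁.measure) {s : ℝ}
    (hs : s ∈ Icc (0 : ℝ) 1) :
    Integrable f (h.curve s).measure ∧ ∫ x, f x ∂(h.curve s).measure ≤
      (1 - s) * ∫ x, f x ∂v₀.measure + s * ∫ x, f x ∂v₁.measure
        - ν / 2 * (s * (1 - s)) * ∫ p, ‖p.2.1 - p.2.2‖ ^ 2 ∂π := by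
  have hfc := continuous_of_convexOn_sub hf
  have := h.isProbabilityMeasure
  have i0 := (h.integrable_comp_snd h₀).const_mul (1 - s)
  have i1 := (h.integrable_comp_trd h₁).const_mul s
  have i2 := h.integrable_snd_sub_trd.const_mul (ν / 2 * (s * (1 - s)))
  have i3 := (integrable_const (μ := π) A).add ((h.integrable_interp_sq s).const_mul B)
  have i01 : Integrable (fun p => (1 - s) * f p.2.1 + s * f p.2.2) π := i0.add i1
  have i : Integrable (fun p => f (interp s p)) π := by
    refine integrable_of_le_of_le (hfc.comp (continuous_interp s)).aestronglyMeasurable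
      (Eventually.of_forall fun p => hAB _) (Eventually.of_forall fun p => ?_) i3 (i01.sub i2)
    exact combo_le_of_convexOn hf p.2.1 p.2.2 hs
  have hm := (continuous_interp (d := d) s).measurable.aemeasurable (μ := π)
  refine ⟨(integrable_map_measure hfc.aestronglyMeasurable hm).2 i, ?_⟩
  have e : ∫ x, f x ∂(h.curve s).measure = ∫ p, f (interp s p) ∂π :=
    integral_map hm hfc.aestronglyMeasurable
  rw [e, ← h.integral_comp_snd hfc, ← h.integral_comp_trd hfc, ← integral_const_mul,
    ← integral_const_mul, ← integral_const_mul, ← integral_add i0 i1, ← integral_sub i01 i2]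
  exact integral_mono i (i01.sub i2) fun p => combo_le_of_convexOn hf p.2.1 p.2.2 hs

end IsThreePlan

end

noncomputable section

variable {d : ℕ}

/-! ### Half-open boxes -/

/-- The half-open box with corners `l` and `r`. -/
def box (l r : Fin d → ℝ) : Set (Euc d) := {x | ∀ i, l i ≤ x i ∧ x i < r i}

theorem measurableSet_box (l r : Fin d → ℝ) : MeasurableSet (box l r) := by
  have : box l r = ⋂ i, {x : Euc d | l i ≤ x i ∧ x i < r i} := by ext; simp [box]
  rw [this]
  refine MeasurableSet.iInter fun i => ?_
  have hi : Measurable fun x : Euc d => x i := by fun_prop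
  exact (measurableSet_le measurable_const hi).inter (measurableSet_lt hi measurable_const)

theorem volume_box (l r : Fin d → ℝ) :
    volume (box l r) = ∏ i, ENNReal.ofReal (r i - l i) := by
  rw [← Real.volume_pi_Ico, ← (EuclideanSpace.volume_preserving_symm_measurableEquiv_toLp
    (Fin d)).measure_preimage_equiv]
  congr 1
  ext x
  simp [box]

theorem volume_box_ne_top (l r : Fin d → ℝ) : volume (box l r) ≠ ∞ := by
  rw [volume_box]; exact ENNReal.prod_ne_top fun i _ => ENNReal.ofReal_ne_top

theorem volumeReal_box {l r : Fin d → ℝ} (h : ∀ i, l i ≤ r i) :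
    volume.real (box l r) = ∏ i, (r i - l i) := by
  rw [Measure.real, volume_box, ENNReal.toReal_prod]
  exact Finset.prod_congr rfl fun i _ => ENNReal.toReal_ofReal (sub_nonneg.2 (h i))

theorem pos_of_volume_box_ne_zero {l r : Fin d → ℝ} (h : volume (box l r) ≠ 0) (i : Fin d) :
    l i < r i := by
  rw [volume_box] at h
  have := Finset.prod_ne_zero_iff.1 h i (Finset.mem_univ i)
  simpa using this

/-- Half-open boxes are cut into exact partitions, with no null sets to discard. -/
theorem box_split {l r : Fin d → ℝ} {j : Fin d} {c : ℝ} (h1 : l j ≤ c) (h2 : c ≤ r j) :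
    box l r = box l (Function.update r j c) ∪ box (Function.update l j c) r := by
  ext x
  simp only [box, mem_ofPred_eq, mem_union]
  constructor
  · intro h
    rcases lt_or_ge (x j) c with hx | hx
    · left; intro i
      by_cases hi : i = j
      · subst hi; simpa using ⟨(h i).1, hx⟩
      · simpa [hi] using h i
    · right; intro i
      by_cases hi : i = j
      · subst hi; simpa using ⟨hx, (h i).2⟩
      · simpa [hi] using h i
  · rintro (h | h) i
    · have := h i
      by_cases hi : i = j
      · subst hi; simp at this; exact ⟨this.1, this.2.trans_le h2⟩
      · simpa [hi] using this
    · have := h i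
      by_cases hi : i = j
      · subst hi; simp at this; exact ⟨h1.trans this.1, this.2⟩
      · simpa [hi] using this

theorem disjoint_box_split (l r : Fin d → ℝ) (j : Fin d) (c : ℝ) :
    Disjoint (box l (Function.update r j c)) (box (Function.update l j c) r) := by
  refine Set.disjoint_left.2 fun x h1 h2 => ?_
  have h1 := (h1 j).2
  have h2 := (h2 j).1
  simp only [Function.update_self] at h1 h2
  linarith

/-- Interpolation of corners of boxes. -/
def mix (s : ℝ) (l l' : Fin d → ℝ) (i : Fin d) : ℝ := (1 - s) * l i + s * l' i

theorem mix_update (s : ℝ) (l l' : Fin d → ℝ) (j : Fin d) (c c' : ℝ) :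
    mix s (Function.update l j c) (Function.update l' j c')
      = Function.update (mix s l l') j ((1 - s) * c + s * c') := by
  ext i
  by_cases hi : i = j
  · subst hi; simp [mix]
  · simp [mix, hi]

/-- The interpolation map `(x, y) ↦ (1 - s) x + s y`. -/
def lerp (s : ℝ) (p : Euc d × Euc d) : Euc d := (1 - s) • p.1 + s • p.2

theorem continuous_lerp (s : ℝ) : Continuous (lerp (d := d) s) := by
  unfold lerp; fun_prop

theorem mix_lt_mix {s a a' b b' : ℝ} (hs : s ∈ Icc (0 : ℝ) 1) (h : a < b) (h' : a' < b') :
    (1 - s) * a + s * a' < (1 - s) * b + s * b' := by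
  -- At s = 0 strictness can only come from the first pair.
  rcases hs.1.eq_or_lt with rfl | h0
  · simpa using h
  · have := mul_lt_mul_of_pos_left h' h0
    have := mul_le_mul_of_nonneg_left h.le (sub_nonneg.2 hs.2)
    linarith

theorem lerp_mem_box {l r l' r' : Fin d → ℝ} {s : ℝ} (hs : s ∈ Icc (0 : ℝ) 1)
    {p : Euc d × Euc d} (h : p.1 ∈ box l r) (h' : p.2 ∈ box l' r') :
    lerp s p ∈ box (mix s l l') (mix s r r') := by
  intro i
  have hi : lerp s p i = (1 - s) * p.1 i + s * p.2 i := by simp [lerp]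
  rw [hi]
  refine ⟨?_, mix_lt_mix hs (h i).2 (h' i).2⟩
  exact add_le_add (mul_le_mul_of_nonneg_left (h i).1 (sub_nonneg.2 hs.2))
    (mul_le_mul_of_nonneg_left (h' i).1 hs.1)

/-- The sum of the side lengths is used for the diameter because it behaves additively when a box is
cut. -/
theorem norm_sub_le_of_mem_box {l r : Fin d → ℝ} {x y : Euc d} (hx : x ∈ box l r)
    (hy : y ∈ box l r) : ‖x - y‖ ≤ ∑ i, (r i - l i) := by
  calc ‖x - y‖ = ‖∑ i, EuclideanSpace.single i ((x - y) i)‖ := by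
        congr 1; ext j; simp [Finset.sum_apply, Pi.single_apply]
    _ ≤ ∑ i, ‖EuclideanSpace.single i ((x - y) i)‖ := norm_sum_le _ _
    _ ≤ ∑ i, (r i - l i) := by
        refine Finset.sum_le_sum fun i _ => ?_
        rw [PiLp.norm_single, Real.norm_eq_abs, abs_le]
        have h1 := hx i
        have h2 := hy i
        simp only [PiLp.sub_apply]
        constructor <;> linarith [h1.1, h1.2, h2.1, h2.2]

theorem volume_inner_eq_zero {a : Euc d} (ha : a ≠ 0) (c : ℝ) :
    volume {x : Euc d | inner ℝ x a = c} = 0 := by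
  by_cases hne : ∃ x₀ : Euc d, inner ℝ x₀ a = c
  · obtain ⟨x₀, hx₀⟩ := hne
    let S : AffineSubspace ℝ (Euc d) := AffineSubspace.mk' x₀ (ℝ ∙ a)ᗮ
    have hS : (S : Set (Euc d)) = {x | inner ℝ x a = c} := by
      ext x
      simp only [S, SetLike.mem_coe, AffineSubspace.mem_mk', vsub_eq_sub,
        Submodule.mem_orthogonal_singleton_iff_inner_left, inner_sub_left, mem_ofPred_eq, hx₀]
      exact sub_eq_zero
    rw [← hS]
    refine Measure.addHaar_affineSubspace _ _ fun htop => ha ?_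
    have h1 : x₀ + a ∈ (S : Set (Euc d)) := by rw [htop]; trivial
    rw [hS, mem_ofPred_eq, inner_add_left, hx₀] at h1
    exact inner_self_eq_zero.1 (by linarith : inner ℝ a a = (0 : ℝ))
  · have : {x : Euc d | inner ℝ x a = c} = ∅ := by
      ext x; simp only [mem_ofPred_eq, mem_empty_iff_false, iff_false]
      exact fun h => hne ⟨x, h⟩
    rw [this, measure_empty]

theorem volume_coord_eq_zero (j : Fin d) (c : ℝ) : volume {x : Euc d | x j = c} = 0 := by
  have h := volume_inner_eq_zero (a := EuclideanSpace.single j (1 : ℝ)) (by simp) c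
  simpa [EuclideanSpace.inner_single_right] using h

/-- A box can be cut by a hyperplane into halves of equal mass. -/
theorem exists_bisection {f : Measure (Euc d)} [IsFiniteMeasure f] (hf : f ≪ volume)
    {l r : Fin d → ℝ} (j : Fin d) (hlr : l j ≤ r j) :
    ∃ c ∈ Icc (l j) (r j), f.real (box l (Function.update r j c)) = f.real (box l r) / 2 ∧
      f.real (box (Function.update l j c) r) = f.real (box l r) / 2 := by
  set F : ℝ → ℝ := fun c => ∫ x in box l r, {y : Euc d | y j < c}.indicator (fun _ => (1 : ℝ)) x ∂f
    with hF
  have hms : ∀ c, MeasurableSet {y : Euc d | y j < c} := fun c =>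
    measurableSet_lt (by fun_prop) measurable_const
  have hFe : ∀ c, F c = f.real (box l r ∩ {y | y j < c}) := fun c => by
    simp only [hF]
    rw [integral_indicator (hms c), Measure.restrict_restrict (hms c), inter_comm]
    simp
  -- Dominated convergence: the indicators converge off the hyperplane x j = c, which is null for f
  -- ≪ volume. The cut is then found by the intermediate value theorem.
  have hFc : Continuous F := by
    refine continuous_iff_continuousAt.2 fun c => ?_
    refine continuousAt_of_dominated (bound := fun _ => 1)
      (Eventually.of_forall fun c' => (measurable_const.indicator (hms c')).aestronglyMeasurable)
      (Eventually.of_forall fun c' => Eventually.of_forall fun x => ?_) (integrable_const _) ?_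
    · by_cases hx : x j < c' <;> simp [indicator, hx]
    · refine ae_restrict_of_ae ?_
      have : ∀ᵐ x ∂f, ¬ (x j = c) :=
        hf.ae_le (measure_eq_zero_iff_ae_notMem.1 (volume_coord_eq_zero j c))
      filter_upwards [this] with x hx
      rcases lt_or_gt_of_ne hx with h | h
      · refine (continuousAt_const (y := (1 : ℝ))).congr ?_
        filter_upwards [Ioi_mem_nhds h] with c' hc'
        have hc' : x j < c' := hc'
        simp [indicator, hc']
      · refine (continuousAt_const (y := (0 : ℝ))).congr ?_
        filter_upwards [Iio_mem_nhds h] with c' hc'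
        have hc' : ¬ x j < c' := not_lt.2 (le_of_lt hc')
        simp [indicator, hc']
  have h0 : F (l j) = 0 := by
    rw [hFe]
    have : box l r ∩ {y | y j < l j} = ∅ := by
      ext x; simp only [mem_inter_iff, mem_ofPred_eq, mem_empty_iff_false, iff_false, not_and, not_lt]
      exact fun h => (h j).1
    simp [this]
  have h1 : F (r j) = f.real (box l r) := by
    rw [hFe, inter_eq_left.2]
    exact fun x hx => (hx j).2
  have hmem : f.real (box l r) / 2 ∈ Icc (F (l j)) (F (r j)) := by
    have : 0 ≤ f.real (box l r) := measureReal_nonneg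
    rw [h0, h1]; constructor <;> linarith
  obtain ⟨c, hc, hcF⟩ := intermediate_value_Icc hlr hFc.continuousOn hmem
  have e1 : f.real (box l (Function.update r j c)) = f.real (box l r) / 2 := by
    rw [← hcF, hFe, box_split hc.1 hc.2]
    congr 1
    ext x
    simp only [mem_inter_iff, mem_union, mem_ofPred_eq]
    constructor
    · intro hx; exact ⟨Or.inl hx, by simpa using (hx j).2⟩
    · rintro ⟨hx | hx, hxc⟩
      · exact hx
      · have := (hx j).1
        simp only [Function.update_self] at this
        linarith
  refine ⟨c, hc, e1, ?_⟩
  have := measureReal_union (μ := f) (disjoint_box_split l r j c) (measurableSet_box _ _)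
  rw [← box_split hc.1 hc.2, e1] at this
  linarith

/-! ### Coarse plans between boxes -/

theorem mul_sub_exp_mul_le {f : Measure (Euc d)} [IsFiniteMeasure f] (hf : f ≪ volume)
    (hent : Integrable (entDensity f)) {C : Set (Euc d)} (hC : MeasurableSet C)
    (hCv : volume C ≠ ∞) (a : ℝ) :
    a * f.real C - Real.exp (a - 1) * volume.real C ≤ ∫ x in C, entDensity f x := by
  have h := setIntegral_sub_exp_le hf hent hC (k := fun _ => a) integrableOn_const
    (integrableOn_const hCv)
  simpa [mul_comm] using h

/-- Jensen's inequality for r log r on C, read off from duality with the best constant test function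
a = log(f(C)/|C|) + 1. -/
theorem mul_log_le_setIntegral {f : Measure (Euc d)} [IsFiniteMeasure f] (hf : f ≪ volume)
    (hent : Integrable (entDensity f)) {C : Set (Euc d)} (hC : MeasurableSet C)
    (hCv : volume C ≠ ∞) (hpos : 0 < f.real C) :
    0 < volume.real C ∧
      f.real C * (Real.log (f.real C) - Real.log (volume.real C)) ≤ ∫ x in C, entDensity f x := by
  have hv : 0 < volume.real C := by
    refine ENNReal.toReal_pos (fun h0 => ?_) hCv
    simp [Measure.real, hf h0] at hpos
  refine ⟨hv, ?_⟩
  have h := mul_sub_exp_mul_le hf hent hC hCv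
    (Real.log (f.real C) - Real.log (volume.real C) + 1)
  rw [add_sub_cancel_right, Real.exp_sub, Real.exp_log hpos, Real.exp_log hv,
    div_mul_cancel₀ _ hv.ne'] at h
  linarith

/-- The logarithm of the volume is the sum of the logarithms of the sides, the sides interpolate
linearly, and log is concave. This takes the place of the concavity of log det in the classical
proof. -/
theorem le_log_volumeReal_mix {l r l' r' : Fin d → ℝ} (h : ∀ i, l i < r i)
    (h' : ∀ i, l' i < r' i) {s : ℝ} (hs : s ∈ Icc (0 : ℝ) 1) :
    (1 - s) * Real.log (volume.real (box l r)) + s * Real.log (volume.real (box l' r'))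
      ≤ Real.log (volume.real (box (mix s l l') (mix s r r'))) := by
  have hm : ∀ i, mix s l l' i < mix s r r' i := fun i => mix_lt_mix hs (h i) (h' i)
  rw [volumeReal_box fun i => (h i).le, volumeReal_box fun i => (h' i).le,
    volumeReal_box fun i => (hm i).le, Real.log_prod fun i _ => (sub_pos.2 (h i)).ne',
    Real.log_prod fun i _ => (sub_pos.2 (h' i)).ne',
    Real.log_prod fun i _ => (sub_pos.2 (hm i)).ne', Finset.mul_sum, Finset.mul_sum,
    ← Finset.sum_add_distrib]
  refine Finset.sum_le_sum fun i _ => ?_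
  have h1 := strictConcaveOn_log_Ioi.concaveOn.2 (x := r i - l i) (y := r' i - l' i)
    (sub_pos.2 (h i)) (sub_pos.2 (h' i)) (sub_nonneg.2 hs.2) hs.1 (by ring)
  simp only [smul_eq_mul] at h1
  refine h1.trans_eq ?_
  congr 1
  simp only [mix]; ring

/-- The total width of an interpolated box, discounted by the number of bisections. -/
def discountedWidth (L : List (Fin d)) (l r : Fin d → ℝ) : ℝ :=
  ∑ i, (1 / 2) ^ L.count i * (r i - l i)

/-- `π` couples `f` on `box l r` with `g` on `box l' r'`, and the law of `(1 - s) x + s y` under `π`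
is close to a measure `σ` whose entropy is controlled. -/
structure IsCoarsePlan (f g : Measure (Euc d)) (l r l' r' : Fin d → ℝ) (m : ℝ)
    (L : List (Fin d)) (π : Measure (Euc d × Euc d)) : Prop where
  map_fst : π.map Prod.fst = f.restrict (box l r)
  map_snd : π.map Prod.snd = g.restrict (box l' r')
  exists_close : ∀ s ∈ Icc (0 : ℝ) 1, ∃ σ : Measure (Euc d), IsFiniteMeasure σ ∧
    σ (box (mix s l l') (mix s r r'))ᶜ = 0 ∧
    ∀ k : Euc d → ℝ, Continuous k → (∃ M, ∀ x, |k x| ≤ M) →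
      (∫ x, k x ∂σ - ∫ x in box (mix s l l') (mix s r r'), Real.exp (k x - 1)
        ≤ (1 - s) * (∫ x in box l r, entDensity f x)
          + s * ∫ x in box l' r', entDensity g x) ∧
      ∀ ε K : ℝ, 0 ≤ K → (∀ x ∈ box (mix s l l') (mix s r r'),
        ∀ y ∈ box (mix s l l') (mix s r r'), |k x - k y| ≤ ε + K * ‖x - y‖) →
        |∫ p, k (lerp s p) ∂π - ∫ x, k x ∂σ|
          ≤ 2 * m * (ε + K * discountedWidth L (mix s l l') (mix s r r'))

theorem abs_integral_sub_le_of_ae {α : Type*} [MeasurableSpace α] {π : Measure α}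
    [IsFiniteMeasure π] {φ : α → ℝ} (hφ : Integrable φ π) {c D : ℝ}
    (h : ∀ᵐ a ∂π, |φ a - c| ≤ D) : |∫ a, φ a ∂π - π.real univ * c| ≤ π.real univ * D := by
  have h1 : π.real univ * c = ∫ _, c ∂π := by simp
  have h2 : π.real univ * D = ∫ _, D ∂π := by simp
  rw [h1, h2, ← integral_sub hφ (integrable_const _)]
  exact abs_integral_le_integral_abs.trans
    (integral_mono_ae (hφ.sub (integrable_const _)).abs (integrable_const _) h)

/-- Without bisections, the normalised product coupling and the uniform measure σ of mass m on the
interpolated box do. The entropy m(log m - log|C|) of σ is estimated by concavity of the log-volume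
and Jensen on the two end boxes. Both laws live on C, so each integral differs from m k(x₀) by at
most m times the oscillation; hence the factor 2m. -/
theorem exists_isCoarsePlan_nil {f g : Measure (Euc d)} [IsFiniteMeasure f] [IsFiniteMeasure g]
    (hf : f ≪ volume) (hg : g ≪ volume) (hef : Integrable (entDensity f))
    (heg : Integrable (entDensity g)) {l r l' r' : Fin d → ℝ} {m : ℝ} (hm : 0 < m)
    (hfm : f.real (box l r) = m) (hgm : g.real (box l' r') = m) :
    ∃ π, IsCoarsePlan f g l r l' r' m [] π := by
  have hA := measurableSet_box l r
  have hB := measurableSet_box l' r'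
  obtain ⟨hvA, hEA⟩ := mul_log_le_setIntegral hf hef hA (volume_box_ne_top l r) (hfm ▸ hm)
  obtain ⟨hvB, hEB⟩ := mul_log_le_setIntegral hg heg hB (volume_box_ne_top l' r') (hgm ▸ hm)
  rw [hfm] at hEA
  rw [hgm] at hEB
  have hlr := pos_of_volume_box_ne_zero (l := l) (r := r) (by intro h; simp [Measure.real, h] at hvA)
  have hlr' := pos_of_volume_box_ne_zero (l := l') (r := r')
    (by intro h; simp [Measure.real, h] at hvB)
  have hmE : ENNReal.ofReal m ≠ 0 := by simpa using hm
  have hfE : f (box l r) = ENNReal.ofReal m := by rw [← hfm, ofReal_measureReal]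
  have hgE : g (box l' r') = ENNReal.ofReal m := by rw [← hgm, ofReal_measureReal]
  have hinv : (ENNReal.ofReal m)⁻¹ * ENNReal.ofReal m = 1 :=
    ENNReal.inv_mul_cancel hmE ENNReal.ofReal_ne_top
  set π : Measure (Euc d × Euc d) :=
    (ENNReal.ofReal m)⁻¹ • (f.restrict (box l r)).prod (g.restrict (box l' r')) with hπ
  have p1 : π.map Prod.fst = f.restrict (box l r) := by
    rw [hπ, Measure.map_smul, Measure.map_fst_prod, Measure.restrict_apply_univ, hgE, smul_smul,
      hinv, one_smul]
  have p2 : π.map Prod.snd = g.restrict (box l' r') := by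
    rw [hπ, Measure.map_smul, Measure.map_snd_prod, Measure.restrict_apply_univ, hfE, smul_smul,
      hinv, one_smul]
  have hπu : π univ = ENNReal.ofReal m := by
    rw [← preimage_univ (f := Prod.fst), ← Measure.map_apply measurable_fst MeasurableSet.univ, p1,
      Measure.restrict_apply_univ, hfE]
  have hπf : IsFiniteMeasure π := ⟨by rw [hπu]; exact ENNReal.ofReal_lt_top⟩
  refine ⟨π, p1, p2, fun s hs => ?_⟩
  set C := box (mix s l l') (mix s r r') with hC
  have hCm : MeasurableSet C := measurableSet_box _ _
  have hCv : volume C ≠ ∞ := volume_box_ne_top _ _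
  have hmix : ∀ i, mix s l l' i < mix s r r' i := fun i => mix_lt_mix hs (hlr i) (hlr' i)
  have hvC : 0 < volume.real C := by
    rw [hC, volumeReal_box fun i => (hmix i).le]
    exact Finset.prod_pos fun i _ => sub_pos.2 (hmix i)
  have hvC0 : volume C ≠ 0 := by intro h; simp [Measure.real, h] at hvC
  set t : ℝ := m / volume.real C with ht
  have htp : 0 < t := div_pos hm hvC
  set σ : Measure (Euc d) := ENNReal.ofReal t • volume.restrict C with hσ
  have hσu : σ univ = ENNReal.ofReal m := by
    rw [hσ, Measure.smul_apply, Measure.restrict_apply_univ, smul_eq_mul,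
      ← ofReal_measureReal hCv, ← ENNReal.ofReal_mul htp.le, ht, div_mul_cancel₀ _ hvC.ne']
  have hσf : IsFiniteMeasure σ := ⟨by rw [hσu]; exact ENNReal.ofReal_lt_top⟩
  have hσC : σ Cᶜ = 0 := by
    rw [hσ, Measure.smul_apply, Measure.restrict_apply hCm.compl]; simp
  have hlerp : ∀ᵐ p ∂π, lerp s p ∈ C := by
    have h1 : ∀ᵐ p ∂π, p.1 ∈ box l r := by
      refine ae_of_ae_map measurable_fst.aemeasurable ?_
      rw [p1]; exact ae_restrict_mem hA
    have h2 : ∀ᵐ p ∂π, p.2 ∈ box l' r' := by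
      refine ae_of_ae_map measurable_snd.aemeasurable ?_
      rw [p2]; exact ae_restrict_mem hB
    filter_upwards [h1, h2] with p hp1 hp2
    exact lerp_mem_box hs hp1 hp2
  refine ⟨σ, hσf, hσC, fun k hk ⟨M, hM⟩ => ⟨?_, fun ε K hK hεK => ?_⟩⟩
  · have hki : IntegrableOn k C := by
      have : IsFiniteMeasure (volume.restrict C) := ⟨by simpa using hCv.lt_top⟩
      exact Integrable.of_bound hk.aestronglyMeasurable M (Eventually.of_forall hM)
    have hke : IntegrableOn (fun x => Real.exp (k x - 1)) C := by
      have : IsFiniteMeasure (volume.restrict C) := ⟨by simpa using hCv.lt_top⟩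
      refine Integrable.of_bound (C := Real.exp (M - 1)) (by fun_prop)
        (Eventually.of_forall fun x => ?_)
      rw [Real.norm_of_nonneg (Real.exp_pos _).le]
      exact Real.exp_le_exp.2 (by linarith [(abs_le.1 (hM x)).2])
    have e1 : ∫ x, k x ∂σ = ∫ x in C, t * k x := by
      rw [hσ, integral_smul_measure, integral_const_mul, ENNReal.toReal_ofReal htp.le, smul_eq_mul]
    have e2 : ∫ x, k x ∂σ - ∫ x in C, Real.exp (k x - 1)
        ≤ m * (Real.log m - Real.log (volume.real C)) := by
      rw [e1, ← integral_sub (hki.const_mul t) hke]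
      refine (setIntegral_mono ((hki.const_mul t).sub hke) (integrableOn_const hCv)
        fun x => mul_sub_exp_le htp.le (k x)).trans_eq ?_
      rw [setIntegral_const, smul_eq_mul, ht, Real.log_div hm.ne' hvC.ne']
      field_simp
    have e3 := le_log_volumeReal_mix hlr hlr' hs
    have e4 := mul_le_mul_of_nonneg_left hEA (sub_nonneg.2 hs.2)
    have e5 := mul_le_mul_of_nonneg_left hEB hs.1
    have e6 := mul_le_mul_of_nonneg_left e3 hm.le
    refine e2.trans (le_trans ?_ (add_le_add e4 e5))
    linarith
  · obtain ⟨x₀, hx₀⟩ : C.Nonempty := nonempty_of_measure_ne_zero hvC0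
    set D := ε + K * discountedWidth [] (mix s l l') (mix s r r') with hD
    have hb : ∀ x ∈ C, |k x - k x₀| ≤ D := fun x hx => by
      refine (hεK x hx x₀ hx₀).trans ?_
      have := norm_sub_le_of_mem_box hx hx₀
      rw [hD, discountedWidth]
      simp only [List.count_nil, pow_zero, one_mul]
      gcongr
    have hσC' : ∀ᵐ x ∂σ, x ∈ C := by
      rw [ae_iff]; exact hσC
    have a1 := abs_integral_sub_le_of_ae (π := π) (φ := fun p => k (lerp s p))
      (Integrable.of_bound (hk.comp (continuous_lerp s)).aestronglyMeasurable M
        (Eventually.of_forall fun p => hM _)) (c := k x₀) (D := D)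
      (hlerp.mono fun p hp => hb _ hp)
    have a2 := abs_integral_sub_le_of_ae (π := σ) (φ := k)
      (Integrable.of_bound hk.aestronglyMeasurable M (Eventually.of_forall hM)) (c := k x₀) (D := D)
      (hσC'.mono fun p hp => hb _ hp)
    have u1 : π.real univ = m := by rw [Measure.real, hπu, ENNReal.toReal_ofReal hm.le]
    have u2 : σ.real univ = m := by rw [Measure.real, hσu, ENNReal.toReal_ofReal hm.le]
    rw [u1] at a1
    rw [u2] at a2
    rw [abs_le] at a1 a2 ⊢
    constructor <;> linarith [a1.1, a1.2, a2.1, a2.2]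

/-- A cut in direction j divides the j-th width between the two halves, wherever c lies, and
duplicates the other widths. On average over the halves the j-th width is halved. -/
theorem discountedWidth_cons (L : List (Fin d)) (l r : Fin d → ℝ) (j : Fin d) (c : ℝ) :
    discountedWidth L l (Function.update r j c) + discountedWidth L (Function.update l j c) r
      = 2 * discountedWidth (j :: L) l r := by
  simp only [discountedWidth]
  rw [← Finset.sum_add_distrib, Finset.mul_sum]
  refine Finset.sum_congr rfl fun i _ => ?_
  by_cases hi : i = j
  · subst hi; simp only [Function.update_self, List.count_cons_self, pow_succ]; ring
  · rw [Function.update_of_ne hi, Function.update_of_ne hi, List.count_cons_of_ne (Ne.symm hi)]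
    ring

/-- Induction on the directions of the cuts: bisect both boxes into halves of mass m/2, couple lower
with lower and upper with upper, and add the plans and the comparison measures. -/
theorem exists_isCoarsePlan {f g : Measure (Euc d)} [IsFiniteMeasure f] [IsFiniteMeasure g]
    (hf : f ≪ volume) (hg : g ≪ volume) (hef : Integrable (entDensity f))
    (heg : Integrable (entDensity g)) (L : List (Fin d)) :
    ∀ {l r l' r' : Fin d → ℝ} {m : ℝ}, 0 < m → f.real (box l r) = m → g.real (box l' r') = m →
    ∃ π, IsCoarsePlan f g l r l' r' m L π := by
  induction L with
  | nil => exact fun hm hfm hgm => exists_isCoarsePlan_nil hf hg hef heg hm hfm hgm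
  | cons j L ih =>
    intro l r l' r' m hm hfm hgm
    have hlt : ∀ {μ : Measure (Euc d)} [IsFiniteMeasure μ] {l r : Fin d → ℝ}, μ ≪ volume →
        μ.real (box l r) = m → l j ≤ r j := fun hμ h =>
      (pos_of_volume_box_ne_zero (fun h0 => by
        rw [Measure.real, hμ h0] at h; simp at h; linarith) j).le
    obtain ⟨c, hc, hc1, hc2⟩ := exists_bisection hf j (hlt hf hfm)
    obtain ⟨c', hc', hc1', hc2'⟩ := exists_bisection hg j (hlt hg hgm)
    rw [hfm] at hc1 hc2
    rw [hgm] at hc1' hc2'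
    obtain ⟨π₁, h₁⟩ := ih (half_pos hm) hc1 hc1'
    obtain ⟨π₂, h₂⟩ := ih (half_pos hm) hc2 hc2'
    have hfin : ∀ {π : Measure (Euc d × Euc d)} {ν : Measure (Euc d)} [IsFiniteMeasure ν],
        π.map Prod.fst = ν → IsFiniteMeasure π := fun {π ν} _ h => by
      have : IsFiniteMeasure (π.map Prod.fst) := by rw [h]; infer_instance
      exact Measure.isFiniteMeasure_of_map measurable_fst.aemeasurable
    have i₁ := hfin h₁.map_fst
    have i₂ := hfin h₂.map_fst
    refine ⟨π₁ + π₂, ?_, ?_, fun s hs => ?_⟩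
    · rw [Measure.map_add _ _ measurable_fst, h₁.map_fst, h₂.map_fst, box_split hc.1 hc.2,
        Measure.restrict_union (disjoint_box_split _ _ _ _) (measurableSet_box _ _)]
    · rw [Measure.map_add _ _ measurable_snd, h₁.map_snd, h₂.map_snd, box_split hc'.1 hc'.2,
        Measure.restrict_union (disjoint_box_split _ _ _ _) (measurableSet_box _ _)]
    · obtain ⟨σ₁, j₁, z₁, H₁⟩ := h₁.exists_close s hs
      obtain ⟨σ₂, j₂, z₂, H₂⟩ := h₂.exists_close s hs
      rw [mix_update] at z₁ z₂
      simp only [mix_update] at H₁ H₂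
      -- The interpolated halves are exactly the halves of the interpolated box cut at b, so the
      -- exponential integrals add up.
      set b := (1 - s) * c + s * c' with hb
      have hb1 : mix s l l' j ≤ b :=
        add_le_add (mul_le_mul_of_nonneg_left hc.1 (sub_nonneg.2 hs.2))
          (mul_le_mul_of_nonneg_left hc'.1 hs.1)
      have hb2 : b ≤ mix s r r' j :=
        add_le_add (mul_le_mul_of_nonneg_left hc.2 (sub_nonneg.2 hs.2))
          (mul_le_mul_of_nonneg_left hc'.2 hs.1)
      have hsplit := box_split hb1 hb2
      have hs1 : box (mix s l l') (Function.update (mix s r r') j b)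
          ⊆ box (mix s l l') (mix s r r') := by rw [hsplit]; exact subset_union_left
      have hs2 : box (Function.update (mix s l l') j b) (mix s r r')
          ⊆ box (mix s l l') (mix s r r') := by rw [hsplit]; exact subset_union_right
      refine ⟨σ₁ + σ₂, inferInstance, ?_, fun k hk hkb => ⟨?_, fun ε K hK hεK => ?_⟩⟩
      · rw [Measure.add_apply, measure_mono_null (compl_subset_compl.2 hs1) z₁,
          measure_mono_null (compl_subset_compl.2 hs2) z₂, add_zero]
      · have e₁ := (H₁ k hk hkb).1
        have e₂ := (H₂ k hk hkb).1
        obtain ⟨M, hM⟩ := hkb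
        have hke : ∀ {C : Set (Euc d)}, volume C ≠ ∞ →
            IntegrableOn (fun x => Real.exp (k x - 1)) C := fun {C} hCv => by
          have : IsFiniteMeasure (volume.restrict C) := ⟨by simpa using hCv.lt_top⟩
          refine Integrable.of_bound (C := Real.exp (M - 1)) (by fun_prop)
            (Eventually.of_forall fun x => ?_)
          rw [Real.norm_of_nonneg (Real.exp_pos _).le]
          exact Real.exp_le_exp.2 (by linarith [(abs_le.1 (hM x)).2])
        rw [integral_add_measure
            (Integrable.of_bound hk.aestronglyMeasurable M (Eventually.of_forall hM))
            (Integrable.of_bound hk.aestronglyMeasurable M (Eventually.of_forall hM)), hsplit,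
          box_split hc.1 hc.2, box_split hc'.1 hc'.2,
          setIntegral_union (disjoint_box_split _ _ _ _) (measurableSet_box _ _)
            (hke (volume_box_ne_top _ _)) (hke (volume_box_ne_top _ _)),
          setIntegral_union (disjoint_box_split _ _ _ _) (measurableSet_box _ _)
            hef.integrableOn hef.integrableOn,
          setIntegral_union (disjoint_box_split _ _ _ _) (measurableSet_box _ _)
            heg.integrableOn heg.integrableOn]
        linarith
      · have e₁ := (H₁ k hk hkb).2 ε K hK fun x hx y hy => hεK x (hs1 hx) y (hs1 hy)
        have e₂ := (H₂ k hk hkb).2 ε K hK fun x hx y hy => hεK x (hs2 hx) y (hs2 hy)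
        obtain ⟨M, hM⟩ := hkb
        have hi : ∀ (π : Measure (Euc d × Euc d)) [IsFiniteMeasure π],
            Integrable (fun p => k (lerp s p)) π := fun π _ =>
          Integrable.of_bound (hk.comp (continuous_lerp s)).aestronglyMeasurable M
            (Eventually.of_forall fun p => hM _)
        rw [integral_add_measure (hi π₁) (hi π₂), integral_add_measure
            (Integrable.of_bound hk.aestronglyMeasurable M (Eventually.of_forall hM))
            (Integrable.of_bound hk.aestronglyMeasurable M (Eventually.of_forall hM))]
        have hw := discountedWidth_cons L (mix s l l') (mix s r r') j b
        -- The error is affine in the width and both halves have mass m/2, so the two errors sum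
        -- exactly. Cuts equalise masses, not lengths, so individual boxes need not shrink; only the
        -- average width does, and an affine modulus is what can be averaged.
        have hw' : 2 * m * (ε + K * discountedWidth (j :: L) (mix s l l') (mix s r r'))
            = 2 * (m / 2) * (ε + K * discountedWidth L (mix s l l')
                (Function.update (mix s r r') j b))
              + 2 * (m / 2) * (ε + K * discountedWidth L
                (Function.update (mix s l l') j b) (mix s r r')) := by
          linear_combination (-m * K) * hw
        rw [hw', add_sub_add_comm]
        exact (abs_add_le _ _).trans (add_le_add e₁ e₂)

end

noncomputable section

variable {d : ℕ}

/-! ### Couplings of measures on a box with convex entropy -/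

theorem ae_rnDeriv_eq_zero {f : Measure (Euc d)} {C : Set (Euc d)} (h : f Cᶜ = 0)
    (hC : MeasurableSet C) : ∀ᵐ x, x ∉ C → f.rnDeriv volume x = 0 := by
  have h1 : ∫⁻ x in Cᶜ, f.rnDeriv volume x = 0 :=
    le_antisymm ((Measure.setLIntegral_rnDeriv_le _).trans h.le) zero_le
  rw [lintegral_eq_zero_iff (Measure.measurable_rnDeriv _ _)] at h1
  exact (ae_restrict_iff' hC.compl).1 h1

theorem setIntegral_entDensity_of_null {f : Measure (Euc d)} {C : Set (Euc d)} (h : f Cᶜ = 0)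
    (hC : MeasurableSet C) : ∫ x in C, entDensity f x = ∫ x, entDensity f x := by
  refine setIntegral_eq_integral_of_ae_compl_eq_zero ?_
  filter_upwards [ae_rnDeriv_eq_zero h hC] with x hx hxC
  simp [entDensity, hx hxC]

/-- The list of all coordinates, repeated `n` times. -/
def coordList (d n : ℕ) : List (Fin d) := (List.replicate n (List.finRange d)).flatten

theorem discountedWidth_coordList (n : ℕ) (l r : Fin d → ℝ) :
    discountedWidth (coordList d n) l r = (1 / 2) ^ n * ∑ i, (r i - l i) := by
  rw [discountedWidth, Finset.mul_sum]
  refine Finset.sum_congr rfl fun i _ => ?_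
  have : (coordList d n).count i = n := by
    rw [coordList, List.count_flatten]
    simp [List.count_eq_one_of_mem (List.nodup_finRange d) (List.mem_finRange i)]
  rw [this]

theorem mix_self (s : ℝ) (l : Fin d → ℝ) : mix s l l = l := by
  ext i; simp only [mix]; ring

theorem box_subset_closedBall (l r : Fin d → ℝ) : ∃ R, box l r ⊆ Metric.closedBall 0 R := by
  rcases (box l r).eq_empty_or_nonempty with h | ⟨x₀, h₀⟩
  · exact ⟨0, by simp [h]⟩
  · refine ⟨‖x₀‖ + ∑ i, (r i - l i), fun x hx => ?_⟩
    rw [mem_closedBall_zero_iff]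
    have := norm_sub_le_of_mem_box hx h₀
    have := norm_add_le x₀ (x - x₀)
    rw [add_sub_cancel] at this
    linarith

/-- Uniform continuity on a bounded set as an affine modulus of continuity. -/
theorem exists_affine_modulus {k : Euc d → ℝ} (hk : Continuous k) {M : ℝ} (hM : ∀ x, |k x| ≤ M)
    (R : ℝ) {ε : ℝ} (hε : 0 < ε) :
    ∃ K, 0 ≤ K ∧ ∀ x ∈ Metric.closedBall 0 R, ∀ y ∈ Metric.closedBall 0 R,
      |k x - k y| ≤ ε + K * ‖x - y‖ := by
  have huc := (isCompact_closedBall (0 : Euc d) R).uniformContinuousOn_of_continuous hk.continuousOn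
  obtain ⟨δ, hδ, H⟩ := Metric.uniformContinuousOn_iff.1 huc ε hε
  have hM0 : 0 ≤ M := (abs_nonneg _).trans (hM 0)
  -- With this slope, points at distance at least δ are covered by the trivial bound 2M.
  refine ⟨2 * M / δ, by positivity, fun x hx y hy => ?_⟩
  rcases lt_or_ge (dist x y) δ with h | h
  · have h1 := (H x hx y hy h).le
    rw [Real.dist_eq] at h1
    have : 0 ≤ 2 * M / δ * ‖x - y‖ := by positivity
    linarith
  · rw [dist_eq_norm] at h
    have h1 : 2 * M ≤ 2 * M / δ * ‖x - y‖ := by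
      rw [div_mul_eq_mul_div, le_div_iff₀ hδ]
      gcongr
    have h2 := abs_sub (k x) (k y)
    linarith [hM x, hM y]

/-- The normalisation of a finite measure of mass `m`. -/
def normalized (f : Measure (Euc d)) {m : ℝ} (hm : 0 < m) (hf : f univ = ENNReal.ofReal m)
    (h2 : Integrable (fun x => ‖x‖ ^ 2) f) : WassersteinSpace d where
  measure := (ENNReal.ofReal m)⁻¹ • f
  isProbabilityMeasure := ⟨by
    rw [Measure.smul_apply, hf, smul_eq_mul,
      ENNReal.inv_mul_cancel (by simpa using hm) ENNReal.ofReal_ne_top]⟩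
  integrable_norm_sq := h2.smul_measure (ENNReal.inv_ne_top.2 (by simpa using hm))

/-- A weak limit of the coarse plans, as every coordinate is bisected n times. Weak convergence
handles a fixed bounded continuous test function; its comparison error tends to 2mε as n → ∞, then ε
→ 0, and duality turns the resulting bounds into an entropy bound. -/
theorem exists_box_plan {f g : Measure (Euc d)} [IsFiniteMeasure f] [IsFiniteMeasure g]
    (hf : f ≪ volume) (hg : g ≪ volume) (hef : Integrable (entDensity f))
    (heg : Integrable (entDensity g)) (h2f : Integrable (fun x => ‖x‖ ^ 2) f)
    (h2g : Integrable (fun x => ‖x‖ ^ 2) g) {l r : Fin d → ℝ} (hfQ : f (box l r)ᶜ = 0)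
    (hgQ : g (box l r)ᶜ = 0) {m : ℝ} (hm : 0 < m) (hfm : f univ = ENNReal.ofReal m)
    (hgm : g univ = ENNReal.ofReal m) :
    ∃ π : Measure (Euc d × Euc d), π.map Prod.fst = f ∧ π.map Prod.snd = g ∧
      ∀ s ∈ Icc (0 : ℝ) 1, π.map (lerp s) ≪ volume ∧ Integrable (entDensity (π.map (lerp s))) ∧
        ∫ x, entDensity (π.map (lerp s)) x
          ≤ (1 - s) * (∫ x, entDensity f x) + s * ∫ x, entDensity g x := by
  set Q := box l r with hQ
  have hQm : MeasurableSet Q := measurableSet_box l r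
  have hmE : ENNReal.ofReal m ≠ 0 := by simpa using hm
  have hinv : ENNReal.ofReal m * (ENNReal.ofReal m)⁻¹ = 1 :=
    ENNReal.mul_inv_cancel hmE ENNReal.ofReal_ne_top
  have hreal : ∀ {μ : Measure (Euc d)}, μ Qᶜ = 0 → μ univ = ENNReal.ofReal m → μ.real Q = m := by
    intro μ h h'
    have h3 := measure_add_measure_compl (μ := μ) hQm
    rw [h, add_zero, h'] at h3
    rw [Measure.real, h3, ENNReal.toReal_ofReal hm.le]
  have hres : ∀ {μ : Measure (Euc d)}, μ Qᶜ = 0 → μ.restrict Q = μ := fun h =>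
    Measure.restrict_eq_self_of_ae_mem (measure_eq_zero_iff_ae_notMem.1 h |>.mono
      fun x hx => not_notMem.1 hx)
  have hex : ∀ n, ∃ π, IsCoarsePlan f g l r l r m (coordList d n) π := fun n =>
    exists_isCoarsePlan hf hg hef heg (coordList d n) hm (hreal hfQ hfm) (hreal hgQ hgm)
  choose π hπ using hex
  have hπ1 : ∀ n, (π n).map Prod.fst = f := fun n => by rw [(hπ n).map_fst, hres hfQ]
  have hπ2 : ∀ n, (π n).map Prod.snd = g := fun n => by rw [(hπ n).map_snd, hres hgQ]
  set f' := normalized f hm hfm h2f with hf'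
  set g' := normalized g hm hgm h2g with hg'
  have hc : ∀ n, IsCoupling ((ENNReal.ofReal m)⁻¹ • π n) f' g' := fun n => by
    constructor
    · rw [Measure.map_smul, hπ1]; rfl
    · rw [Measure.map_smul, hπ2]; rfl
  let P : ℕ → ProbabilityMeasure (Euc d × Euc d) := fun n => ⟨_, (hc n).isProbabilityMeasure⟩
  obtain ⟨P', hP', hc'⟩ := exists_tendsto_isCoupling (γ := P) hc
  set π' : Measure (Euc d × Euc d) := ENNReal.ofReal m • (P' : Measure (Euc d × Euc d)) with hπ'
  have hπ'f : IsFiniteMeasure π' := by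
    rw [hπ']; exact Measure.smul_finite _ ENNReal.ofReal_ne_top
  have q1 : π'.map Prod.fst = f := by
    rw [hπ', Measure.map_smul, hc'.1]
    change ENNReal.ofReal m • ((ENNReal.ofReal m)⁻¹ • f) = f
    rw [smul_smul, hinv, one_smul]
  have q2 : π'.map Prod.snd = g := by
    rw [hπ', Measure.map_smul, hc'.2]
    change ENNReal.ofReal m • ((ENNReal.ofReal m)⁻¹ • g) = g
    rw [smul_smul, hinv, one_smul]
  refine ⟨π', q1, q2, fun s hs => ?_⟩
  have hlm := (continuous_lerp (d := d) s).measurable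
  have hlerp : ∀ᵐ p ∂π', lerp s p ∈ Q := by
    have h1 : ∀ᵐ p ∂π', p.1 ∈ Q := by
      refine ae_of_ae_map measurable_fst.aemeasurable ?_
      rw [q1, ae_iff]; exact hfQ
    have h2 : ∀ᵐ p ∂π', p.2 ∈ Q := by
      refine ae_of_ae_map measurable_snd.aemeasurable ?_
      rw [q2, ae_iff]; exact hgQ
    filter_upwards [h1, h2] with p hp1 hp2
    have := lerp_mem_box hs hp1 hp2
    rwa [mix_self, mix_self] at this
  obtain ⟨R, hR⟩ := box_subset_closedBall l r
  have hRn : ∀ x ∈ Q, ‖x‖ ^ 2 ≤ R ^ 2 := fun x hx => by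
    have := hR hx
    rw [mem_closedBall_zero_iff] at this
    gcongr
  have h2γ : Integrable (fun x => ‖x‖ ^ 2) (π'.map (lerp s)) := by
    rw [integrable_map_measure (Measurable.aestronglyMeasurable (by fun_prop)) hlm.aemeasurable]
    refine Integrable.of_bound (C := R ^ 2) (Measurable.aestronglyMeasurable
      (by have := hlm; fun_prop)) (hlerp.mono fun p hp => ?_)
    rw [Real.norm_of_nonneg (by simp)]
    exact hRn _ hp
  refine entropy_le_of_dualEntropy_le h2γ fun h hh ⟨M, hM⟩ => ?_
  -- Truncation from below makes the test function bounded and changes nothing on Q, where |x| ≤ R.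
  set k : Euc d → ℝ := fun x => max (-(M + R ^ 2)) (h x - ‖x‖ ^ 2) with hk
  have hkc : Continuous k := by rw [hk]; fun_prop
  have hM0 : 0 ≤ M := (abs_nonneg _).trans (hM 0)
  have hkb : ∀ x, |k x| ≤ M + R ^ 2 := fun x => abs_le.2 ⟨le_max_left _ _,
    max_le (by nlinarith) (by nlinarith [(abs_le.1 (hM x)).2, sq_nonneg ‖x‖])⟩
  have hkQ : ∀ x ∈ Q, k x = h x - ‖x‖ ^ 2 := fun x hx =>
    max_eq_right (by linarith [(abs_le.1 (hM x)).1, hRn x hx])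
  set B := (1 - s) * (∫ x, entDensity f x) + s * ∫ x, entDensity g x with hB
  set Z := ∫ x in Q, Real.exp (k x - 1) with hZ
  set W := ∑ i, (r i - l i) with hW
  have key : ∀ ε > 0, ∫ p, k (lerp s p) ∂π' ≤ B + Z + 2 * m * ε := by
    intro ε hε
    obtain ⟨K, hK, hmod⟩ := exists_affine_modulus hkc hkb R hε
    let φ : BoundedContinuousFunction (Euc d × Euc d) ℝ :=
      BoundedContinuousFunction.ofNormedAddCommGroup (fun p => k (lerp s p))
        (hkc.comp (continuous_lerp s)) (M + R ^ 2) fun p => hkb _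
    have hl1 : Tendsto (fun n => m * ∫ p, k (lerp s p) ∂(P n : Measure (Euc d × Euc d)))
        (hyperfilter ℕ) (𝓝 (m * ∫ p, k (lerp s p) ∂(P' : Measure (Euc d × Euc d)))) :=
      (ProbabilityMeasure.tendsto_iff_forall_integral_tendsto.1 hP' φ).const_mul m
    have e1 : ∫ p, k (lerp s p) ∂π' = m * ∫ p, k (lerp s p) ∂(P' : Measure (Euc d × Euc d)) := by
      rw [hπ', integral_smul_measure, ENNReal.toReal_ofReal hm.le, smul_eq_mul]
    have e2 : ∀ n, m * ∫ p, k (lerp s p) ∂(P n : Measure (Euc d × Euc d))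
        = ∫ p, k (lerp s p) ∂(π n) := fun n => by
      change m * ∫ p, k (lerp s p) ∂((ENNReal.ofReal m)⁻¹ • π n) = _
      rw [integral_smul_measure, ENNReal.toReal_inv, ENNReal.toReal_ofReal hm.le, smul_eq_mul,
        mul_inv_cancel_left₀ hm.ne']
    have hl2 : Tendsto (fun n : ℕ => B + Z + 2 * m * (ε + K * ((1 / 2) ^ n * W)))
        (hyperfilter ℕ) (𝓝 (B + Z + 2 * m * (ε + K * (0 * W)))) := by
      refine Tendsto.mono_left ?_ hyperfilter_le_atTop
      have : Tendsto (fun n : ℕ => (1 / 2 : ℝ) ^ n) atTop (𝓝 0) :=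
        tendsto_pow_atTop_nhds_zero_of_lt_one (by norm_num) (by norm_num)
      exact ((((this.mul_const W).const_mul K).const_add ε).const_mul (2 * m)).const_add (B + Z)
    rw [e1]
    refine (le_of_tendsto_of_tendsto' hl1 hl2 fun n => ?_).trans_eq (by ring)
    rw [e2]
    obtain ⟨σ, hσ, hσC, H⟩ := (hπ n).exists_close s hs
    simp only [mix_self, discountedWidth_coordList] at hσC H
    obtain ⟨H1, H2⟩ := H k hkc ⟨_, hkb⟩
    have H3 := H2 ε K hK fun x hx y hy => hmod x (hR hx) y (hR hy)
    rw [setIntegral_entDensity_of_null hfQ hQm, setIntegral_entDensity_of_null hgQ hQm] at H1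
    linarith [(abs_le.1 H3).2]
  have key' : ∫ p, k (lerp s p) ∂π' ≤ B + Z := by
    refine le_of_forall_pos_le_add fun δ hδ => ?_
    have := key (δ / (2 * m)) (by positivity)
    rwa [mul_div_cancel₀ _ (by positivity)] at this
  rw [dualEntropy, integral_map hlm.aemeasurable (Measurable.aestronglyMeasurable
    (by have := hh.measurable; fun_prop))]
  have e3 : ∫ p, (h (lerp s p) - ‖lerp s p‖ ^ 2) ∂π' = ∫ p, k (lerp s p) ∂π' :=
    integral_congr_ae (hlerp.mono fun p hp => (hkQ _ hp).symm)
  have e4 : Z ≤ ∫ x, Real.exp (h x - ‖x‖ ^ 2 - 1) := by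
    have : Z = ∫ x in Q, Real.exp (h x - ‖x‖ ^ 2 - 1) :=
      setIntegral_congr_fun hQm fun x hx => by simp only [hkQ x hx]
    rw [this]
    exact setIntegral_le_integral (integrable_exp_sub hh.measurable fun x => (abs_le.1 (hM x)).2)
      (Eventually.of_forall fun x => (Real.exp_pos _).le)
  rw [e3]
  linarith

end

noncomputable section

variable {d : ℕ}

/-! ### Laguerre cells and semi-discrete optimal transport -/

section Laguerre

variable {ι : Type*}

/-- The Laguerre cell of the site `a i` for the weights `w`. -/
def laguerreCell (a : ι → Euc d) (w : ι → ℝ) (i : ι) : Set (Euc d) :=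
  {x | ∀ j, j ≠ i → inner ℝ x (a j) + w j < inner ℝ x (a i) + w i}

theorem pairwise_disjoint_laguerreCell (a : ι → Euc d) (w : ι → ℝ) :
    Pairwise (Function.onFun Disjoint (laguerreCell a w)) := by
  intro i j hij
  refine Set.disjoint_left.2 fun x hi hj => ?_
  exact lt_asymm (hi j hij.symm) (hj i hij)

/-- The inequalities defining a cell are affine in the point and the weights jointly. Hence
interpolants from distinct pairs of cells land in distinct, disjoint cells of the interpolated
weights. -/
theorem lerp_mem_laguerreCell {a : ι → Euc d} {w w' : ι → ℝ} {i : ι} {s : ℝ}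
    (hs : s ∈ Icc (0 : ℝ) 1) {p : Euc d × Euc d} (h : p.1 ∈ laguerreCell a w i)
    (h' : p.2 ∈ laguerreCell a w' i) :
    lerp s p ∈ laguerreCell a (fun i => (1 - s) * w i + s * w' i) i := by
  intro j hj
  simp only [lerp, inner_add_left, real_inner_smul_left]
  have := mix_lt_mix hs (h j hj) (h' j hj)
  linarith

variable [Fintype ι]

theorem measurableSet_laguerreCell (a : ι → Euc d) (w : ι → ℝ) (i : ι) :
    MeasurableSet (laguerreCell a w i) := by
  have : laguerreCell a w i = ⋂ j, ⋂ _ : j ≠ i,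
      {x | inner ℝ x (a j) + w j < inner ℝ x (a i) + w i} := by ext; simp [laguerreCell]
  rw [this]
  refine MeasurableSet.iInter fun j => MeasurableSet.iInter fun _ => ?_
  exact measurableSet_lt (by fun_prop) (by fun_prop)

variable [Nonempty ι]

/-- The convex potential `max_i (⟪x, a i⟫ + w i)`. -/
def maxAffine (a : ι → Euc d) (w : ι → ℝ) (x : Euc d) : ℝ :=
  Finset.univ.sup' Finset.univ_nonempty fun i => inner ℝ x (a i) + w i

theorem le_maxAffine (a : ι → Euc d) (w : ι → ℝ) (x : Euc d) (i : ι) :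
    inner ℝ x (a i) + w i ≤ maxAffine a w x :=
  Finset.le_sup' (fun i => inner ℝ x (a i) + w i) (Finset.mem_univ i)

theorem maxAffine_le {a : ι → Euc d} {w : ι → ℝ} {x : Euc d} {c : ℝ}
    (h : ∀ i, inner ℝ x (a i) + w i ≤ c) : maxAffine a w x ≤ c :=
  Finset.sup'_le _ _ fun i _ => h i

theorem continuous_maxAffine (a : ι → Euc d) (w : ι → ℝ) : Continuous (maxAffine a w) := by
  unfold maxAffine
  exact Continuous.finset_sup'_apply _ fun i _ => by fun_prop

theorem maxAffine_le_add_norm (a : ι → Euc d) (w w' : ι → ℝ) (x : Euc d) :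
    maxAffine a w x ≤ maxAffine a w' x + ‖w - w'‖ := by
  refine maxAffine_le fun i => ?_
  have h1 := le_maxAffine a w' x i
  have h2 := norm_le_pi_norm (w - w') i
  rw [Pi.sub_apply, Real.norm_eq_abs] at h2
  linarith [(abs_le.1 h2).2]

theorem maxAffine_add_const (a : ι → Euc d) (w : ι → ℝ) (c : ℝ) (x : Euc d) :
    maxAffine a (fun i => w i + c) x = maxAffine a w x + c := by
  refine le_antisymm (maxAffine_le fun i => ?_) ?_
  · have := le_maxAffine a w x i
    linarith
  · rw [← le_sub_iff_add_le]
    refine maxAffine_le fun i => ?_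
    have := le_maxAffine a (fun i => w i + c) x i
    linarith

theorem maxAffine_of_mem {a : ι → Euc d} {w : ι → ℝ} {x : Euc d} {i : ι}
    (h : x ∈ laguerreCell a w i) : maxAffine a w x = inner ℝ x (a i) + w i := by
  refine le_antisymm (maxAffine_le fun j => ?_) (le_maxAffine a w x i)
  by_cases hj : j = i
  · rw [hj]
  · exact (h j hj).le

theorem integrable_inner_of_sq {v : Measure (Euc d)} [IsFiniteMeasure v]
    (h2 : Integrable (fun x => ‖x‖ ^ 2) v) (b : Euc d) :
    Integrable (fun x => inner ℝ x b) v := by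
  have h1 : Integrable (fun x : Euc d => ‖x‖) v := integrable_norm_of_sq measurable_id h2
  refine (h1.mul_const ‖b‖).mono' (by fun_prop) (Eventually.of_forall fun x => ?_)
  exact norm_inner_le_norm x b

theorem integrable_maxAffine {v : Measure (Euc d)} [IsFiniteMeasure v]
    (h2 : Integrable (fun x => ‖x‖ ^ 2) v) (a : ι → Euc d) (w : ι → ℝ) :
    Integrable (maxAffine a w) v := by
  have hi : ∀ i, Integrable (fun x => |inner ℝ x (a i) + w i|) v := fun i =>
    ((integrable_inner_of_sq h2 (a i)).add (integrable_const (w i))).abs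
  refine (integrable_finsetSum Finset.univ fun i _ => hi i).mono'
    (continuous_maxAffine a w).aestronglyMeasurable (Eventually.of_forall fun x => ?_)
  have hle : ∀ i, |inner ℝ x (a i) + w i| ≤ ∑ j, |inner ℝ x (a j) + w j| := fun i =>
    Finset.single_le_sum (f := fun j => |inner ℝ x (a j) + w j|) (fun j _ => abs_nonneg _)
      (Finset.mem_univ i)
  rw [Real.norm_eq_abs, abs_le]
  obtain ⟨i⟩ := ‹Nonempty ι›
  constructor
  · exact (abs_le.1 (hle i)).1.trans (le_maxAffine a w x i)
  · exact maxAffine_le fun j => (abs_le.1 (hle j)).2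

/-- The Kantorovich functional of semi-discrete optimal transport. -/
def kantorovich (a : ι → Euc d) (m : ι → ℝ) (v : Measure (Euc d)) (w : ι → ℝ) : ℝ :=
  ∫ x, maxAffine a w x ∂v - ∑ i, m i * w i

theorem continuous_kantorovich {v : Measure (Euc d)} [IsProbabilityMeasure v]
    (h2 : Integrable (fun x => ‖x‖ ^ 2) v) (a : ι → Euc d) (m : ι → ℝ) :
    Continuous (kantorovich a m v) := by
  refine Continuous.sub ?_ (by fun_prop)
  have hi := integrable_maxAffine h2 a
  refine LipschitzWith.continuous (K := 1) (LipschitzWith.of_le_add fun w w' => ?_)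
  rw [dist_eq_norm]
  have h1 : ∫ x, (maxAffine a w' x + ‖w - w'‖) ∂v = ∫ x, maxAffine a w' x ∂v + ‖w - w'‖ := by
    rw [integral_add (hi w') (integrable_const _)]; simp
  rw [← h1]
  exact integral_mono (hi w) ((hi w').add (integrable_const _)) fun x => maxAffine_le_add_norm a w w' x

/-- Adding a constant to all weights changes nothing, because the masses sum to 1, so the largest
weight may be taken to be 0. Then the functional is at least -C - m j * w j for every j, which
confines the relevant weights to a compact box since m j > 0. -/
theorem exists_min_kantorovich {v : Measure (Euc d)} [IsProbabilityMeasure v]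
    (h2 : Integrable (fun x => ‖x‖ ^ 2) v) (a : ι → Euc d) {m : ι → ℝ} (hm : ∀ i, 0 < m i)
    (hsum : ∑ i, m i = 1) : ∃ w, ∀ w', kantorovich a m v w ≤ kantorovich a m v w' := by
  set C := ∑ i, ∫ x, |inner ℝ x (a i)| ∂v with hC
  have hCi : ∀ i, -C ≤ ∫ x, inner ℝ x (a i) ∂v := fun i => by
    have h1 : ∫ x, |inner ℝ x (a i)| ∂v ≤ C :=
      Finset.single_le_sum (f := fun i => ∫ x, |inner ℝ x (a i)| ∂v)
        (fun j _ => integral_nonneg fun _ => abs_nonneg _) (Finset.mem_univ i)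
    have h3 := neg_abs_le (∫ x, inner ℝ x (a i) ∂v)
    have h4 := abs_integral_le_integral_abs (f := fun x => inner ℝ x (a i)) (μ := v)
    linarith
  have hlow : ∀ w : ι → ℝ, ∀ i, w i = 0 → (∀ j, w j ≤ 0) → ∀ j,
      -C - m j * w j ≤ kantorovich a m v w := by
    intro w i hi hw j
    have h1 : -C ≤ ∫ x, maxAffine a w x ∂v := (hCi i).trans
      (integral_mono (integrable_inner_of_sq h2 _) (integrable_maxAffine h2 a w) fun x => by
        have := le_maxAffine a w x i
        rw [hi] at this; linarith)
    have h3 : m j * -w j ≤ ∑ i, m i * -w i :=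
      Finset.single_le_sum (f := fun i => m i * -w i)
        (fun k _ => mul_nonneg (hm k).le (neg_nonneg.2 (hw k))) (Finset.mem_univ j)
    simp only [mul_neg, Finset.sum_neg_distrib] at h3
    rw [kantorovich]
    linarith
  have htrans : ∀ w : ι → ℝ, ∀ c : ℝ, kantorovich a m v (fun i => w i + c) = kantorovich a m v w := by
    intro w c
    simp only [kantorovich, maxAffine_add_const]
    rw [integral_add (integrable_maxAffine h2 a w) (integrable_const _)]
    simp only [mul_add, Finset.sum_add_distrib, ← Finset.sum_mul, hsum]
    simp
  set F0 := kantorovich a m v 0 with hF0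
  have hF0C : 0 ≤ F0 + C := by
    obtain ⟨i⟩ := ‹Nonempty ι›
    have := hlow 0 i rfl (fun _ => le_rfl) i
    simp only [Pi.zero_apply, mul_zero, sub_zero] at this
    linarith
  have h0 : (0 : ι → ℝ) ∈ Icc (fun i => -((F0 + C) / m i)) 0 :=
    ⟨fun i => neg_nonpos.2 (div_nonneg hF0C (hm i).le), le_rfl⟩
  obtain ⟨w, -, hw⟩ := isCompact_Icc.exists_isMinOn ⟨_, h0⟩
    (continuous_kantorovich h2 a m).continuousOn
  refine ⟨w, fun w' => ?_⟩
  obtain ⟨i, -, hi⟩ := Finset.exists_max_image Finset.univ w' Finset.univ_nonempty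
  rw [← htrans w' (-w' i)]
  set w'' : ι → ℝ := fun j => w' j + -w' i with hw''
  by_cases hle : kantorovich a m v w'' ≤ F0
  · refine hw ⟨fun j => ?_, fun j => ?_⟩
    · have h3 := hlow w'' i (by simp [hw'']) (fun j => by
        simp only [hw'']; linarith [hi j (Finset.mem_univ j)]) j
      rw [neg_le, le_div_iff₀ (hm j)]
      linarith
    · simp only [hw'', Pi.zero_apply]; linarith [hi j (Finset.mem_univ j)]
  · exact (hw h0).trans (not_le.1 hle).le

/-- Raising one weight by h raises the potential by at most h, and only where that site is within h
of the maximum. Minimality compares this gain with m i * h; then h → 0. One-sided differences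
suffice, so no differentiability is needed. -/
theorem le_measure_tie {v : Measure (Euc d)} [IsProbabilityMeasure v]
    (h2 : Integrable (fun x => ‖x‖ ^ 2) v) {a : ι → Euc d} {m w : ι → ℝ}
    (hw : ∀ w', kantorovich a m v w ≤ kantorovich a m v w') (i : ι) :
    m i ≤ v.real {x | maxAffine a w x ≤ inner ℝ x (a i) + w i} := by
  classical
  have hi := integrable_maxAffine h2 a
  have hslice : ∀ h : ℝ, 0 < h → m i ≤ v.real {x | maxAffine a w x < inner ℝ x (a i) + w i + h} := by
    intro h hh
    set E := {x | maxAffine a w x < inner ℝ x (a i) + w i + h} with hE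
    have hEm : MeasurableSet E :=
      measurableSet_lt (continuous_maxAffine a w).measurable (by fun_prop)
    set w' := Function.update w i (w i + h) with hw'
    have h3 := hw w'
    have h4 : ∑ j, m j * w' j = ∑ j, m j * w j + m i * h := by
      have : ∀ j, m j * w' j = m j * w j + if j = i then m i * h else 0 := fun j => by
        by_cases hj : j = i
        · subst hj; simp [hw']; ring
        · simp [hw', hj]
      simp only [this, Finset.sum_add_distrib, Finset.sum_ite_eq', Finset.mem_univ, if_true]
    have h5 : ∀ x, maxAffine a w' x ≤ maxAffine a w x + E.indicator (fun _ => h) x := by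
      intro x
      refine maxAffine_le fun j => ?_
      by_cases hj : j = i
      · subst hj
        simp only [hw', Function.update_self]
        by_cases hx : x ∈ E
        · rw [indicator_of_mem hx]
          have := le_maxAffine a w x j
          linarith
        · rw [indicator_of_notMem hx]
          have : inner ℝ x (a j) + w j + h ≤ maxAffine a w x := not_lt.1 hx
          linarith
      · simp only [hw', Function.update_of_ne hj]
        have h6 := le_maxAffine a w x j
        have h7 : 0 ≤ E.indicator (fun _ => h) x := indicator_nonneg (fun _ _ => hh.le) x
        linarith
    have hEi : Integrable (E.indicator fun _ => h) v := (integrable_const h).indicator hEm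
    have h6 : ∫ x, maxAffine a w' x ∂v ≤ ∫ x, maxAffine a w x ∂v + h * v.real E := by
      have h7 := integral_mono (hi w') ((hi w).add hEi) h5
      have h8 : ∫ x, (maxAffine a w + E.indicator fun _ => h) x ∂v
          = ∫ x, maxAffine a w x ∂v + h * v.real E := by
        rw [integral_add' (hi w) hEi, integral_indicator hEm]
        simp [mul_comm]
      rw [← h8]; exact h7
    rw [kantorovich, kantorovich, h4] at h3
    have h9 : m i * h ≤ v.real E * h := by linarith
    exact le_of_mul_le_mul_right h9 hh
  set s : ℕ → Set (Euc d) := fun n =>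
    {x | maxAffine a w x < inner ℝ x (a i) + w i + 1 / ((n : ℝ) + 1)} with hs
  have hcap : ⋂ n, s n = {x | maxAffine a w x ≤ inner ℝ x (a i) + w i} := by
    ext x
    simp only [hs, mem_iInter, mem_ofPred_eq]
    constructor
    · intro h
      have hl := (tendsto_one_div_add_atTop_nhds_zero_nat (𝕜 := ℝ)).const_add
        (inner ℝ x (a i) + w i)
      rw [add_zero] at hl
      exact ge_of_tendsto' hl fun n => (h n).le
    · intro h n
      have : 0 < 1 / ((n : ℝ) + 1) := by positivity
      linarith
  have hanti : Antitone s := fun n n' hn x hx => by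
    have h1 : 1 / ((n' : ℝ) + 1) ≤ 1 / ((n : ℝ) + 1) := by
      gcongr
    simp only [hs, mem_ofPred_eq] at hx ⊢
    linarith
  have hlim := tendsto_measure_iInter_atTop (μ := v) (s := s) (fun n =>
    (measurableSet_lt (continuous_maxAffine a w).measurable (by fun_prop)).nullMeasurableSet)
    hanti ⟨0, measure_ne_top _ _⟩
  rw [hcap] at hlim
  have hlim' := (ENNReal.tendsto_toReal (measure_ne_top v _)).comp hlim
  exact ge_of_tendsto' hlim' fun n => hslice _ (by positivity)

/-- Existence of weights whose Laguerre cells have prescribed masses. -/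
theorem exists_laguerre_weights {v : Measure (Euc d)} [IsProbabilityMeasure v]
    (h2 : Integrable (fun x => ‖x‖ ^ 2) v) (hv : v ≪ volume) {a : ι → Euc d}
    (ha : Function.Injective a) {m : ι → ℝ} (hm : ∀ i, 0 < m i) (hsum : ∑ i, m i = 1) :
    ∃ w, (∀ i, v (laguerreCell a w i) = ENNReal.ofReal (m i)) ∧
      v (⋃ i, laguerreCell a w i)ᶜ = 0 := by
  obtain ⟨w, hw⟩ := exists_min_kantorovich h2 a hm hsum
  -- Ties between distinct sites lie on hyperplanes, which v does not charge.
  have hge : ∀ i, m i ≤ v.real (laguerreCell a w i) := by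
    intro i
    refine (le_measure_tie h2 hw i).trans ?_
    have hnull : v (⋃ j, {x : Euc d | j ≠ i ∧ inner ℝ x (a j - a i) = w i - w j}) = 0 := by
      refine measure_iUnion_null fun j => ?_
      by_cases hj : j = i
      · simp [hj]
      · refine hv (measure_mono_null (fun x hx => hx.2)
          (volume_inner_eq_zero (sub_ne_zero.2 (ha.ne hj)) _))
    have hsub : {x | maxAffine a w x ≤ inner ℝ x (a i) + w i} ⊆ laguerreCell a w i ∪
        ⋃ j, {x : Euc d | j ≠ i ∧ inner ℝ x (a j - a i) = w i - w j} := by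
      intro x hx
      by_cases hxc : x ∈ laguerreCell a w i
      · exact Or.inl hxc
      · right
        simp only [laguerreCell, mem_ofPred_eq, not_forall, not_lt] at hxc
        obtain ⟨j, hj, hle⟩ := hxc
        refine mem_iUnion.2 ⟨j, hj, ?_⟩
        have h3 := (le_maxAffine a w x j).trans hx
        rw [inner_sub_right]
        linarith
    refine ENNReal.toReal_mono (measure_ne_top _ _) ?_
    refine (measure_mono hsub).trans ((measure_union_le _ _).trans ?_)
    rw [hnull, add_zero]
  have htot : ∑ i, v.real (laguerreCell a w i) = v.real (⋃ i, laguerreCell a w i) := by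
    rw [measureReal_iUnion_fintype (pairwise_disjoint_laguerreCell a w)
      (measurableSet_laguerreCell a w)]
  have hle1 : v.real (⋃ i, laguerreCell a w i) ≤ 1 := measureReal_le_one
  -- The cells are disjoint with total mass at most 1 = ∑ m i, so no inequality can be strict.
  have heq : ∀ i, m i = v.real (laguerreCell a w i) := by
    have h3 : ∑ i, m i = ∑ i, v.real (laguerreCell a w i) :=
      le_antisymm (Finset.sum_le_sum fun i _ => hge i) (by rw [htot, hsum]; exact hle1)
    exact fun i => (Finset.sum_eq_sum_iff_of_le fun i _ => hge i).1 h3 i (Finset.mem_univ i)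
  refine ⟨w, fun i => by rw [heq i, ofReal_measureReal], ?_⟩
  rw [prob_compl_eq_zero_iff (MeasurableSet.iUnion (measurableSet_laguerreCell a w)),
    ← ofReal_measureReal, ← htot, ← Finset.sum_congr rfl fun i _ => heq i, hsum]
  simp

end Laguerre

end

noncomputable section

variable {d : ℕ}

/-! ### Optimality of Laguerre plans and addition of entropies over cells -/

section Semidiscrete

variable {ι : Type*} [Fintype ι]

theorem entDensity_restrict_ae (f : Measure (Euc d)) [IsFiniteMeasure f] {C : Set (Euc d)}
    (hC : MeasurableSet C) : entDensity (f.restrict C) =ᵐ[volume] C.indicator (entDensity f) := by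
  filter_upwards [Measure.rnDeriv_restrict f volume hC] with x hx
  by_cases hxC : x ∈ C <;> simp [entDensity, hx, hxC]

/-- Apply Fenchel-Young on each cell separately. Disjointness is what keeps the sum of the
exponential integrals below the integral over the whole space. -/
theorem dualEntropy_sum_le {γ : ι → Measure (Euc d)} [∀ i, IsFiniteMeasure (γ i)]
    (h2 : ∀ i, Integrable (fun x => ‖x‖ ^ 2) (γ i)) {C : ι → Set (Euc d)}
    (hC : ∀ i, MeasurableSet (C i)) (hdisj : Pairwise (Function.onFun Disjoint C))
    (hγC : ∀ i, γ i (C i)ᶜ = 0) (hac : ∀ i, γ i ≪ volume)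
    (hent : ∀ i, Integrable (entDensity (γ i))) {h : Euc d → ℝ} (hh : Continuous h) {M : ℝ}
    (hM : ∀ x, |h x| ≤ M) :
    dualEntropy h (∑ i, γ i) ≤ ∑ i, ∫ x, entDensity (γ i) x := by
  have hk : ∀ i, Integrable (fun x => h x - ‖x‖ ^ 2) (γ i) := fun i =>
    (Integrable.of_bound hh.aestronglyMeasurable M (Eventually.of_forall hM)).sub (h2 i)
  have he := integrable_exp_sub hh.measurable fun x => (abs_le.1 (hM x)).2
  have e1 : ∫ x, (h x - ‖x‖ ^ 2) ∂(∑ i, γ i) = ∑ i, ∫ x in C i, (h x - ‖x‖ ^ 2) ∂(γ i) := by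
    rw [integral_finsetSum_measure fun i _ => hk i]
    refine Finset.sum_congr rfl fun i _ => (setIntegral_eq_integral_of_ae_compl_eq_zero ?_).symm
    filter_upwards [measure_eq_zero_iff_ae_notMem.1 (hγC i)] with x hx hx'
    exact absurd hx' hx
  have e2 : ∑ i, ∫ x in C i, Real.exp (h x - ‖x‖ ^ 2 - 1)
      ≤ ∫ x, Real.exp (h x - ‖x‖ ^ 2 - 1) := by
    rw [← integral_iUnion_fintype hC hdisj fun i => he.integrableOn]
    exact setIntegral_le_integral he (Eventually.of_forall fun x => (Real.exp_pos _).le)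
  have e3 : ∀ i, ∫ x in C i, (h x - ‖x‖ ^ 2) ∂(γ i)
      - ∫ x in C i, Real.exp (h x - ‖x‖ ^ 2 - 1) ≤ ∫ x, entDensity (γ i) x := fun i => by
    rw [← setIntegral_entDensity_of_null (hγC i) (hC i)]
    exact setIntegral_sub_exp_le (hac i) (hent i) (hC i) (hk i).integrableOn he.integrableOn
  have e4 := Finset.sum_le_sum fun i (_ : i ∈ Finset.univ) => e3 i
  rw [Finset.sum_sub_distrib] at e4
  rw [dualEntropy, e1]
  linarith

theorem integrable_comp_fst_add {γ : Measure (Euc d × Euc d)} {u v : WassersteinSpace d}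
    (hγ : IsCoupling γ u v) {α β : Euc d → ℝ} (hα : Integrable α u.measure)
    (hβ : Integrable β v.measure) :
    Integrable (fun p => α p.1 + β p.2) γ ∧
      ∫ p, (α p.1 + β p.2) ∂γ = ∫ y, α y ∂u.measure + ∫ x, β x ∂v.measure := by
  have h1 : Integrable (fun p => α p.1) γ := by
    rw [← hγ.1] at hα; exact hα.comp_measurable measurable_fst
  have h2 : Integrable (fun p => β p.2) γ := by
    rw [← hγ.2] at hβ; exact hβ.comp_measurable measurable_snd
  refine ⟨h1.add h2, ?_⟩
  rw [integral_add h1 h2]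
  congr 1
  · rw [← hγ.1] at hα ⊢
    exact (integral_map measurable_fst.aemeasurable hα.1).symm
  · rw [← hγ.2] at hβ ⊢
    exact (integral_map measurable_snd.aemeasurable hβ.1).symm

variable [Nonempty ι]

/-- A plan sending each Laguerre cell to its site is optimal. -/
theorem cost_le_dist_sq_of_laguerre {u v : WassersteinSpace d} {γ : Measure (Euc d × Euc d)}
    (hγ : IsCoupling γ u v) {a : ι → Euc d} (ha : Function.Injective a) {w : ι → ℝ}
    (hu : ∀ᵐ y ∂u.measure, ∃ i, y = a i)
    (hcell : ∀ᵐ p ∂γ, ∃ i, p.1 = a i ∧ p.2 ∈ laguerreCell a w i) :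
    ∫ p, ‖p.1 - p.2‖ ^ 2 ∂γ ≤ dist u v ^ 2 := by
  classical
  set W : Euc d → ℝ := fun y => ∑ i, ({a i} : Set (Euc d)).indicator (fun _ => w i) y with hW
  have hWa : ∀ i, W (a i) = w i := fun i => by
    simp only [hW]
    rw [Finset.sum_eq_single i (fun j _ hj => by simp [ha.ne hj.symm]) (by simp)]
    simp
  have hwi : ∀ i, Integrable (({a i} : Set (Euc d)).indicator fun _ => w i) u.measure := fun i =>
    (integrable_const (μ := u.measure) (w i)).indicator (measurableSet_singleton (a i))
  have hWi : Integrable W u.measure := by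
    simpa only [hW] using integrable_finsetSum Finset.univ fun i _ => hwi i
  -- Kantorovich potentials: α(y) + β(x) ≤ |y - x|² when y is a site, with equality when x lies in
  -- the cell of y. Since ∫(α + β) depends only on the marginals, the given plan costs no more than
  -- an optimal one.
  set α : Euc d → ℝ := fun y => ‖y‖ ^ 2 + 2 * W y with hα
  set β : Euc d → ℝ := fun x => ‖x‖ ^ 2 - 2 * maxAffine a w x with hβ
  have hαi : Integrable α u.measure := u.integrable_norm_sq.add (hWi.const_mul 2)
  have hβi : Integrable β v.measure :=
    v.integrable_norm_sq.sub ((integrable_maxAffine v.integrable_norm_sq a w).const_mul 2)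
  obtain ⟨γ', hγ', hopt⟩ := exists_optimal_coupling u v
  obtain ⟨i1, j1⟩ := integrable_comp_fst_add hγ hαi hβi
  obtain ⟨i2, j2⟩ := integrable_comp_fst_add hγ' hαi hβi
  have hu' : ∀ᵐ p ∂γ', ∃ i, p.1 = a i := by
    refine ae_of_ae_map (p := fun y => ∃ i, y = a i) measurable_fst.aemeasurable ?_
    rw [hγ'.1]; exact hu
  rw [← hopt]
  calc ∫ p, ‖p.1 - p.2‖ ^ 2 ∂γ = ∫ p, (α p.1 + β p.2) ∂γ := by
        refine integral_congr_ae ?_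
        filter_upwards [hcell] with p ⟨i, h1, h2⟩
        simp only [hα, hβ]
        rw [h1, hWa, maxAffine_of_mem h2, norm_sub_sq_real, real_inner_comm]
        ring
    _ = ∫ p, (α p.1 + β p.2) ∂γ' := by rw [j1, j2]
    _ ≤ ∫ p, ‖p.1 - p.2‖ ^ 2 ∂γ' := by
        refine integral_mono_ae i2 hγ'.integrable_cost ?_
        filter_upwards [hu'] with p ⟨i, h1⟩
        simp only [hα, hβ]
        rw [h1, hWa, norm_sub_sq_real, real_inner_comm]
        have := le_maxAffine a w p.2 i
        linarith

/-- Convexity of the entropy along generalised geodesics with discrete base and bounded ends. -/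
theorem exists_threePlan_of_discrete {a : ι → Euc d} (ha : Function.Injective a) {m : ι → ℝ}
    (hm : ∀ i, 0 < m i) (hsum : ∑ i, m i = 1) {u v₀ v₁ : WassersteinSpace d}
    (hu : u.measure = ∑ i, ENNReal.ofReal (m i) • Measure.dirac (a i))
    (h₀ : v₀.measure ≪ volume) (h₁ : v₁.measure ≪ volume)
    (he₀ : Integrable (entDensity v₀.measure)) (he₁ : Integrable (entDensity v₁.measure))
    {l r : Fin d → ℝ} (hb₀ : v₀.measure (box l r)ᶜ = 0) (hb₁ : v₁.measure (box l r)ᶜ = 0) :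
    ∃ π, ∃ h : IsThreePlan π u v₀ v₁, ∀ s ∈ Icc (0 : ℝ) 1,
      (h.curve s).measure ≪ volume ∧ Integrable (entDensity (h.curve s).measure) ∧
        ∫ x, entDensity (h.curve s).measure x
          ≤ (1 - s) * (∫ x, entDensity v₀.measure x) + s * ∫ x, entDensity v₁.measure x := by
  obtain ⟨w₀, hw₀, hc₀⟩ := exists_laguerre_weights v₀.integrable_norm_sq h₀ ha hm hsum
  obtain ⟨w₁, hw₁, hc₁⟩ := exists_laguerre_weights v₁.integrable_norm_sq h₁ ha hm hsum
  set A := laguerreCell a w₀ with hA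
  set B := laguerreCell a w₁ with hB
  have hAm : ∀ i, MeasurableSet (A i) := measurableSet_laguerreCell a w₀
  have hBm : ∀ i, MeasurableSet (B i) := measurableSet_laguerreCell a w₁
  have hres : ∀ {v : WassersteinSpace d} (C : Set (Euc d)), MeasurableSet C →
      Integrable (entDensity v.measure) → Integrable (entDensity (v.measure.restrict C)) :=
    fun C hC h => (h.indicator hC).congr (entDensity_restrict_ae _ hC).symm
  have hresI : ∀ {v : WassersteinSpace d} (C : Set (Euc d)), MeasurableSet C →
      ∫ x, entDensity (v.measure.restrict C) x = ∫ x in C, entDensity v.measure x :=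
    fun C hC => by rw [integral_congr_ae (entDensity_restrict_ae _ hC), integral_indicator hC]
  -- Optimality towards u only records the cell of a point, so the coupling inside each pair of
  -- cells is free and is chosen for the entropy.
  have hex : ∀ i, ∃ π : Measure (Euc d × Euc d), π.map Prod.fst = v₀.measure.restrict (A i) ∧
      π.map Prod.snd = v₁.measure.restrict (B i) ∧ ∀ s ∈ Icc (0 : ℝ) 1,
        π.map (lerp s) ≪ volume ∧ Integrable (entDensity (π.map (lerp s))) ∧
        ∫ x, entDensity (π.map (lerp s)) x
          ≤ (1 - s) * (∫ x, entDensity (v₀.measure.restrict (A i)) x)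
            + s * ∫ x, entDensity (v₁.measure.restrict (B i)) x := fun i =>
    exists_box_plan (Measure.restrict_le_self.absolutelyContinuous.trans h₀)
      (Measure.restrict_le_self.absolutelyContinuous.trans h₁) (hres _ (hAm i) he₀)
      (hres _ (hBm i) he₁) v₀.integrable_norm_sq.restrict v₁.integrable_norm_sq.restrict
      (le_antisymm ((Measure.restrict_le_self _).trans hb₀.le) zero_le)
      (le_antisymm ((Measure.restrict_le_self _).trans hb₁.le) zero_le) (hm i)
      (by rw [Measure.restrict_apply_univ, hw₀]) (by rw [Measure.restrict_apply_univ, hw₁])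
  choose π hπ1 hπ2 hπ using hex
  have hπu : ∀ i, π i univ = ENNReal.ofReal (m i) := fun i => by
    rw [← preimage_univ (f := Prod.fst), ← Measure.map_apply measurable_fst MeasurableSet.univ,
      hπ1, Measure.restrict_apply_univ, hw₀]
  have hπf : ∀ i, IsFiniteMeasure (π i) := fun i =>
    ⟨by rw [hπu]; exact ENNReal.ofReal_lt_top⟩
  have hpm : ∀ i, Measurable fun p : Euc d × Euc d => (a i, p) := fun i => by fun_prop
  set P : Measure (Euc d × (Euc d × Euc d)) := ∑ i, (π i).map fun p => (a i, p) with hP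
  have hmap : ∀ {f : Euc d × (Euc d × Euc d) → Euc d}, Measurable f →
      P.map f = ∑ i, (π i).map fun p => f (a i, p) := fun {f} hf => by
    rw [hP, Measure.map_finset_sum hf.aemeasurable]
    exact Finset.sum_congr rfl fun i _ => Measure.map_map hf (hpm i)
  have hunion : ∀ {v : WassersteinSpace d} {C : ι → Set (Euc d)}, (∀ i, MeasurableSet (C i)) →
      Pairwise (Function.onFun Disjoint C) → v.measure (⋃ i, C i)ᶜ = 0 →
      ∑ i, v.measure.restrict (C i) = v.measure := fun hC hd h0 => by
    rw [← Measure.sum_fintype, ← Measure.restrict_iUnion hd hC]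
    exact Measure.restrict_eq_self_of_ae_mem ((measure_eq_zero_iff_ae_notMem.1 h0).mono
      fun x hx => not_notMem.1 hx)
  have m1 : P.map (fun p => p.1) = u.measure := by
    rw [hmap measurable_fst, hu]
    refine Finset.sum_congr rfl fun i _ => ?_
    simp only
    rw [Measure.map_const, hπu]
  have m2 : P.map (fun p => p.2.1) = v₀.measure := by
    rw [hmap (by fun_prop), ← hunion hAm (pairwise_disjoint_laguerreCell a w₀) hc₀]
    exact Finset.sum_congr rfl fun i _ => hπ1 i
  have m3 : P.map (fun p => p.2.2) = v₁.measure := by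
    rw [hmap (by fun_prop), ← hunion hBm (pairwise_disjoint_laguerreCell a w₁) hc₁]
    exact Finset.sum_congr rfl fun i _ => hπ2 i
  have hmem1 : ∀ i, ∀ᵐ p ∂(π i), p.1 ∈ A i := fun i => by
    refine ae_of_ae_map measurable_fst.aemeasurable ?_
    rw [hπ1]; exact ae_restrict_mem (hAm i)
  have hmem2 : ∀ i, ∀ᵐ p ∂(π i), p.2 ∈ B i := fun i => by
    refine ae_of_ae_map measurable_snd.aemeasurable ?_
    rw [hπ2]; exact ae_restrict_mem (hBm i)
  have hua : ∀ᵐ y ∂u.measure, ∃ i, y = a i := by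
    rw [hu, ae_finsetSum_measure_iff]
    intro i _
    exact Measure.ae_smul_measure (by rw [ae_dirac_eq]; exact ⟨i, rfl⟩) _
  have cost : ∀ {v : WassersteinSpace d} {f : Euc d × Euc d → Euc d} {w : ι → ℝ}, Measurable f →
      P.map (fun p => f p.2) = v.measure → (∀ i, ∀ᵐ p ∂(π i), f p ∈ laguerreCell a w i) →
      ∫ p, ‖p.1 - f p.2‖ ^ 2 ∂P ≤ dist u v ^ 2 := by
    intro v f w hf hv hmem
    have hfm : Measurable fun p : Euc d × (Euc d × Euc d) => (p.1, f p.2) := by fun_prop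
    have hc : IsCoupling (P.map fun p => (p.1, f p.2)) u v := by
      constructor
      · rw [Measure.map_map measurable_fst hfm]; exact m1
      · rw [Measure.map_map measurable_snd hfm]; exact hv
    have hms : MeasurableSet {p : Euc d × Euc d | ∃ i, p.1 = a i ∧ p.2 ∈ laguerreCell a w i} := by
      have : {p : Euc d × Euc d | ∃ i, p.1 = a i ∧ p.2 ∈ laguerreCell a w i}
          = ⋃ i, {a i} ×ˢ laguerreCell a w i := by ext; simp
      rw [this]
      exact MeasurableSet.iUnion fun i =>
        (measurableSet_singleton _).prod (measurableSet_laguerreCell a w i)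
    have h3 := cost_le_dist_sq_of_laguerre hc ha (w := w) hua (by
      rw [ae_map_iff hfm.aemeasurable hms, hP, ae_finsetSum_measure_iff]
      intro i _
      refine (ae_map_iff (hpm i).aemeasurable (hfm hms)).2 ?_
      filter_upwards [hmem i] with p hp
      exact ⟨i, rfl, hp⟩)
    rwa [integral_map hfm.aemeasurable (Measurable.aestronglyMeasurable (by fun_prop))] at h3
  have hplan : IsThreePlan P u v₀ v₁ :=
    ⟨m1, m2, m3, cost measurable_fst m2 hmem1, cost measurable_snd m3 hmem2⟩
  refine ⟨P, hplan, fun s hs => ?_⟩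
  have hcurve : (hplan.curve s).measure = ∑ i, (π i).map (lerp s) :=
    hmap (continuous_interp s).measurable
  have hsq := (hplan.curve s).integrable_norm_sq
  rw [hcurve, integrable_finsetSum_measure] at hsq
  have hlm := (continuous_lerp (d := d) s).measurable
  have hcell : ∀ i, (π i).map (lerp s)
      (laguerreCell a (fun i => (1 - s) * w₀ i + s * w₁ i) i)ᶜ = 0 := fun i => by
    rw [measure_eq_zero_iff_ae_notMem,
      ae_map_iff hlm.aemeasurable (measurableSet_laguerreCell _ _ _).compl.compl]
    filter_upwards [hmem1 i, hmem2 i] with p h1 h2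
    exact not_not.2 (lerp_mem_laguerreCell hs h1 h2)
  refine entropy_le_of_dualEntropy_le (hplan.curve s).integrable_norm_sq fun h hh ⟨M, hM⟩ => ?_
  rw [hcurve]
  refine (dualEntropy_sum_le (fun i => hsq i (Finset.mem_univ i))
    (measurableSet_laguerreCell _ _) (pairwise_disjoint_laguerreCell _ _) hcell
    (fun i => (hπ i s hs).1) (fun i => (hπ i s hs).2.1) hh hM).trans ?_
  refine (Finset.sum_le_sum fun i _ => (hπ i s hs).2.2).trans_eq ?_
  have htot : ∀ {v : WassersteinSpace d} {C : ι → Set (Euc d)}, (∀ i, MeasurableSet (C i)) →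
      Pairwise (Function.onFun Disjoint C) → v.measure (⋃ i, C i)ᶜ = 0 →
      Integrable (entDensity v.measure) →
      ∑ i, ∫ x, entDensity (v.measure.restrict (C i)) x = ∫ x, entDensity v.measure x :=
    fun {v C} hC hd h0 hi => by
      rw [← setIntegral_entDensity_of_null h0 (MeasurableSet.iUnion hC),
        integral_iUnion_fintype hC hd fun i => hi.integrableOn]
      exact Finset.sum_congr rfl fun i _ => hresI _ (hC i)
  rw [Finset.sum_add_distrib, ← Finset.mul_sum, ← Finset.mul_sum,
    htot hAm (pairwise_disjoint_laguerreCell a w₀) hc₀ he₀,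
    htot hBm (pairwise_disjoint_laguerreCell a w₁) hc₁ he₁]

end Semidiscrete

end

noncomputable section

variable {d : ℕ}

/-! ### Approximation by discrete measures -/

/-- Values with null preimage are dropped, since the construction of Laguerre weights needs strictly
positive masses. -/
theorem map_simpleFunc_eq_sum (f : SimpleFunc (Euc d) (Euc d)) (μ : Measure (Euc d))
    [IsFiniteMeasure μ] : μ.map f = ∑ y ∈ f.range.filter (fun y => μ (f ⁻¹' {y}) ≠ 0),
      μ (f ⁻¹' {y}) • Measure.dirac y := by
  classical
  rw [Finset.sum_filter_of_ne (p := fun y => μ (f ⁻¹' {y}) ≠ 0)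
    (fun y _ h h0 => h (by rw [h0, zero_smul]))]
  ext s hs
  rw [Measure.map_apply f.measurable hs, Measure.finsetSum_apply]
  have h1 : f ⁻¹' s = f ⁻¹' ((f.range.filter (· ∈ s) : Finset (Euc d)) : Set (Euc d)) := by
    ext x; simp
  rw [h1, ← f.sum_measure_preimage_singleton, Finset.sum_filter]
  refine Finset.sum_congr rfl fun y _ => ?_
  rw [Measure.smul_apply, Measure.dirac_apply' _ hs]
  by_cases h : y ∈ s <;> simp [h]

/-- Push u forward by a simple function close to the identity in L²(u); the pair of the two maps is
a coupling whose cost is their squared L² distance. -/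
theorem exists_discrete_dist_lt (u : WassersteinSpace d) {ε : ℝ} (hε : 0 < ε) :
    ∃ (S : Finset (Euc d)) (m : S → ℝ), (∀ i, 0 < m i) ∧ ∑ i, m i = 1 ∧
      ∃ u' : WassersteinSpace d, u'.measure = ∑ i : S, ENNReal.ofReal (m i) •
        Measure.dirac (i : Euc d) ∧ dist u' u < ε := by
  classical
  have hid : MemLp (fun x : Euc d => x) 2 u.measure :=
    (memLp_two_iff_integrable_sq_norm (Measurable.aestronglyMeasurable (by fun_prop))).2
      u.integrable_norm_sq
  have hlim := SimpleFunc.tendsto_approxOn_Lp_eLpNorm (p := 2) (μ := u.measure)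
    (f := fun x : Euc d => x) measurable_id (s := univ) (y₀ := 0) (mem_univ _) (by simp) (by simp)
    (by simpa using hid.2)
  obtain ⟨n, hn⟩ := (hlim.eventually (gt_mem_nhds (ENNReal.ofReal_pos.2 hε))).exists
  set f := SimpleFunc.approxOn (fun x : Euc d => x) measurable_id univ 0 (mem_univ _) n with hf
  have hf2 : MemLp f 2 u.measure :=
    SimpleFunc.memLp_approxOn measurable_id hid (mem_univ _) (by simp) n
  let u' : WassersteinSpace d :=
    { measure := u.measure.map f
      isProbabilityMeasure := Measure.isProbabilityMeasure_map f.measurable.aemeasurable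
      integrable_norm_sq := by
        rw [integrable_map_measure (Measurable.aestronglyMeasurable (by fun_prop))
          f.measurable.aemeasurable]
        exact hf2.integrable_norm_pow (by norm_num) }
  set S := f.range.filter (fun y => u.measure (f ⁻¹' {y}) ≠ 0) with hS
  have hsum : u.measure.map f = ∑ i : S, ENNReal.ofReal (u.measure.real (f ⁻¹' {(i : Euc d)})) •
      Measure.dirac (i : Euc d) := by
    rw [map_simpleFunc_eq_sum, ← Finset.sum_coe_sort]
    refine Finset.sum_congr rfl fun y _ => ?_
    rw [ofReal_measureReal]
  refine ⟨S, fun i => u.measure.real (f ⁻¹' {(i : Euc d)}), fun i => ?_, ?_, u', hsum, ?_⟩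
  · exact ENNReal.toReal_pos (Finset.mem_filter.1 i.2).2 (measure_ne_top _ _)
  · have h1 : (u.measure.map f) univ = 1 := u'.isProbabilityMeasure.measure_univ
    rw [hsum, Measure.finsetSum_apply] at h1
    simp only [Measure.smul_apply, measure_univ, smul_eq_mul, mul_one] at h1
    rw [← ENNReal.ofReal_sum_of_nonneg fun i _ => measureReal_nonneg] at h1
    exact ENNReal.ofReal_eq_one.1 h1
  · have hd := IsThreePlan.dist_le_of_map (π := u.measure) (f := f) (g := fun x => x)
      f.measurable measurable_id (μ := u') (ν := u) rfl Measure.map_id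
    have hsub : MemLp (⇑f - fun x : Euc d => x) 2 u.measure := hf2.sub hid
    have he : ∫ a, ‖f a - a‖ ^ 2 ∂u.measure
        = (eLpNorm (⇑f - fun x : Euc d => x) 2 u.measure).toReal ^ 2 := by
      rw [hsub.eLpNorm_eq_integral_rpow_norm (by simp) (by simp), ENNReal.toReal_ofReal (by positivity)]
      simp only [ENNReal.toReal_ofNat, Real.rpow_two, Pi.sub_apply]
      rw [← Real.rpow_natCast, ← Real.rpow_mul (integral_nonneg fun _ => by positivity)]
      norm_num
    rw [he] at hd
    refine (abs_le_of_sq_le_sq' hd ENNReal.toReal_nonneg).2.trans_lt ?_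
    exact (ENNReal.lt_ofReal_iff_toReal_lt hsub.2.ne).1 hn

/-! ### Approximation by measures on cubes -/

theorem entropy_smul {μ : Measure (Euc d)} [IsFiniteMeasure μ] (hac : μ ≪ volume)
    (hi : Integrable (entDensity μ)) {c : ℝ} (hc : 0 < c) :
    Integrable (entDensity (ENNReal.ofReal c • μ)) ∧
      ∫ x, entDensity (ENNReal.ofReal c • μ) x
        = c * (∫ x, entDensity μ x) + c * Real.log c * μ.real univ := by
  have h1 : entDensity (ENNReal.ofReal c • μ) =ᵐ[volume] fun x =>
      c * entDensity μ x + c * Real.log c * (μ.rnDeriv volume x).toReal := by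
    filter_upwards [Measure.rnDeriv_smul_left_of_ne_top μ volume (ENNReal.ofReal_ne_top (r := c))]
      with x hx
    simp only [entDensity, hx, Pi.smul_apply, smul_eq_mul, ENNReal.toReal_mul,
      ENNReal.toReal_ofReal hc.le]
    -- The logarithm of a product splits only for nonzero factors; where the density vanishes both
    -- sides are 0.
    by_cases h0 : (μ.rnDeriv volume x).toReal = 0
    · simp [h0]
    · rw [Real.log_mul hc.ne' h0]; ring
  have i1 := hi.const_mul c
  have i2 := (Measure.integrable_toReal_rnDeriv (μ := μ) (ν := volume)).const_mul (c * Real.log c)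
  refine ⟨(i1.add i2).congr h1.symm, ?_⟩
  rw [integral_congr_ae h1, integral_add i1 i2, integral_const_mul, integral_const_mul,
    Measure.integral_toReal_rnDeriv hac]

section Conditioned

variable (v : WassersteinSpace d) {C : Set (Euc d)} (hp : 0 < v.measure.real C)

/-- The measure `v` conditioned on `C`. -/
def conditioned : WassersteinSpace d :=
  normalized (v.measure.restrict C) hp
    (by rw [Measure.restrict_apply_univ, ofReal_measureReal]) v.integrable_norm_sq.restrict

theorem conditioned_measure : (conditioned v hp).measure
    = ENNReal.ofReal (v.measure.real C)⁻¹ • v.measure.restrict C := by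
  rw [ENNReal.ofReal_inv_of_pos hp]; rfl

theorem entropy_conditioned (hC : MeasurableSet C) (hac : v.measure ≪ volume)
    (hi : Integrable (entDensity v.measure)) :
    (conditioned v hp).measure ≪ volume ∧ Integrable (entDensity (conditioned v hp).measure) ∧
      ∫ x, entDensity (conditioned v hp).measure x = (v.measure.real C)⁻¹ *
        (∫ x in C, entDensity v.measure x) - Real.log (v.measure.real C) := by
  have hr := entDensity_restrict_ae v.measure hC
  have hac' : v.measure.restrict C ≪ volume :=
    Measure.restrict_le_self.absolutelyContinuous.trans hac
  obtain ⟨h1, h2⟩ := entropy_smul hac' ((hi.indicator hC).congr hr.symm) (inv_pos.2 hp)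
  rw [conditioned_measure]
  refine ⟨hac'.smul_left _, h1, ?_⟩
  rw [h2, integral_congr_ae hr, integral_indicator hC, measureReal_restrict_apply_univ,
    Real.log_inv]
  field_simp
  ring

/-- Leave the part of v on C in place and send the excess mass, the fraction p⁻¹(1 - p) of v on C,
to the part of v outside C by a product coupling. Only this second piece has a cost. -/
theorem dist_conditioned_sq_le (hC : MeasurableSet C) :
    dist (conditioned v hp) v ^ 2 ≤ 2 * ((v.measure.real C)⁻¹ * (1 - v.measure.real C)
      * ∫ x in C, ‖x‖ ^ 2 ∂v.measure) + 2 * ∫ x in Cᶜ, ‖x‖ ^ 2 ∂v.measure := by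
  set p := v.measure.real C with hpdef
  set γ₁ : Measure (Euc d × Euc d) := (v.measure.restrict C).map fun x => (x, x) with hγ₁
  set γ₂ : Measure (Euc d × Euc d) :=
    ENNReal.ofReal p⁻¹ • (v.measure.restrict C).prod (v.measure.restrict Cᶜ) with hγ₂
  have hpc : v.measure Cᶜ = ENNReal.ofReal (1 - p) := by
    rw [← ofReal_measureReal, probReal_compl_eq_one_sub hC]
  have hpC : v.measure C = ENNReal.ofReal p := by rw [ofReal_measureReal]
  have hp1 : p ≤ 1 := measureReal_le_one
  have f2 : γ₂.map Prod.fst = ENNReal.ofReal (p⁻¹ * (1 - p)) • v.measure.restrict C := by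
    rw [hγ₂, Measure.map_smul, Measure.map_fst_prod, Measure.restrict_apply_univ, hpc, smul_smul,
      ENNReal.ofReal_mul (inv_nonneg.2 hp.le)]
  have s2 : γ₂.map Prod.snd = v.measure.restrict Cᶜ := by
    rw [hγ₂, Measure.map_smul, Measure.map_snd_prod, Measure.restrict_apply_univ, hpC, smul_smul,
      ← ENNReal.ofReal_mul (inv_nonneg.2 hp.le), inv_mul_cancel₀ hp.ne', ENNReal.ofReal_one,
      one_smul]
  have hdm : Measurable fun x : Euc d => (x, x) := by fun_prop
  have hc : IsCoupling (γ₁ + γ₂) (conditioned v hp) v := by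
    constructor
    · rw [Measure.map_add _ _ measurable_fst, f2, hγ₁, Measure.map_map measurable_fst hdm,
        conditioned_measure]
      change Measure.map id _ + _ = _
      rw [Measure.map_id, ← one_smul ℝ≥0∞ (v.measure.restrict C), smul_smul, smul_smul, mul_one,
        ← add_smul, ← ENNReal.ofReal_one,
        ← ENNReal.ofReal_add zero_le_one (mul_nonneg (inv_nonneg.2 hp.le) (sub_nonneg.2 hp1))]
      have e : 1 + p⁻¹ * (1 - p) = p⁻¹ := by field_simp; ring
      rw [e, ENNReal.ofReal_one, mul_one]
    · rw [Measure.map_add _ _ measurable_snd, s2, hγ₁, Measure.map_map measurable_snd hdm]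
      change Measure.map id _ + _ = _
      rw [Measure.map_id, Measure.restrict_add_restrict_compl hC]
  have hic := integrable_add_measure.1 hc.integrable_cost
  have hi1 := (integrable_add_measure.1 hc.integrable_fst).2.const_mul 2
  have hi2 := (integrable_add_measure.1 hc.integrable_snd).2.const_mul 2
  refine hc.dist_sq_le.trans ?_
  rw [integral_add_measure hic.1 hic.2]
  have e1 : ∫ p : Euc d × Euc d, ‖p.1 - p.2‖ ^ 2 ∂γ₁ = 0 := by
    rw [hγ₁, integral_map hdm.aemeasurable (Measurable.aestronglyMeasurable (by fun_prop))]
    simp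
  have e2 : ∫ q : Euc d × Euc d, ‖q.1‖ ^ 2 ∂γ₂
      = p⁻¹ * (1 - p) * ∫ x in C, ‖x‖ ^ 2 ∂v.measure := by
    rw [← integral_map (f := fun x : Euc d => ‖x‖ ^ 2) measurable_fst.aemeasurable
      (Measurable.aestronglyMeasurable (by fun_prop)), f2, integral_smul_measure,
      ENNReal.toReal_ofReal (mul_nonneg (inv_nonneg.2 hp.le) (sub_nonneg.2 hp1)), smul_eq_mul]
  have e3 : ∫ q : Euc d × Euc d, ‖q.2‖ ^ 2 ∂γ₂ = ∫ x in Cᶜ, ‖x‖ ^ 2 ∂v.measure := by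
    rw [← integral_map (f := fun x : Euc d => ‖x‖ ^ 2) measurable_snd.aemeasurable
      (Measurable.aestronglyMeasurable (by fun_prop)), s2]
  rw [e1, zero_add, ← e2, ← e3, ← integral_const_mul, ← integral_const_mul,
    ← integral_add hi1 hi2]
  exact integral_mono hic.2 (hi1.add hi2) fun q => norm_sub_sq_le _ _

end Conditioned

/-- The half-open cube of side `2 n` around the origin. -/
def cube (d n : ℕ) : Set (Euc d) := box (fun _ => -(n : ℝ)) fun _ => n

theorem monotone_cube : Monotone (cube d) := fun m n hmn x hx i => by
  have : (m : ℝ) ≤ n := by exact_mod_cast hmn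
  exact ⟨(neg_le_neg this).trans (hx i).1, (hx i).2.trans_le this⟩

theorem iUnion_cube : ⋃ n, cube d n = univ := by
  refine eq_univ_of_forall fun x => mem_iUnion.2 ?_
  obtain ⟨n, hn⟩ := exists_nat_gt ‖x‖
  refine ⟨n, fun i => ?_⟩
  have h1 := abs_le.1 ((PiLp.norm_apply_le x i).trans hn.le)
  have h2 := (le_abs_self _).trans_lt ((PiLp.norm_apply_le x i).trans_lt hn)
  exact ⟨h1.1, h2⟩

/-- Condition v on growing cubes: masses, second moments and entropies over the cubes converge. The
conclusion holds for all large n, so that one cube can serve two measures. -/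
theorem exists_cube_approximation {v : WassersteinSpace d} (hac : v.measure ≪ volume)
    (hi : Integrable (entDensity v.measure)) {ε : ℝ} (hε : 0 < ε) :
    ∀ᶠ n in atTop, ∃ w : WassersteinSpace d, w.measure (cube d n)ᶜ = 0 ∧ w.measure ≪ volume ∧
      Integrable (entDensity w.measure) ∧ dist w v < ε ∧
      ∫ x, entDensity w.measure x < (∫ x, entDensity v.measure x) + ε := by
  have hm : ∀ n, MeasurableSet (cube d n) := fun n => measurableSet_box _ _
  have hlim : ∀ {μ : Measure (Euc d)} {f : Euc d → ℝ}, Integrable f μ →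
      Tendsto (fun n => ∫ x in cube d n, f x ∂μ) atTop (𝓝 (∫ x, f x ∂μ)) := fun {μ f} hf => by
    have := tendsto_setIntegral_of_monotone hm monotone_cube (f := f) (μ := μ) hf.integrableOn
    rwa [iUnion_cube, Measure.restrict_univ] at this
  have h1 : Tendsto (fun n => v.measure.real (cube d n)) atTop (𝓝 1) := by
    have := hlim (integrable_const (μ := v.measure) (1 : ℝ))
    simpa using this
  have h2 := hlim v.integrable_norm_sq
  have h3 := hlim hi
  set M := ∫ x, ‖x‖ ^ 2 ∂v.measure with hM
  have h4 : Tendsto (fun n => ∫ x in (cube d n)ᶜ, ‖x‖ ^ 2 ∂v.measure) atTop (𝓝 0) := by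
    have : Tendsto (fun n => M - ∫ x in cube d n, ‖x‖ ^ 2 ∂v.measure) atTop (𝓝 (M - M)) :=
      tendsto_const_nhds.sub h2
    rw [sub_self] at this
    refine this.congr fun n => ?_
    rw [hM, ← integral_add_compl (hm n) v.integrable_norm_sq, add_sub_cancel_left]
  have hinv : Tendsto (fun n => (v.measure.real (cube d n))⁻¹) atTop (𝓝 1⁻¹) :=
    h1.inv₀ one_ne_zero
  have h5 : Tendsto (fun n => 2 * ((v.measure.real (cube d n))⁻¹ * (1 - v.measure.real (cube d n))
      * ∫ x in cube d n, ‖x‖ ^ 2 ∂v.measure) + 2 * ∫ x in (cube d n)ᶜ, ‖x‖ ^ 2 ∂v.measure) atTop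
      (𝓝 0) := by
    have := (((hinv.mul (tendsto_const_nhds (x := (1 : ℝ)).sub h1)).mul h2).const_mul 2).add
      (h4.const_mul 2)
    simpa using this
  have h6 : Tendsto (fun n => (v.measure.real (cube d n))⁻¹ *
      (∫ x in cube d n, entDensity v.measure x) - Real.log (v.measure.real (cube d n))) atTop
      (𝓝 (∫ x, entDensity v.measure x)) := by
    have := (hinv.mul h3).sub (h1.log one_ne_zero)
    simpa using this
  filter_upwards [h1.eventually (lt_mem_nhds zero_lt_one),
    h5.eventually (gt_mem_nhds (pow_pos hε 2)), h6.eventually (gt_mem_nhds (lt_add_of_pos_right _ hε))]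
    with n hn1 hn2 hn3
  obtain ⟨a1, a2, a3⟩ := entropy_conditioned v hn1 (hm n) hac hi
  refine ⟨conditioned v hn1, ?_, a1, a2, ?_, a3 ▸ hn3⟩
  · rw [conditioned_measure, Measure.smul_apply, Measure.restrict_apply (hm n).compl]
    simp
  · exact lt_of_pow_lt_pow_left₀ 2 hε.le ((dist_conditioned_sq_le v hn1 (hm n)).trans_lt hn2)

end

noncomputable section

variable {d : ℕ}

/-! ### Convexity of the entropy along generalised geodesics -/

theorem exists_threePlan_approximation (u : WassersteinSpace d) {v₀ v₁ : WassersteinSpace d}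
    (h₀ : v₀.measure ≪ volume) (h₁ : v₁.measure ≪ volume)
    (he₀ : Integrable (entDensity v₀.measure)) (he₁ : Integrable (entDensity v₁.measure))
    {ε : ℝ} (hε : 0 < ε) :
    ∃ (u' w₀ w₁ : WassersteinSpace d) (π : Measure (Euc d × (Euc d × Euc d)))
      (h : IsThreePlan π u' w₀ w₁), dist u' u < ε ∧ dist w₀ v₀ < ε ∧ dist w₁ v₁ < ε ∧
      ∀ s ∈ Icc (0 : ℝ) 1,
        (h.curve s).measure ≪ volume ∧ Integrable (entDensity (h.curve s).measure) ∧
          ∫ x, entDensity (h.curve s).measure x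
            ≤ (1 - s) * (∫ x, entDensity v₀.measure x) + s * (∫ x, entDensity v₁.measure x)
              + ε := by
  obtain ⟨S, m, hm, hsum, u', hu', hd⟩ := exists_discrete_dist_lt u hε
  obtain ⟨n, ⟨w₀, a₀, b₀, c₀, d₀, e₀⟩, w₁, a₁, b₁, c₁, d₁, e₁⟩ :=
    ((exists_cube_approximation h₀ he₀ hε).and (exists_cube_approximation h₁ he₁ hε)).exists
  have : Nonempty S := by
    by_contra hne
    rw [not_nonempty_iff] at hne
    simp at hsum
  obtain ⟨π, h, H⟩ := exists_threePlan_of_discrete (a := fun i : S => (i : Euc d))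
    Subtype.val_injective hm hsum hu' b₀ b₁ c₀ c₁ a₀ a₁
  refine ⟨u', w₀, w₁, π, h, hd, d₀, d₁, fun s hs => ⟨(H s hs).1, (H s hs).2.1,
    (H s hs).2.2.trans ?_⟩⟩
  have i₀ := mul_le_mul_of_nonneg_left e₀.le (sub_nonneg.2 hs.2)
  have i₁ := mul_le_mul_of_nonneg_left e₁.le hs.1
  linarith

theorem IsThreePlan.lintegral_enorm_sq_le {π : Measure (Euc d × (Euc d × Euc d))}
    {u v₀ v₁ : WassersteinSpace d} (h : IsThreePlan π u v₀ v₁) : ∫⁻ p, ‖p‖ₑ ^ 2 ∂π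
      ≤ ENNReal.ofReal (∫ x, ‖x‖ ^ 2 ∂u.measure + (∫ x, ‖x‖ ^ 2 ∂v₀.measure
        + ∫ x, ‖x‖ ^ 2 ∂v₁.measure)) := by
  have hle : ∀ p : Euc d × (Euc d × Euc d),
      ‖p‖ₑ ^ 2 ≤ ‖p.1‖ₑ ^ 2 + (‖p.2.1‖ₑ ^ 2 + ‖p.2.2‖ₑ ^ 2) := fun p =>
    (enorm_prod_sq_le p).trans (add_le_add le_rfl (enorm_prod_sq_le p.2))
  have hc : Continuous fun x : Euc d => ‖x‖ ^ 2 := by fun_prop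
  have e1 : ∫ p, ‖p.1‖ ^ 2 ∂π = ∫ x, ‖x‖ ^ 2 ∂u.measure := by
    rw [← h.map_fst, integral_map (by fun_prop) hc.aestronglyMeasurable]
  refine (lintegral_mono hle).trans ?_
  rw [lintegral_add_left (by fun_prop), lintegral_add_left (by fun_prop),
    lintegral_enorm_sq_eq h.integrable_fst,
    lintegral_enorm_sq_eq (h.integrable_comp_snd v₀.integrable_norm_sq),
    lintegral_enorm_sq_eq (h.integrable_comp_trd v₁.integrable_norm_sq), e1,
    h.integral_comp_snd hc, h.integral_comp_trd hc,
    ← ENNReal.ofReal_add (integral_nonneg fun _ => by positivity)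
      (integral_nonneg fun _ => by positivity),
    ← ENNReal.ofReal_add (integral_nonneg fun _ => by positivity)
      (add_nonneg (integral_nonneg fun _ => by positivity)
        (integral_nonneg fun _ => by positivity))]

/-- The second moment of the interpolant is expressed by those of the ends and the plan cost. The
end moments converge with the ends in d₂, while the lower semicontinuous plan cost enters with a
plus sign, as the passage to the limit requires; for -∫|x|² itself weak semicontinuity would point
the wrong way. -/
theorem IsThreePlan.dualEntropy_curve {π : Measure (Euc d × (Euc d × Euc d))}
    {u v₀ v₁ : WassersteinSpace d} (h : IsThreePlan π u v₀ v₁) (s : ℝ) {f : Euc d → ℝ}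
    (hf : Continuous f) {M : ℝ} (hM : ∀ x, |f x| ≤ M) :
    dualEntropy f (h.curve s).measure = ∫ p, f (interp s p) ∂π
      - ((1 - s) * (∫ x, ‖x‖ ^ 2 ∂v₀.measure) + s * (∫ x, ‖x‖ ^ 2 ∂v₁.measure)
        - ∫ p, s * (1 - s) * ‖p.2.1 - p.2.2‖ ^ 2 ∂π)
      - ∫ x, Real.exp (f x - ‖x‖ ^ 2 - 1) := by
  have := h.isProbabilityMeasure
  have hs := continuous_interp (d := d) s
  have hc : Continuous fun x : Euc d => ‖x‖ ^ 2 := by fun_prop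
  have e : ∫ x, (f x - ‖x‖ ^ 2) ∂(h.curve s).measure
      = ∫ p, (f (interp s p) - ‖interp s p‖ ^ 2) ∂π :=
    integral_map hs.measurable.aemeasurable (hf.sub hc).aestronglyMeasurable
  have i0 := (h.integrable_comp_snd v₀.integrable_norm_sq).const_mul (1 - s)
  have i1 := (h.integrable_comp_trd v₁.integrable_norm_sq).const_mul s
  have i01 : Integrable (fun p => (1 - s) * ‖p.2.1‖ ^ 2 + s * ‖p.2.2‖ ^ 2) π := i0.add i1
  have iF : Integrable (fun p => f (interp s p)) π := Integrable.of_bound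
    (hf.comp hs).aestronglyMeasurable M (Eventually.of_forall fun p => hM _)
  rw [dualEntropy, e, integral_sub iF (h.integrable_interp_sq s)]
  simp only [interp, norm_combo_sq]
  rw [integral_sub i01 (h.integrable_snd_sub_trd.const_mul _), integral_add i0 i1,
    integral_const_mul (1 - s) fun p : Euc d × (Euc d × Euc d) => ‖p.2.1‖ ^ 2,
    integral_const_mul s fun p : Euc d × (Euc d × Euc d) => ‖p.2.2‖ ^ 2,
    h.integral_comp_snd hc, h.integral_comp_trd hc]

/-- Between measures of finite entropy there is a three-plan along which the entropy is convex. -/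
theorem exists_threePlan_entropy (u : WassersteinSpace d) {v₀ v₁ : WassersteinSpace d}
    (h₀ : v₀.measure ≪ volume) (h₁ : v₁.measure ≪ volume)
    (he₀ : Integrable (entDensity v₀.measure)) (he₁ : Integrable (entDensity v₁.measure)) :
    ∃ π, ∃ h : IsThreePlan π u v₀ v₁, ∀ s ∈ Icc (0 : ℝ) 1,
      (h.curve s).measure ≪ volume ∧ Integrable (entDensity (h.curve s).measure) ∧
        ∫ x, entDensity (h.curve s).measure x
          ≤ (1 - s) * (∫ x, entDensity v₀.measure x) + s * ∫ x, entDensity v₁.measure x := by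
  choose u' w₀ w₁ π h hu hw₀ hw₁ hent using fun n : ℕ =>
    exists_threePlan_approximation u h₀ h₁ he₀ he₁ (ε := 1 / ((n : ℝ) + 1)) (by positivity)
  have hε := tendsto_one_div_add_atTop_nhds_zero_nat (𝕜 := ℝ)
  have hlim : ∀ {w : ℕ → WassersteinSpace d} {w' : WassersteinSpace d},
      (∀ n : ℕ, dist (w n) w' < 1 / ((n : ℝ) + 1)) → Tendsto w atTop (𝓝 w') := fun hw =>
    tendsto_iff_dist_tendsto_zero.2
      (squeeze_zero (fun _ => dist_nonneg) (fun n => (hw n).le) hε)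
  have tu := hlim hu
  have t₀ := hlim hw₀
  have t₁ := hlim hw₁
  have hM : ∀ {w : ℕ → WassersteinSpace d} {w' : WassersteinSpace d}, Tendsto w atTop (𝓝 w') →
      Tendsto (fun n => ∫ x, ‖x‖ ^ 2 ∂(w n).measure) atTop (𝓝 (∫ x, ‖x‖ ^ 2 ∂w'.measure)) :=
    fun hw => (continuous_secondMoment.tendsto _).comp hw
  obtain ⟨B, hB⟩ := ((hM tu).add ((hM t₀).add (hM t₁))).bddAbove_range
  let P : ℕ → ProbabilityMeasure (Euc d × (Euc d × Euc d)) := fun n =>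
    ⟨π n, (h n).isProbabilityMeasure⟩
  obtain ⟨P', hP'⟩ := exists_tendsto_of_moment_le P B fun n =>
    (h n).lintegral_enorm_sq_le.trans (ENNReal.ofReal_le_ofReal (hB (mem_range_self n)))
  have hat := hyperfilter_le_atTop
  have hplan : IsThreePlan (P' : Measure (Euc d × (Euc d × Euc d))) u v₀ v₁ :=
    { map_fst := map_eq_of_tendsto hP' (by fun_prop) (tu.mono_left hat) fun n => (h n).map_fst
      map_snd := map_eq_of_tendsto hP' (by fun_prop) (t₀.mono_left hat) fun n => (h n).map_snd
      map_trd := map_eq_of_tendsto hP' (by fun_prop) (t₁.mono_left hat) fun n => (h n).map_trd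
      cost_snd := (integrable_of_tendsto hP' (F := fun p => ‖p.1 - p.2.1‖ ^ 2) (by fun_prop)
        (fun _ => by positivity) (((tu.dist t₀).pow 2).mono_left hat)
        (fun n => (h n).integrable_fst_sub_snd) fun n => (h n).cost_snd).2
      cost_trd := (integrable_of_tendsto hP' (F := fun p => ‖p.1 - p.2.2‖ ^ 2) (by fun_prop)
        (fun _ => by positivity) (((tu.dist t₁).pow 2).mono_left hat)
        (fun n => (h n).integrable_fst_sub_trd) fun n => (h n).cost_trd).2 }
  refine ⟨_, hplan, fun s hs => ?_⟩
  refine entropy_le_of_dualEntropy_le (hplan.curve s).integrable_norm_sq fun f hf ⟨M, hM'⟩ => ?_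
  rw [hplan.dualEntropy_curve s hf hM']
  let F : BoundedContinuousFunction (Euc d × (Euc d × Euc d)) ℝ :=
    BoundedContinuousFunction.ofNormedAddCommGroup (fun p => f (interp s p))
      (hf.comp (continuous_interp s)) M fun p => hM' _
  have tF : Tendsto (fun n => ∫ p, f (interp s p) ∂π n) (hyperfilter ℕ)
      (𝓝 (∫ p, f (interp s p) ∂P')) :=
    ProbabilityMeasure.tendsto_iff_forall_integral_tendsto.1 hP' F
  -- The approximate entropy inequality, solved for the plan cost: all other terms converge, so
  -- lower semicontinuity of the cost gives the inequality for the limit plan.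
  have tc := (((((tendsto_const_nhds (x := (1 - s) * (∫ x, entDensity v₀.measure x)
    + s * (∫ x, entDensity v₁.measure x))).add hε).add (((hM t₀).const_mul (1 - s)).add
      ((hM t₁).const_mul s))).add (tendsto_const_nhds (x := ∫ x, Real.exp (f x - ‖x‖ ^ 2 - 1)))
      ).mono_left hat).sub tF
  have hD := (integrable_of_tendsto hP'
    (F := fun p => s * (1 - s) * ‖p.2.1 - p.2.2‖ ^ 2) (by fun_prop)
    (fun p => mul_nonneg (mul_nonneg hs.1 (sub_nonneg.2 hs.2)) (by positivity)) tc
    (fun n => (h n).integrable_snd_sub_trd.const_mul _) fun n => by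
      have h1 := dualEntropy_le (hent n s hs).1 (hent n s hs).2.1
        ((h n).curve s).integrable_norm_sq hf.measurable hM'
      rw [(h n).dualEntropy_curve s hf hM'] at h1
      have h2 := (hent n s hs).2.2
      change ∫ p, s * (1 - s) * ‖p.2.1 - p.2.2‖ ^ 2 ∂π n ≤ _
      linarith).2
  linarith

end

noncomputable section

variable {d : ℕ} {V : ℝ → Euc d → ℝ} {lam : ℝ → ℝ} {κ : ℝ}

/-! ### Convexity of the penalised energy -/

/-- E5 wants a curve independent of t and τ, so the plan is fixed by the entropies alone. If κ = 0
or an end has infinite entropy, any three-plan will do. -/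
theorem exists_threePlan_mul_entropy (hκ : 0 ≤ κ) (u v₀ v₁ : WassersteinSpace d) :
    ∃ π, ∃ h : IsThreePlan π u v₀ v₁, EntropyTermFinite κ v₀ → EntropyTermFinite κ v₁ →
      ∀ s ∈ Icc (0 : ℝ) 1, EntropyTermFinite κ (h.curve s) ∧
        κ * ∫ x, entDensity (h.curve s).measure x ≤ (1 - s) *
          (κ * ∫ x, entDensity v₀.measure x) + s * (κ * ∫ x, entDensity v₁.measure x) := by
  by_cases hf : κ ≠ 0 ∧ EntropyTermFinite κ v₀ ∧ EntropyTermFinite κ v₁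
  · obtain ⟨h0, f₀, f₁⟩ := hf
    have g₀ := f₀.resolve_left h0
    have g₁ := f₁.resolve_left h0
    obtain ⟨π, h, H⟩ := exists_threePlan_entropy u g₀.1 g₁.1 g₀.2 g₁.2
    refine ⟨π, h, fun _ _ s hs => ⟨Or.inr ⟨(H s hs).1, (H s hs).2.1⟩, ?_⟩⟩
    have := mul_le_mul_of_nonneg_left (H s hs).2.2 hκ
    linarith
  · obtain ⟨π, h⟩ := exists_isThreePlan u v₀ v₁
    refine ⟨π, h, fun f₀ f₁ s hs => ?_⟩
    have h0 : κ = 0 := by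
      by_contra h0
      exact hf ⟨h0, f₀, f₁⟩
    exact ⟨Or.inl h0, by simp [h0]⟩

theorem combo_eq_top {x y : EReal} (hx : x ≠ ⊥) (hy : y ≠ ⊥) (h : x = ⊤ ∨ y = ⊤) {a b : ℝ}
    (ha : 0 < a) (hb : 0 < b) (c : ℝ) : (a : EReal) * x + (b : EReal) * y - (c : EReal) = ⊤ := by
  have hne : ∀ {z : EReal} {r : ℝ}, z ≠ ⊥ → 0 < r → (r : EReal) * z ≠ ⊥ := by
    intro z r hz hr
    induction z with
    | bot => exact absurd rfl hz
    | coe z => rw [← EReal.coe_mul]; exact EReal.coe_ne_bot _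
    | top => rw [EReal.coe_mul_top_of_pos hr]; exact top_ne_bot
  have hsum : (a : EReal) * x + (b : EReal) * y = ⊤ := by
    rcases h with rfl | rfl
    · rw [EReal.coe_mul_top_of_pos ha]
      exact EReal.top_add_of_ne_bot (hne hy hb)
    · rw [EReal.coe_mul_top_of_pos hb]
      exact EReal.add_top_of_ne_bot (hne hx ha)
  rw [hsum, EReal.top_sub_coe]

/-- Add the three convexity estimates along one plan. The distance and potential terms together gain
(1 + τν)/(2τ) s(1-s) D, with ν = max(λ(t), -Λ). -/
theorem hypE5_energyOne (hκ : 0 ≤ κ) (hV1 : HypV1 V lam) (hV2 : HypV2 V) (hV3 : HypV3 V) :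
    HypE5 (energyOne κ V) lam := by
  refine ⟨hV1.1, fun u v₀ v₁ => ?_⟩
  obtain ⟨π, h, H⟩ := exists_threePlan_mul_entropy hκ u v₀ v₁
  refine ⟨h.curve, h.continuous_curve.continuousOn, h.curve_zero, h.curve_one, ?_⟩
  intro T hT t ht τ hτ hτT s hs
  obtain ⟨A, B, hAB⟩ := exists_quadratic_lower_bound hV1 hV2 hV3 hT
  have hVc := continuous_potential hV1 ht.1
  -- The ends are separate because 0 * ⊤ = 0: an infinite energy at one end makes the right side
  -- infinite only for 0 < s < 1.
  rcases hs.1.eq_or_lt with rfl | hs0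
  · rw [h.curve_zero]; simp
  rcases hs.2.eq_or_lt with rfl | hs1
  · rw [h.curve_one]; simp
  have hcoe : ∀ {v : WassersteinSpace d}, EnergyFinite κ V t v → penalized (energyOne κ V) t τ u v
      = ((κ * (∫ x, entDensity v.measure x) + ∫ x, V t x ∂v.measure
        + dist u v ^ 2 / (2 * τ) : ℝ) : EReal) := fun hv => by
    rw [penalized, energyOne_eq_coe hv, ← EReal.coe_add]
  have htop : ∀ {v : WassersteinSpace d}, ¬ EnergyFinite κ V t v →
      penalized (energyOne κ V) t τ u v = ⊤ := fun hv => by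
    rw [penalized, energyOne_eq_top hκ hVc (hAB t ht) hv, EReal.top_add_coe]
  have hbot : ∀ v : WassersteinSpace d, penalized (energyOne κ V) t τ u v ≠ ⊥ := fun v => by
    by_cases hv : EnergyFinite κ V t v
    · rw [hcoe hv]; exact EReal.coe_ne_bot _
    · rw [htop hv]; exact top_ne_bot
  by_cases hfin : EnergyFinite κ V t v₀ ∧ EnergyFinite κ V t v₁
  swap
  · rw [combo_eq_top (hbot v₀) (hbot v₁) _ (sub_pos.2 hs1) hs0]
    · exact le_top
    · rw [not_and_or] at hfin
      exact hfin.imp htop htop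
  obtain ⟨f₀, f₁⟩ := hfin
  obtain ⟨e1, e2⟩ := H f₀.1 f₁.1 s hs
  obtain ⟨p1, p2⟩ := h.integrable_curve (convexOn_sub_max hV1 hV3 hT ht) (hAB t ht) f₀.2 f₁.2 hs
  rw [hcoe ⟨e1, p1⟩, hcoe f₀, hcoe f₁, ← EReal.coe_mul, ← EReal.coe_mul, ← EReal.coe_add,
    ← EReal.coe_sub, EReal.coe_le_coe_iff]
  set Λ := (negBound lam T).toReal with hΛ
  set ν := max (lam t) (-Λ) with hν
  set D := ∫ p, ‖p.2.1 - p.2.2‖ ^ 2 ∂π with hD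
  have hτΛ : τ * Λ < 1 := by
    have hlt := negBound_lt_top hV1.1 hT
    have h1 : negBound lam T < (ENNReal.ofReal τ)⁻¹ := ENNReal.lt_inv_iff_lt_inv.1 hτT
    rw [← ENNReal.ofReal_inv_of_pos hτ, ENNReal.lt_ofReal_iff_toReal_lt hlt.ne, ← hΛ,
      ← one_div, lt_div_iff₀ hτ] at h1
    linarith
  have hν1 : 0 ≤ 1 + τ * ν := by
    have := mul_le_mul_of_nonneg_left (le_max_right (lam t) (-Λ)) hτ.le
    linarith
  have hd := h.dist_sq_curve_le hs
  have hss : 0 ≤ s * (1 - s) := mul_nonneg hs.1 (sub_nonneg.2 hs.2)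
  -- The condition τ < 1/λ_T⁻ is used here: 1 + τν ≥ 0 allows D to replace d²(v₀, v₁). At
  -- exceptional times λ(t) may lie below -Λ and 1 + τλ(t) may be negative, which is why ν appears.
  have hkey : (1 + τ * lam t) * dist v₀ v₁ ^ 2 ≤ (1 + τ * ν) * D := by
    refine le_trans ?_ (mul_le_mul_of_nonneg_left h.dist_sq_le hν1)
    gcongr
    exact le_max_left _ _
  have hd' : dist u (h.curve s) ^ 2 / (2 * τ) ≤ ((1 - s) * dist u v₀ ^ 2 + s * dist u v₁ ^ 2
      - s * (1 - s) * D) / (2 * τ) := by gcongr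
  have hk' : (1 + τ * lam t) / (2 * τ) * s * (1 - s) * dist v₀ v₁ ^ 2
      ≤ ν / 2 * (s * (1 - s)) * D + s * (1 - s) * D / (2 * τ) := by
    calc _ = s * (1 - s) * ((1 + τ * lam t) * dist v₀ v₁ ^ 2) / (2 * τ) := by ring
      _ ≤ s * (1 - s) * ((1 + τ * ν) * D) / (2 * τ) := by gcongr
      _ = _ := by field_simp; ring
  have hsplit : ((1 - s) * dist u v₀ ^ 2 + s * dist u v₁ ^ 2 - s * (1 - s) * D) / (2 * τ)
      = (1 - s) * (dist u v₀ ^ 2 / (2 * τ)) + s * (dist u v₁ ^ 2 / (2 * τ))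
        - s * (1 - s) * D / (2 * τ) := by ring
  linarith

end

end TimeDepFlow

theorem mainTheorem11 (d : ℕ) (κ : ℝ) (hκ : 0 ≤ κ)
    (V : ℝ → EuclideanSpace ℝ (Fin d) → ℝ) (lam : ℝ → ℝ)
    (hV1 : HypV1 V lam) (hV2 : HypV2 V) (hV3 : HypV3 V)
    (hμ : ∃ μ : WassersteinSpace d,
      μ.measure ≪ MeasureTheory.volume ∧ entropy μ < ⊤ ∧ potentialEnergy V 0 μ < ⊤) :
    HypE1 (energyOne κ V) ∧ HypE2 (energyOne κ V) ∧ HypE3 (energyOne κ V) ∧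
      HypE4 (energyOne κ V) ∧ HypE5 (energyOne κ V) lam :=
  ⟨hypE1_energyOne hκ hV1 hV2 hV3 hμ, hypE2_energyOne hκ hV1 hV2 hV3,
    hypE3_energyOne hκ hV1 hV2 hV3, hypE4_energyOne hκ hV1 hV2 hV3,
    hypE5_energyOne hκ hV1 hV2 hV3⟩
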